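/- For an integer $N\ge 1$ let $\Gamma_N$ be the star graph consisting of $N$ half-lines $[0,\infty)$ with their endpoints $0$ identified. Let $H^1(\Gamma_N)$ be the space of all $\psi\in L_2(\Gamma_N)$ whose restrictions $\psi_1,\dots,\psi_N$ to the edges belong to $H^1(0,\infty)$ and satisfy $\psi_1(0)=\dots=\psi_N(0)$. Let $\gamma\ge 1/2$. For $V:\Gamma_N\to\mathbb R$ with $V_-=\max(-V,0)\in L_{\gamma+1/2}(\Gamma_N)$ and $V_+=\max(V,0)\in L_1^{\rm loc}(\Gamma_N)$, let $H=-\frac{d^2}{dx^2}+V$ be the self-adjoint operator in $L_2(\Gamma_N)$ associated with the quadratic form $$ h[\psi]=\int_{\Gamma_N}\left(|\psi'|^2+V|\psi|^2\right)dx,\qquad \psi\in H^1(\Gamma_N)\cap L_2(\Gamma_N,V_+\,dx) $$ (the Schrödinger operator with Kirchhoff conditions at the vertex), and let $\operatorname{tr}H_-^\gamma$ be the sum of the $\gamma$-th powers of the absolute values of the negative eigenvalues of $H$, counted with multiplicities. Let $L_{\gamma,N}\in[0,\infty]$ be the optimal (that is, smallest possible) constant such that $$ \operatorname{tr}H_-^\gamma\le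 L_{\gamma,N}\int_{\Gamma_N}V_-^{\gamma+1/2}\,dx $$ for all such $V$. Likewise, let $L_\gamma\in[0,\infty]$ be the optimal constant such that $$ \operatorname{tr}\left(-\frac{d^2}{dx^2}+V\right)_-^\gamma\le L_\gamma\int_{\mathbb R}V_-^{\gamma+1/2}\,dx $$ for all $V:\mathbb R\to\mathbb R$ with $V_-\in L_{\gamma+1/2}(\mathbb R)$ and $V_+\in L_1^{\rm loc}(\mathbb R)$, where $-\frac{d^2}{dx^2}+V$ is the self-adjoint operator in $L_2(\mathbb R)$ associated with the form $\int_{\mathbb R}(|\psi'|^2+V|\psi|^2)\,dx$ on $H^1(\mathbb R)\cap L_2(\mathbb R,V_+\,dx)$. If $N$ is even, then $L_{\gamma,N}=L_\gamma$. If $N$ is odd, then $L_{\gamma,N}\le\frac{N+1}{N}\,L_\gamma$. -/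

import Mathlib

open MeasureTheory

noncomputable section

namespace StarLT

/-! ### Operators given by quadratic forms, and their negative eigenvalues -/

section Form

variable {E : Type*} [NormedAddCommGroup E] [InnerProductSpace ℂ E]

/-- For a sesquilinear form `h` (antilinear in the first argument) with form domain `D` in a
Hilbert space `E`, this says that `u` lies in the operator domain of the operator `H` associated
with the form, and that `H u = f`. -/
def OperatorRel (D : Set E) (h : E → E → ℂ) (u f : E) : Prop :=
  u ∈ D ∧ ∀ v ∈ D, h v u = inner ℂ v f

/-- The multiplicity of `t` as an eigenvalue of the operator associated with the form, that is,
the dimension of the space of all `u` with `H u = t u` (`0` if `t` is not an eigenvalue). -/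
def multiplicity (D : Set E) (h : E → E → ℂ) (t : ℝ) : ℕ∞ :=
  Cardinal.toENat
    (Module.rank ℂ (Submodule.span ℂ {u : E | OperatorRel D h u ((t : ℂ) • u)}))

/-- `tr H_-^γ`: the sum of the `γ`-th powers of the absolute values of the negative eigenvalues,
counted with multiplicities. -/
def negTrace (D : Set E) (h : E → E → ℂ) (γ : ℝ) : ENNReal :=
  ∑' t : Set.Iio (0 : ℝ),
    (multiplicity D h (t : ℝ) : ENNReal) * ENNReal.ofReal (|(t : ℝ)| ^ γ)

end Form

/-! ### Sobolev functions on an open set of the line -/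

/-- `g` is a weak derivative of `u` on the open set `Ω`. -/
def HasWeakDeriv (Ω : Set ℝ) (u g : ℝ → ℂ) : Prop :=
  ∀ φ : ℝ → ℝ, ContDiff ℝ (⊤ : ℕ∞) φ → HasCompactSupport φ → tsupport φ ⊆ Ω →
    ∫ x in Ω, ((deriv φ x : ℝ) : ℂ) * u x = -∫ x in Ω, ((φ x : ℝ) : ℂ) * g x

/-- `u` has a weak derivative in `L²(Ω)`. -/
def HasL2WeakDeriv (Ω : Set ℝ) (u : ℝ → ℂ) : Prop :=
  ∃ g : ℝ → ℂ, MemLp g 2 (volume.restrict Ω) ∧ HasWeakDeriv Ω u g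

/-- `u ∈ H¹(Ω)`. -/
def MemH1 (Ω : Set ℝ) (u : ℝ → ℂ) : Prop :=
  MemLp u 2 (volume.restrict Ω) ∧ HasL2WeakDeriv Ω u

open Classical in
/-- The weak derivative in `L²(Ω)` (unique almost everywhere on `Ω`) of a function that has one. -/
def weakDeriv (Ω : Set ℝ) (u : ℝ → ℂ) : ℝ → ℂ :=
  if h : HasL2WeakDeriv Ω u then h.choose else 0

/-- The continuous representative on `[0,∞)` of `u` takes the value `c` at `0`. -/
def HasBoundaryValue (u : ℝ → ℂ) (c : ℂ) : Prop :=
  ∃ w : ℝ → ℂ, ContinuousOn w (Set.Ici 0) ∧ w =ᵐ[volume.restrict (Set.Ioi 0)] u ∧ w 0 = c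

/-! ### The Schrödinger operator on the star graph with `N` half-line edges

Functions on the star graph are families of functions on `(0,∞)` indexed by the edges `Fin N`. -/

/-- `L²(Γ_N)`. -/
abbrev StarL2 (N : ℕ) : Type :=
  PiLp 2 (fun _ : Fin N => Lp ℂ 2 (volume.restrict (Set.Ioi (0 : ℝ))))

/-- The Sobolev space `H¹(Γ_N)`: each restriction to an edge is in `H¹(0,∞)`, and the values at
the vertex coincide. -/
def starH1 (N : ℕ) : Set (StarL2 N) :=
  {u | (∀ j, MemH1 (Set.Ioi 0) (u j)) ∧ ∃ c : ℂ, ∀ j, HasBoundaryValue (u j) c}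

/-- The form domain `H¹(Γ_N) ∩ L²(Γ_N, V₊ dx)`. -/
def starDomain {N : ℕ} (V : Fin N → ℝ → ℝ) : Set (StarL2 N) :=
  {u | u ∈ starH1 N ∧ ∀ j, IntegrableOn (fun x => max (V j x) 0 * ‖u j x‖ ^ 2) (Set.Ioi 0)}

/-- The sesquilinear form of `h[u] = ∫ (|u'|² + V |u|²) dx` on the star graph. -/
def starForm {N : ℕ} (V : Fin N → ℝ → ℝ) (v u : StarL2 N) : ℂ :=
  ∑ j, ∫ x in Set.Ioi (0 : ℝ),
    (starRingEnd ℂ (weakDeriv (Set.Ioi 0) (v j) x) * weakDeriv (Set.Ioi 0) (u j) x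
      + (V j x : ℂ) * (starRingEnd ℂ (v j x) * u j x))

/-- Admissible potentials: `V₊ ∈ L¹_loc(Γ_N)` (up to and including the vertex) and
`V₋ ∈ L^p(Γ_N)`. -/
def StarPotential {N : ℕ} (p : ℝ) (V : Fin N → ℝ → ℝ) : Prop :=
  ∀ j, LocallyIntegrableOn (fun x => max (V j x) 0) (Set.Ici 0) ∧
    MemLp (fun x => max (-V j x) 0) (ENNReal.ofReal p) (volume.restrict (Set.Ioi 0))

/-- The Lieb–Thirring inequality on `Γ_N` holds with the constant `L`. -/
def StarLiebThirring (γ : ℝ) (N : ℕ) (L : ENNReal) : Prop :=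
  ∀ V : Fin N → ℝ → ℝ, StarPotential (γ + 1 / 2) V →
    negTrace (starDomain V) (starForm V) γ ≤
      L * ∑ j, ∫⁻ x in Set.Ioi (0 : ℝ), ENNReal.ofReal (max (-V j x) 0 ^ (γ + 1 / 2))

/-- The optimal constant `L_{γ,N}`. -/
def starConst (γ : ℝ) (N : ℕ) : ENNReal :=
  sInf {L : ENNReal | StarLiebThirring γ N L}

/-! ### The Schrödinger operator on the line -/

/-- `L²(ℝ)`. -/
abbrev LineL2 : Type := Lp ℂ 2 (volume : Measure ℝ)

/-- The form domain `H¹(ℝ) ∩ L²(ℝ, V₊ dx)`. -/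
def lineDomain (V : ℝ → ℝ) : Set LineL2 :=
  {u | MemH1 Set.univ u ∧ Integrable (fun x => max (V x) 0 * ‖u x‖ ^ 2)}

/-- The sesquilinear form of `h[u] = ∫ (|u'|² + V |u|²) dx` on the line. -/
def lineForm (V : ℝ → ℝ) (v u : LineL2) : ℂ :=
  ∫ x : ℝ, (starRingEnd ℂ (weakDeriv Set.univ v x) * weakDeriv Set.univ u x
    + (V x : ℂ) * (starRingEnd ℂ (v x) * u x))

/-- Admissible potentials on the line: `V₊ ∈ L¹_loc(ℝ)` and `V₋ ∈ L^p(ℝ)`. -/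
def LinePotential (p : ℝ) (V : ℝ → ℝ) : Prop :=
  LocallyIntegrable (fun x => max (V x) 0) ∧
    MemLp (fun x => max (-V x) 0) (ENNReal.ofReal p) volume

/-- The Lieb–Thirring inequality on the line holds with the constant `L`. -/
def LineLiebThirring (γ : ℝ) (L : ENNReal) : Prop :=
  ∀ V : ℝ → ℝ, LinePotential (γ + 1 / 2) V →
    negTrace (lineDomain V) (lineForm V) γ ≤
      L * ∫⁻ x : ℝ, ENNReal.ofReal (max (-V x) 0 ^ (γ + 1 / 2))

/-- The optimal constant `L_γ` on the line. -/
def lineConst (γ : ℝ) : ENNReal :=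
  sInf {L : ENNReal | LineLiebThirring γ L}

end StarLT

end

/-!
By Glazman's lemma, sums of powers of negative eigenvalues are governed by trial subspaces. So if
maps `J R` into the domains of forms `h' R` become isometric in the limit, and the pulled back forms
converge to `h`, then every bound on the traces of the `h' R` passes to `h`.

For the upper bounds, the edges of the star graph are joined in pairs to lines. By continuity at the
vertex, a function in `H¹(Γ_N)` restricts to a function in `H¹(ℝ)` on each line, so the form on
`Γ_N` is the restriction of a direct sum of forms on lines. If `N` is odd, the edge that carries the
least `∫ V₋ ^ (γ + 1 / 2)` is left over; it is joined to its own mirror image, with weight `1 / √2`.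
That integral, at most `1 / N` of the total, is counted twice, hence the factor `(N + 1) / N`.

For the lower bound, a potential on the line is shifted by `R` into one edge of the star graph. The
shifted functions, cut off near the vertex, are trial functions there, and `R → ∞` recovers the
trace on the line.
-/

noncomputable section

open Filter Topology

namespace StarLT

/-! ### Hermitian forms -/

section HermitianForm

variable {E : Type*} [NormedAddCommGroup E] [InnerProductSpace ℂ E]

/-- `h` is a Hermitian sesquilinear form on the linear subspace `D`. The domain is a bare set and
`h` a total function, as in `OperatorRel`; the values of `h` outside of `D` are irrelevant. -/
structure IsHermitianForm (D : Set E) (h : E → E → ℂ) : Prop where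
  zero_mem : (0 : E) ∈ D
  add_mem : ∀ {u v : E}, u ∈ D → v ∈ D → u + v ∈ D
  smul_mem : ∀ (c : ℂ) {u : E}, u ∈ D → c • u ∈ D
  add_right : ∀ {v u u' : E}, v ∈ D → u ∈ D → u' ∈ D → h v (u + u') = h v u + h v u'
  smul_right : ∀ (c : ℂ) {v u : E}, v ∈ D → u ∈ D → h v (c • u) = c * h v u
  conj_symm : ∀ {u v : E}, u ∈ D → v ∈ D → starRingEnd ℂ (h u v) = h v u

namespace IsHermitianForm

variable {D : Set E} {h : E → E → ℂ} {s t : ℝ} {u v v' x f f' : E}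

/-- The form domain as a subspace. -/
def domain (hf : IsHermitianForm D h) : Submodule ℂ E where
  carrier := D
  zero_mem' := hf.zero_mem
  add_mem' := hf.add_mem
  smul_mem' c _ hu := hf.smul_mem c hu

theorem mono (hf : IsHermitianForm D h) {S : Submodule ℂ E} (hS : (S : Set E) ⊆ D) :
    IsHermitianForm (S : Set E) h where
  zero_mem := S.zero_mem
  add_mem := S.add_mem
  smul_mem c _ hu := S.smul_mem c hu
  add_right hv hu hu' := hf.add_right (hS hv) (hS hu) (hS hu')
  smul_right c _ _ hv hu := hf.smul_right c (hS hv) (hS hu)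
  conj_symm hu hv := hf.conj_symm (hS hu) (hS hv)

theorem add_left (hf : IsHermitianForm D h) (hv : v ∈ D) (hv' : v' ∈ D) (hu : u ∈ D) :
    h (v + v') u = h v u + h v' u := by
  rw [← hf.conj_symm hu (hf.add_mem hv hv'), hf.add_right hu hv hv', map_add,
    hf.conj_symm hu hv, hf.conj_symm hu hv']

theorem smul_left (hf : IsHermitianForm D h) (c : ℂ) (hv : v ∈ D) (hu : u ∈ D) :
    h (c • v) u = starRingEnd ℂ c * h v u := by
  rw [← hf.conj_symm hu (hf.smul_mem c hv), hf.smul_right c hu hv, map_mul, hf.conj_symm hu hv]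

theorem zero_left (hf : IsHermitianForm D h) (hu : u ∈ D) : h 0 u = 0 := by
  simpa using hf.smul_left 0 hf.zero_mem hu

theorem zero_right (hf : IsHermitianForm D h) (hu : u ∈ D) : h u 0 = 0 := by
  simpa using hf.smul_right 0 hu hf.zero_mem

theorem sum_mem (hf : IsHermitianForm D h) {ι : Type*} (s : Finset ι) {u : ι → E}
    (hu : ∀ i, u i ∈ D) : ∑ i ∈ s, u i ∈ D :=
  hf.domain.sum_mem fun i _ => hu i

theorem sum_right (hf : IsHermitianForm D h) {ι : Type*} (s : Finset ι) {u : ι → E}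
    (hv : v ∈ D) (hu : ∀ i, u i ∈ D) : h v (∑ i ∈ s, u i) = ∑ i ∈ s, h v (u i) := by
  induction s using Finset.cons_induction with
  | empty => simpa using hf.zero_right hv
  | cons a s ha ih =>
    rw [Finset.sum_cons, Finset.sum_cons, hf.add_right hv (hu a) (hf.sum_mem s hu), ih]

theorem sum_left (hf : IsHermitianForm D h) {ι : Type*} (s : Finset ι) {u : ι → E}
    (hv : v ∈ D) (hu : ∀ i, u i ∈ D) : h (∑ i ∈ s, u i) v = ∑ i ∈ s, h (u i) v := by
  rw [← hf.conj_symm hv (hf.sum_mem s hu), hf.sum_right s hv hu, map_sum]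
  exact Finset.sum_congr rfl fun i _ => hf.conj_symm hv (hu i)

theorem apply_sum_smul (hf : IsHermitianForm D h) {ι : Type*} [Fintype ι] {w : ι → E}
    (hw : ∀ i, w i ∈ D) (c : ι → ℂ) :
    h (∑ i, c i • w i) (∑ i, c i • w i)
      = ∑ i, ∑ j, starRingEnd ℂ (c i) * c j * h (w i) (w j) := by
  have hcw : ∀ i, c i • w i ∈ D := fun i => hf.smul_mem _ (hw i)
  rw [hf.sum_left _ (hf.sum_mem _ hcw) hcw]
  refine Finset.sum_congr rfl fun i _ => ?_
  rw [hf.sum_right _ (hcw i) hcw]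
  refine Finset.sum_congr rfl fun j _ => ?_
  rw [hf.smul_left _ (hw i) (hcw j), hf.smul_right _ (hw i) (hw j), mul_assoc]

theorem re_smul_smul (hf : IsHermitianForm D h) (c : ℂ) (hu : u ∈ D) :
    (h (c • u) (c • u)).re = ‖c‖ ^ 2 * (h u u).re := by
  rw [hf.smul_left c hu (hf.smul_mem c hu), hf.smul_right c hu hu, ← mul_assoc,
    Complex.conj_mul', ← Complex.ofReal_pow, Complex.re_ofReal_mul]

theorem re_add_smul (hf : IsHermitianForm D h) (s : ℝ) (hu : u ∈ D) (hx : x ∈ D) :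
    (h (u + (s : ℂ) • x) (u + (s : ℂ) • x)).re
      = (h u u).re + 2 * s * (h x u).re + s ^ 2 * (h x x).re := by
  have hsx := hf.smul_mem (s : ℂ) hx
  rw [hf.add_left hu hsx (hf.add_mem hu hsx), hf.add_right hu hu hsx, hf.add_right hsx hu hsx,
    hf.smul_right _ hu hx, hf.smul_left _ hx hu, hf.smul_left _ hx hsx, hf.smul_right _ hx hx,
    ← hf.conj_symm hx hu]
  simp only [Complex.conj_ofReal, Complex.add_re, Complex.re_ofReal_mul, Complex.conj_re]
  ring

theorem operatorRel_add (hf : IsHermitianForm D h) (hu : OperatorRel D h u f)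
    (hv : OperatorRel D h v f') : OperatorRel D h (u + v) (f + f') :=
  ⟨hf.add_mem hu.1 hv.1, fun w hw => by
    rw [hf.add_right hw hu.1 hv.1, hu.2 w hw, hv.2 w hw, inner_add_right]⟩

theorem operatorRel_smul (hf : IsHermitianForm D h) (c : ℂ) (hu : OperatorRel D h u f) :
    OperatorRel D h (c • u) (c • f) :=
  ⟨hf.smul_mem c hu.1, fun w hw => by
    rw [hf.smul_right c hw hu.1, hu.2 w hw, inner_smul_right]⟩

theorem operatorRel_zero (hf : IsHermitianForm D h) : OperatorRel D h 0 0 :=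
  ⟨hf.zero_mem, fun _ hv => by rw [hf.zero_right hv, inner_zero_right]⟩

/-- The space of all `u` with `H u = t u`, where `H` is the operator associated with the form. -/
def eigenspace (hf : IsHermitianForm D h) (t : ℝ) : Submodule ℂ E where
  carrier := {u | OperatorRel D h u ((t : ℂ) • u)}
  zero_mem' := by simpa using hf.operatorRel_zero
  add_mem' hu hv := by simpa using hf.operatorRel_add hu hv
  smul_mem' c u hu := by simpa [smul_comm c] using hf.operatorRel_smul c hu

theorem multiplicity_eq (hf : IsHermitianForm D h) (t : ℝ) :
    multiplicity D h t = Cardinal.toENat (Module.rank ℂ (hf.eigenspace t)) :=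
  congrArg (fun S : Submodule ℂ E => Cardinal.toENat (Module.rank ℂ S))
    (Submodule.span_eq (hf.eigenspace t))

theorem inner_eq_zero (hf : IsHermitianForm D h) (hst : s ≠ t)
    (hu : OperatorRel D h u ((s : ℂ) • u)) (hv : OperatorRel D h v ((t : ℂ) • v)) :
    inner ℂ u v = 0 := by
  have hvu : h v u = s * inner ℂ v u := by rw [hu.2 v hv.1, inner_smul_right]
  have huv : h u v = t * inner ℂ u v := by rw [hv.2 u hu.1, inner_smul_right]
  rw [← hf.conj_symm hv.1 hu.1, hvu, map_mul, inner_conj_symm, Complex.conj_ofReal] at huv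
  exact (mul_eq_mul_right_iff.1 huv).resolve_left (by exact_mod_cast hst)

theorem card_le_multiplicity (hf : IsHermitianForm D h) {ι : Type*} [Fintype ι] {u : ι → E}
    (hu : LinearIndependent ℂ u) (ht : ∀ i, OperatorRel D h (u i) ((t : ℂ) • u i)) :
    (Fintype.card ι : ℕ∞) ≤ multiplicity D h t := by
  rw [hf.multiplicity_eq, Cardinal.natCast_le_toENat]
  have hu' : LinearIndependent ℂ (fun i => (⟨u i, ht i⟩ : hf.eigenspace t)) :=
    LinearIndependent.of_comp (hf.eigenspace t).subtype hu
  simpa using hu'.cardinal_lift_le_rank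

end IsHermitianForm

theorem apply_eigenvectors {D : Set E} {h : E → E → ℂ} {ι : Type*} [DecidableEq ι] {u : ι → E}
    (hu : Orthonormal ℂ u) {t : ι → ℝ} (ht : ∀ i, OperatorRel D h (u i) ((t i : ℂ) • u i))
    (i j : ι) : h (u i) (u j) = if i = j then (t i : ℂ) else 0 := by
  rw [(ht j).2 _ (ht i).1, inner_smul_right, orthonormal_iff_ite.1 hu i j]
  split_ifs with hij
  · rw [hij, mul_one]
  · rw [mul_zero]

end HermitianForm

/-! ### Closed forms and the variational principle below zero -/

section WeakConvergence

variable {E : Type*} [NormedAddCommGroup E] [InnerProductSpace ℂ E]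

theorem inner_piLp_single_left {ι : Type*} [Fintype ι] [DecidableEq ι] {F : ι → Type*}
    [∀ j, NormedAddCommGroup (F j)] [∀ j, InnerProductSpace ℂ (F j)] (j : ι) (e : F j)
    (u : PiLp 2 F) : inner ℂ (PiLp.single 2 j e) u = inner ℂ e (u j) := by
  rw [PiLp.inner_apply, Finset.sum_eq_single j]
  · simp
  · intro i _ hij
    simp [hij]
  · simp

/-- Weak convergence of a sequence in an inner product space. -/
def TendstoWeakly (v : ℕ → E) (u : E) : Prop :=
  ∀ e : E, Tendsto (fun n => inner ℂ e (v n)) atTop (𝓝 (inner ℂ e u))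

namespace TendstoWeakly

variable {v : ℕ → E} {u : E} {m r : ℝ} {ns : ℕ → ℕ}

theorem comp (h : TendstoWeakly v u) (hns : Tendsto ns atTop atTop) :
    TendstoWeakly (v ∘ ns) u :=
  fun e => (h e).comp hns

theorem norm_sq_le (h : TendstoWeakly v u) (hv : Tendsto (fun n => ‖v n‖ ^ 2) atTop (𝓝 m)) :
    ‖u‖ ^ 2 ≤ m := by
  have hre : Tendsto (fun n => RCLike.re (inner ℂ u (v n))) atTop (𝓝 (‖u‖ ^ 2)) := by
    rw [← inner_self_eq_norm_sq (𝕜 := ℂ)]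
    exact (RCLike.continuous_re.tendsto _).comp (h u)
  have hlim : Tendsto (fun n => 2 * RCLike.re (inner ℂ u (v n)) - ‖u‖ ^ 2) atTop
      (𝓝 (2 * ‖u‖ ^ 2 - ‖u‖ ^ 2)) := (hre.const_mul 2).sub_const _
  have := le_of_tendsto_of_tendsto' hlim hv fun n => by
    nlinarith [sq_nonneg ‖u - v n‖, norm_sub_sq (𝕜 := ℂ) u (v n)]
  linarith

theorem mem_orthogonal (h : TendstoWeakly v u) {S : Submodule ℂ E} (hv : ∀ n, v n ∈ Sᗮ) :
    u ∈ Sᗮ :=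
  fun e he => tendsto_nhds_unique (h e) <|
    tendsto_const_nhds.congr fun n => (Submodule.inner_right_of_mem_orthogonal he (hv n)).symm

theorem piLp_apply {ι : Type*} [Fintype ι] {F : ι → Type*} [∀ j, NormedAddCommGroup (F j)]
    [∀ j, InnerProductSpace ℂ (F j)] {v : ℕ → PiLp 2 F} {u : PiLp 2 F} (h : TendstoWeakly v u)
    (j : ι) : TendstoWeakly (fun n => v n j) (u j) := by
  classical
  intro e
  simpa only [inner_piLp_single_left] using h (PiLp.single 2 j e)

end TendstoWeakly

theorem exists_subseq_tendstoWeakly_of_separableSpace [CompleteSpace E]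
    [TopologicalSpace.SeparableSpace E] {v : ℕ → E} {r : ℝ} (hv : ∀ n, ‖v n‖ ≤ r) :
    ∃ (u : E) (ns : ℕ → ℕ), StrictMono ns ∧ TendstoWeakly (v ∘ ns) u := by
  obtain ⟨F, -, ns, hns, hF⟩ := WeakDual.isSeqCompact_closedBall ℂ E (0 : StrongDual ℂ E) r
    (x := fun n => StrongDual.toWeakDual (InnerProductSpace.toDual ℂ E (v n))) fun n => by
      rw [Set.mem_preimage, mem_closedBall_zero_iff]
      exact ((InnerProductSpace.toDual ℂ E).norm_map (v n)).trans_le (hv n)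
  set u := (InnerProductSpace.toDual ℂ E).symm (WeakDual.toStrongDual F)
  refine ⟨u, ns, hns, fun e => ?_⟩
  have hFe : Tendsto (fun n => inner ℂ (v (ns n)) e) atTop (𝓝 (F e)) :=
    ((WeakDual.eval_continuous e).tendsto F).comp hF
  have hue : F e = inner ℂ u e := (InnerProductSpace.toDual_symm_apply ..).symm
  have hconj := (Complex.continuous_conj.tendsto _).comp hFe
  rw [hue, inner_conj_symm] at hconj
  exact hconj.congr fun n => inner_conj_symm _ _

theorem exists_subseq_tendstoWeakly [CompleteSpace E] {v : ℕ → E} {r : ℝ}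
    (hv : ∀ n, ‖v n‖ ≤ r) :
    ∃ (u : E) (ns : ℕ → ℕ), StrictMono ns ∧ TendstoWeakly (v ∘ ns) u := by
  set S := (Submodule.span ℂ (Set.range v)).topologicalClosure
  have : TopologicalSpace.SeparableSpace S :=
    (Set.countable_range v).isSeparable.span.closure.separableSpace
  have : CompleteSpace S := Submodule.topologicalClosure.completeSpace _
  have hvS (n : ℕ) : v n ∈ S :=
    Submodule.le_topologicalClosure _ (Submodule.subset_span (Set.mem_range_self n))
  obtain ⟨u, ns, hns, hu⟩ :=
    exists_subseq_tendstoWeakly_of_separableSpace (v := fun n => (⟨v n, hvS n⟩ : S)) hv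
  refine ⟨u, ns, hns, fun e => ?_⟩
  have hproj (y : S) : inner ℂ e (y : E) = inner ℂ (S.orthogonalProjectionOnto e) y := by
    rw [Submodule.coe_inner]
    exact (Submodule.inner_orthogonalProjectionOnto_eq_of_mem_right y e).symm
  rw [hproj u]
  exact (hu (S.orthogonalProjectionOnto e)).congr fun n => (hproj _).symm

end WeakConvergence

section ClosedForm

variable {E : Type*} [NormedAddCommGroup E] [InnerProductSpace ℂ E]
variable {D : Set E} {h : E → E → ℂ}

/-- A closed Hermitian form that is bounded from below. Closedness is encoded as weak sequential
closedness of the bounded sublevel sets of the form. -/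
structure IsClosedForm (D : Set E) (h : E → E → ℂ) : Prop extends IsHermitianForm D h where
  bddBelow : ∃ C : ℝ, ∀ u ∈ D, -C * ‖u‖ ^ 2 ≤ (h u u).re
  isSeqClosed : ∀ {v : ℕ → E} {u : E} {r m : ℝ}, (∀ n, v n ∈ D) → (∀ n, ‖v n‖ ≤ r) →
    (∀ n, (h (v n) (v n)).re ≤ m) → TendstoWeakly v u → u ∈ D ∧ (h u u).re ≤ m

theorem IsClosedForm.mono (hc : IsClosedForm D h) {S : Submodule ℂ E} (hS : (S : Set E) ⊆ D)
    (hclosed : ∀ {v : ℕ → E} {u : E} {r m : ℝ}, (∀ n, v n ∈ S) → (∀ n, ‖v n‖ ≤ r) →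
      (∀ n, (h (v n) (v n)).re ≤ m) → TendstoWeakly v u → u ∈ S) :
    IsClosedForm (S : Set E) h where
  toIsHermitianForm := hc.toIsHermitianForm.mono hS
  bddBelow := hc.bddBelow.imp fun _ hC u hu => hC u (hS hu)
  isSeqClosed hvS hvr hvm hvu :=
    ⟨hclosed hvS hvr hvm hvu, (hc.isSeqClosed (fun n => hS (hvS n)) hvr hvm hvu).2⟩

theorem IsClosedForm.re_le_of_tendsto (hc : IsClosedForm D h) {v : ℕ → E} {u : E} {r m : ℝ}
    (hvD : ∀ n, v n ∈ D) (hvr : ∀ n, ‖v n‖ ≤ r)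
    (hvm : Tendsto (fun n => (h (v n) (v n)).re) atTop (𝓝 m)) (hvu : TendstoWeakly v u) :
    u ∈ D ∧ (h u u).re ≤ m := by
  have hclose : ∀ ε > 0, u ∈ D ∧ (h u u).re ≤ m + ε := fun ε hε => by
    obtain ⟨k, hk⟩ := eventually_atTop.1 (hvm.eventually_le_const (lt_add_of_pos_right m hε))
    exact hc.isSeqClosed (fun n => hvD (n + k)) (fun n => hvr (n + k))
      (fun n => hk _ (Nat.le_add_left k n)) (hvu.comp (tendsto_add_atTop_nat k))
  exact ⟨(hclose 1 one_pos).1, le_of_forall_pos_le_add fun ε hε => (hclose ε hε).2⟩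

theorem IsClosedForm.exists_minimizingSeq (hc : IsClosedForm D h) (T : Submodule ℂ E) {w : E}
    (hwD : w ∈ D) (hwT : w ∈ T) (hw : w ≠ 0) {l : ℝ} (hwl : (h w w).re ≤ l * ‖w‖ ^ 2) :
    ∃ m ≤ l, (∀ y ∈ D, y ∈ T → m * ‖y‖ ^ 2 ≤ (h y y).re) ∧
      ∃ v : ℕ → E, (∀ n, v n ∈ D ∧ v n ∈ T ∧ ‖v n‖ = 1) ∧
        Tendsto (fun n => (h (v n) (v n)).re) atTop (𝓝 m) := by
  set S : Set ℝ := (fun v => (h v v).re) '' {v | v ∈ D ∧ v ∈ T ∧ ‖v‖ = 1}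
  have hquotient : ∀ {v}, v ∈ D → v ∈ T → v ≠ 0 → (h v v).re / ‖v‖ ^ 2 ∈ S := by
    intro v hvD hvT hv
    have hnorm : ‖v‖ ≠ 0 := norm_ne_zero_iff.2 hv
    refine ⟨((‖v‖⁻¹ : ℝ) : ℂ) • v, ⟨hc.smul_mem _ hvD, T.smul_mem _ hvT, ?_⟩, ?_⟩
    · rw [norm_smul, Complex.norm_real, norm_inv, norm_norm, inv_mul_cancel₀ hnorm]
    · simp only [hc.re_smul_smul _ hvD, Complex.norm_real, norm_inv, norm_norm]
      field_simp
  have hbdd : BddBelow S := by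
    obtain ⟨C, hC⟩ := hc.bddBelow
    refine ⟨-C, ?_⟩
    rintro _ ⟨v, ⟨hvD, -, hv⟩, rfl⟩
    simpa [hv] using hC v hvD
  have hwS := hquotient hwD hwT hw
  obtain ⟨r, -, hr, hrS⟩ := exists_seq_tendsto_sInf ⟨_, hwS⟩ hbdd
  choose v hv hvr using hrS
  refine ⟨sInf S, ?_, fun y hyD hyT => ?_, v, hv, by simpa only [hvr] using hr⟩
  · exact (csInf_le hbdd hwS).trans ((div_le_iff₀ (by positivity)).2 hwl)
  · rcases eq_or_ne y 0 with rfl | hy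
    · simp [hc.zero_right hc.zero_mem]
    · exact (le_div_iff₀ (by positivity)).1 (csInf_le hbdd (hquotient hyD hyT hy))

theorem IsHermitianForm.eq_mul_inner_of_isMin (hf : IsHermitianForm D h) {T : Submodule ℂ E}
    {x : E} (hxD : x ∈ D) (hxT : x ∈ T) {m : ℝ} (hxm : (h x x).re = m * ‖x‖ ^ 2)
    (hmin : ∀ y ∈ D, y ∈ T → m * ‖y‖ ^ 2 ≤ (h y y).re) :
    ∀ y ∈ D, y ∈ T → h y x = m * inner ℂ y x := by
  have hre : ∀ y ∈ D, y ∈ T → (h y x).re = (m * inner ℂ y x : ℂ).re := by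
    intro y hyD hyT
    have hquadratic : ∀ s : ℝ, 0 ≤ ((h y y).re - m * ‖y‖ ^ 2) * (s * s)
        + 2 * ((h y x).re - (m * inner ℂ y x : ℂ).re) * s + 0 := fun s => by
      have hs := hmin (x + (s : ℂ) • y) (hf.add_mem hxD (hf.smul_mem _ hyD))
        (T.add_mem hxT (T.smul_mem _ hyT))
      rw [hf.re_add_smul s hxD hyD, norm_add_sq (𝕜 := ℂ), inner_smul_right, norm_smul,
        Complex.norm_real, Real.norm_eq_abs, mul_pow, sq_abs, hxm, ← inner_conj_symm x y] at hs
      simp only [RCLike.re_to_complex, Complex.re_ofReal_mul, Complex.conj_re] at hs ⊢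
      nlinarith
    have hdiscrim := discrim_le_zero hquadratic
    rw [discrim] at hdiscrim
    nlinarith [sq_nonneg ((h y x).re - (m * inner ℂ y x : ℂ).re)]
  intro y hyD hyT
  refine Complex.ext (hre y hyD hyT) ?_
  have him := hre (Complex.I • y) (hf.smul_mem _ hyD) (T.smul_mem _ hyT)
  rw [hf.smul_left _ hyD hxD, inner_smul_left] at him
  simpa using him

theorem IsClosedForm.exists_eigenvector [CompleteSpace E]
    (hc : IsClosedForm D h) {S : Submodule ℂ E} [S.HasOrthogonalProjection]
    (hS : ∀ u ∈ S, ∃ f ∈ S, OperatorRel D h u f) {w : E} (hwD : w ∈ D) (hwS : w ∈ Sᗮ)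
    (hw : w ≠ 0) {l : ℝ} (hl : l < 0) (hwl : (h w w).re ≤ l * ‖w‖ ^ 2) :
    ∃ x ∈ Sᗮ, ∃ m ≤ l, ‖x‖ = 1 ∧ OperatorRel D h x ((m : ℂ) • x) := by
  obtain ⟨m, hml, hmin, v, hv, hvm⟩ := hc.exists_minimizingSeq Sᗮ hwD hwS hw hwl
  obtain ⟨x, ns, hns, hvx⟩ := exists_subseq_tendstoWeakly fun n => (hv n).2.2.le
  have hxS : x ∈ Sᗮ := hvx.mem_orthogonal fun n => (hv (ns n)).2.1
  obtain ⟨hxD, hxm⟩ := hc.re_le_of_tendsto (fun n => (hv (ns n)).1) (fun n => (hv (ns n)).2.2.le)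
    (hvm.comp hns.tendsto_atTop) hvx
  -- As `m < 0`, no norm can be lost in the weak limit.
  have hx : ‖x‖ = 1 := by
    have hle : ‖x‖ ^ 2 ≤ 1 := hvx.norm_sq_le (by simp [(hv _).2.2])
    have hge := hmin x hxD hxS
    have hone : 1 ≤ ‖x‖ ^ 2 := by nlinarith
    exact (pow_eq_one_iff_of_nonneg (norm_nonneg x) two_ne_zero).1 (le_antisymm hle hone)
  have hEL := hc.eq_mul_inner_of_isMin hxD hxS
    (le_antisymm (by simpa [hx] using hxm) (hmin x hxD hxS)) hmin
  refine ⟨x, hxS, m, hml, hx, hxD, fun y hyD => ?_⟩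
  set p : E := S.starProjection y
  have hpS : p ∈ S := S.starProjection_apply_mem y
  obtain ⟨f, hfS, hpD, hpf⟩ := hS p hpS
  have hpx : h p x = 0 := by
    rw [← hc.conj_symm hxD hpD, hpf x hxD, Submodule.inner_left_of_mem_orthogonal hfS hxS, map_zero]
  have hyp : y - p ∈ Sᗮ := S.sub_starProjection_mem_orthogonal y
  have hypD : y - p ∈ D := hc.domain.sub_mem hyD hpD
  calc h y x = h (y - p) x + h p x := by rw [← hc.add_left hypD hpD hxD, sub_add_cancel]
    _ = m * inner ℂ (y - p) x := by rw [hpx, add_zero, hEL _ hypD hyp]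
    _ = inner ℂ y ((m : ℂ) • x) := by
      rw [inner_sub_left, Submodule.inner_right_of_mem_orthogonal hpS hxS, sub_zero,
        inner_smul_right]

end ClosedForm

section Eigensystem

variable {E : Type*} [NormedAddCommGroup E] [InnerProductSpace ℂ E]
variable {D : Set E} {h : E → E → ℂ}

theorem exists_mem_orthogonal_of_finrank_lt {S W : Submodule ℂ E} [FiniteDimensional ℂ S]
    (hSW : Module.finrank ℂ S < Module.finrank ℂ W) : ∃ w ∈ W, w ∈ Sᗮ ∧ w ≠ 0 := by
  have := Module.finite_of_finrank_pos (Nat.zero_lt_of_lt hSW)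
  obtain ⟨w, hw, hw0⟩ := Submodule.exists_mem_ne_zero_of_ne_bot <|
    LinearMap.ker_ne_bot_of_finrank_lt
      (f := S.orthogonalProjectionOnto.toLinearMap ∘ₗ W.subtype) hSW
  exact ⟨w, w.2, S.orthogonalProjectionOnto_eq_zero_iff.1 (LinearMap.mem_ker.1 hw),
    by simpa using hw0⟩

theorem orthonormal_update_insert {ι : Type*} [DecidableEq ι] {s : Finset ι} {a : ι} (ha : a ∉ s)
    {u : ι → E} (hu : Orthonormal ℂ fun i : s => u i) {x : E} (hx : ‖x‖ = 1)
    (hxs : x ∈ (Submodule.span ℂ (u '' s))ᗮ) :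
    Orthonormal ℂ fun i : ↥(insert a s) => Function.update u a x i := by
  have hne : ∀ {i}, i ∈ s → i ≠ a := fun hi hia => ha (hia ▸ hi)
  have hux : ∀ i ∈ s, inner ℂ (u i) x = 0 := fun i hi =>
    Submodule.inner_right_of_mem_orthogonal
      (Submodule.subset_span (Set.mem_image_of_mem u hi)) hxs
  constructor
  · rintro ⟨i, hi⟩
    rcases Finset.mem_insert.1 hi with rfl | his
    · simpa using hx
    · simpa [hne his] using hu.1 ⟨i, his⟩
  · rintro ⟨i, hi⟩ ⟨j, hj⟩ hij
    replace hij : i ≠ j := fun h => hij (Subtype.ext h)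
    rcases Finset.mem_insert.1 hi with rfl | his <;> rcases Finset.mem_insert.1 hj with rfl | hjs
    · exact absurd rfl hij
    · simpa [hne hjs] using inner_eq_zero_symm.1 (hux j hjs)
    · simpa [hne his] using hux i his
    · simpa [hne his, hne hjs] using
        hu.2 (i := ⟨i, his⟩) (j := ⟨j, hjs⟩) fun h => hij (Subtype.ext_iff.1 h)

theorem IsHermitianForm.exists_operatorRel_of_mem_span (hf : IsHermitianForm D h) {s : Set E}
    (hs : ∀ u ∈ s, ∃ t : ℝ, OperatorRel D h u ((t : ℂ) • u)) :
    ∀ u ∈ Submodule.span ℂ s, ∃ f ∈ Submodule.span ℂ s, OperatorRel D h u f := by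
  intro u hu
  induction hu using Submodule.span_induction with
  | mem u hu =>
    obtain ⟨t, ht⟩ := hs u hu
    exact ⟨_, Submodule.smul_mem _ _ (Submodule.subset_span hu), ht⟩
  | zero => exact ⟨0, Submodule.zero_mem _, hf.operatorRel_zero⟩
  | add u v _ _ hu hv =>
    obtain ⟨f, hf', huf⟩ := hu
    obtain ⟨g, hg', hvg⟩ := hv
    exact ⟨f + g, Submodule.add_mem _ hf' hg', hf.operatorRel_add huf hvg⟩
  | smul c u _ hu =>
    obtain ⟨f, hf', huf⟩ := hu
    exact ⟨c • f, Submodule.smul_mem _ c hf', hf.operatorRel_smul c huf⟩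

theorem finrank_span_image_lt_card {ι : Type*} [Fintype ι] {s : Finset ι} {a : ι} (ha : a ∉ s)
    {l : ι → ℝ} (hmax : ∀ i ∈ s, l i ≤ l a) (u : ι → E) :
    Module.finrank ℂ (Submodule.span ℂ (u '' s)) < Fintype.card {i // l i ≤ l a} := by
  classical
  calc Module.finrank ℂ (Submodule.span ℂ (u '' s)) ≤ (s.image u).card := by
        rw [← Finset.coe_image]
        exact finrank_span_finset_le_card _
    _ ≤ s.card := Finset.card_image_le
    _ < (insert a s).card := by
        rw [Finset.card_insert_of_notMem ha]
        exact Nat.lt_succ_self _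
    _ ≤ Fintype.card {i // l i ≤ l a} := by
        rw [Fintype.card_subtype]
        exact Finset.card_le_card fun i hi => Finset.mem_filter.2 ⟨Finset.mem_univ i,
          (Finset.mem_insert.1 hi).elim (fun h => h ▸ le_rfl) (hmax i)⟩

variable [CompleteSpace E]

/- Glazman's lemma: the eigenvectors are constructed in the order of increasing `l`, the one for
`k` in the orthogonal complement of the previous ones, which meets `W k` for reasons of
dimension. -/
theorem IsClosedForm.exists_eigensystem (hc : IsClosedForm D h) {ι : Type*} [Fintype ι]
    {l : ι → ℝ} (hl : ∀ k, l k < 0) {W : ι → Submodule ℂ E} (hWD : ∀ k, (W k : Set E) ⊆ D)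
    (hdim : ∀ k, Fintype.card {i // l i ≤ l k} ≤ Module.finrank ℂ (W k))
    (hW : ∀ k, ∀ w ∈ W k, (h w w).re ≤ l k * ‖w‖ ^ 2) :
    ∃ (u : ι → E) (μ : ι → ℝ), Orthonormal ℂ u ∧
      ∀ i, μ i ≤ l i ∧ OperatorRel D h (u i) ((μ i : ℂ) • u i) := by
  classical
  suffices ∀ s : Finset ι, ∃ (u : ι → E) (μ : ι → ℝ), Orthonormal ℂ (fun i : s => u i) ∧
      ∀ i ∈ s, μ i ≤ l i ∧ OperatorRel D h (u i) ((μ i : ℂ) • u i) by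
    obtain ⟨u, μ, hu, hμ⟩ := this Finset.univ
    exact ⟨u, μ, hu.comp (fun i => ⟨i, Finset.mem_univ i⟩) fun i j hij => Subtype.ext_iff.1 hij,
      fun i => hμ i (Finset.mem_univ i)⟩
  intro s
  induction s using Finset.induction_on_max_value l with
  | empty => exact ⟨0, 0, ⟨fun i => absurd i.2 (Finset.notMem_empty _),
      fun i => absurd i.2 (Finset.notMem_empty _)⟩, fun i hi => absurd hi (Finset.notMem_empty _)⟩
  | insert a s ha hmax ih =>
    obtain ⟨u, μ, hu, hμ⟩ := ih
    set S := Submodule.span ℂ (u '' s)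
    have : FiniteDimensional ℂ S :=
      FiniteDimensional.span_of_finite ℂ (s.finite_toSet.image u)
    obtain ⟨w, hwW, hwS, hw⟩ := exists_mem_orthogonal_of_finrank_lt
      ((finrank_span_image_lt_card ha hmax u).trans_le (hdim a))
    have hinv := hc.exists_operatorRel_of_mem_span (s := u '' s) <| by
      rintro _ ⟨i, hi, rfl⟩
      exact ⟨μ i, (hμ i hi).2⟩
    obtain ⟨x, hxS, m, hml, hx, hxm⟩ :=
      hc.exists_eigenvector hinv (hWD a hwW) hwS hw (hl a) (hW a w hwW)
    refine ⟨Function.update u a x, Function.update μ a m, orthonormal_update_insert ha hu hx hxS,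
      fun i hi => ?_⟩
    rcases Finset.mem_insert.1 hi with rfl | hi
    · simpa using ⟨hml, hxm⟩
    · have hia : i ≠ a := fun h => ha (h ▸ hi)
      simpa [hia] using hμ i hi

end Eigensystem

/-! ### Bounds on the trace -/

section NegTrace

variable {E : Type*} [NormedAddCommGroup E] [InnerProductSpace ℂ E]
variable {D : Set E} {h : E → E → ℂ} {γ : ℝ} {B : ENNReal}

theorem IsHermitianForm.sum_le_negTrace (hf : IsHermitianForm D h) {ι : Type*} [Fintype ι]
    {u : ι → E} (hu : Orthonormal ℂ u) {μ : ι → ℝ} (hneg : ∀ i, μ i < 0)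
    (hμ : ∀ i, OperatorRel D h (u i) ((μ i : ℂ) • u i)) (γ : ℝ) :
    ∑ i, ENNReal.ofReal (|μ i| ^ γ) ≤ negTrace D h γ := by
  classical
  set ν : ι → Set.Iio (0 : ℝ) := fun i => ⟨μ i, hneg i⟩
  have hfiber : ∑ i, ENNReal.ofReal (|μ i| ^ γ) = ∑ t ∈ Finset.univ.image ν,
      (Finset.univ.filter (fun i => ν i = t)).card • ENNReal.ofReal (|(t : ℝ)| ^ γ) :=
    Finset.sum_comp (fun t : Set.Iio (0 : ℝ) => ENNReal.ofReal (|(t : ℝ)| ^ γ)) ν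
  rw [hfiber]
  refine (Finset.sum_le_sum fun t _ => ?_).trans (ENNReal.sum_le_tsum (Finset.univ.image ν))
  rw [nsmul_eq_mul]
  gcongr
  have hcard : (Fintype.card {i // ν i = t} : ℕ∞) ≤ multiplicity D h (t : ℝ) :=
    hf.card_le_multiplicity (u := fun i : {i // ν i = t} => u i)
      (hu.linearIndependent.comp _ Subtype.val_injective)
      fun ⟨i, hi⟩ => congrArg Subtype.val hi ▸ hμ i
  rw [Fintype.card_subtype] at hcard
  exact_mod_cast ENat.toENNReal_le.2 hcard

theorem exists_orthonormal_of_le_rank (S : Submodule ℂ E) {k : ℕ}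
    (hk : (k : ℕ∞) ≤ Cardinal.toENat (Module.rank ℂ S)) :
    ∃ u : Fin k → E, Orthonormal ℂ u ∧ ∀ i, u i ∈ S := by
  rw [Cardinal.natCast_le_toENat] at hk
  obtain ⟨s, hs, hli⟩ := exists_finset_linearIndependent_of_le_rank hk
  set T : Submodule ℂ S := Submodule.span ℂ (s : Set S)
  have hT : Module.finrank ℂ T = k := (finrank_span_finset_eq_card hli).trans hs
  have : FiniteDimensional ℂ T := FiniteDimensional.span_finset ℂ s
  set b := (stdOrthonormalBasis ℂ T).reindex (finCongr hT)
  exact ⟨fun i => ((b i : S) : E),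
    (b.orthonormal.comp_linearIsometry T.subtypeₗᵢ).comp_linearIsometry S.subtypeₗᵢ,
    fun i => (b i : S).2⟩

theorem tendsto_toNat_min (m : ℕ∞) :
    Tendsto (fun n : ℕ => ((min (n : ℕ∞) m).toNat : ENNReal)) atTop (𝓝 (m : ENNReal)) := by
  induction m using ENat.recTopCoe with
  | top => simpa using ENNReal.tendsto_nat_nhds_top
  | coe m =>
    refine tendsto_const_nhds.congr' ?_
    filter_upwards [eventually_ge_atTop m] with n hn
    rw [min_eq_right (by exact_mod_cast hn)]
    simp

theorem IsHermitianForm.negTrace_le (hf : IsHermitianForm D h)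
    (hB : ∀ (ι : Type) [Fintype ι] (u : ι → E) (t : ι → ℝ), Orthonormal ℂ u → (∀ i, t i < 0) →
      (∀ i, OperatorRel D h (u i) ((t i : ℂ) • u i)) → ∑ i, ENNReal.ofReal (|t i| ^ γ) ≤ B) :
    negTrace D h γ ≤ B := by
  rw [negTrace, ENNReal.tsum_eq_iSup_sum]
  refine iSup_le fun s => le_of_tendsto' (tendsto_finsetSum _ fun t _ =>
    ENNReal.Tendsto.mul_const (tendsto_toNat_min _) (Or.inr ENNReal.ofReal_ne_top)) fun n => ?_
  set k : s → ℕ := fun t => (min (n : ℕ∞) (multiplicity D h (t : Set.Iio (0 : ℝ)))).toNat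
  have hk : ∀ t : s, ∃ u : Fin (k t) → E, Orthonormal ℂ u ∧
      ∀ i, u i ∈ hf.eigenspace (t : Set.Iio (0 : ℝ)) := fun t =>
    exists_orthonormal_of_le_rank _ <| by
      rw [← hf.multiplicity_eq]
      exact (ENat.natCast_toNat_le_self _).trans (min_le_right _ _)
  choose u huo hue using hk
  have ho : Orthonormal ℂ (fun x : Σ t : s, Fin (k t) => u x.1 x.2) := by
    refine ⟨fun x => (huo _).1 _, ?_⟩
    rintro ⟨t, i⟩ ⟨t', i'⟩ hne
    rcases eq_or_ne t t' with rfl | htt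
    · exact (huo _).2 fun hi => hne (Sigma.ext rfl (heq_of_eq hi))
    · exact hf.inner_eq_zero (fun hh => htt (Subtype.ext (Subtype.ext hh))) (hue t i) (hue t' i')
  calc ∑ t ∈ s, ((min (n : ℕ∞) (multiplicity D h t)).toNat : ENNReal)
        * ENNReal.ofReal (|(t : ℝ)| ^ γ)
      = ∑ x : Σ t : s, Fin (k t), ENNReal.ofReal (|((x.1 : Set.Iio (0 : ℝ)) : ℝ)| ^ γ) := by
        rw [Fintype.sum_sigma, ← Finset.sum_coe_sort s]
        simp [k]
    _ ≤ B := hB _ _ _ ho (fun x => x.1.1.2) fun x => hue _ _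

theorem IsClosedForm.sum_le_negTrace_of_trial [CompleteSpace E]
    (hc : IsClosedForm D h) (hγ : 0 ≤ γ)
    {ι : Type*} [Fintype ι] {l : ι → ℝ} (hl : ∀ k, l k < 0) {W : ι → Submodule ℂ E}
    (hWD : ∀ k, (W k : Set E) ⊆ D)
    (hdim : ∀ k, Fintype.card {i // l i ≤ l k} ≤ Module.finrank ℂ (W k))
    (hW : ∀ k, ∀ w ∈ W k, (h w w).re ≤ l k * ‖w‖ ^ 2) :
    ∑ i, ENNReal.ofReal (|l i| ^ γ) ≤ negTrace D h γ := by
  obtain ⟨u, μ, hu, hμ⟩ := hc.exists_eigensystem hl hWD hdim hW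
  have hneg : ∀ i, μ i < 0 := fun i => (hμ i).1.trans_lt (hl i)
  refine (Finset.sum_le_sum fun i _ => ?_).trans
    (hc.sum_le_negTrace hu hneg (fun i => (hμ i).2) γ)
  refine ENNReal.ofReal_le_ofReal (Real.rpow_le_rpow (abs_nonneg _) ?_ hγ)
  rw [abs_of_neg (hl i), abs_of_neg (hneg i)]
  exact neg_le_neg (hμ i).1

end NegTrace

/-! ### Comparison of traces -/

section Comparison

theorem norm_sum_sum_conj_mul_le {ι : Type*} [Fintype ι] (A : ι → ι → ℂ) (c : ι → ℂ) :
    ‖∑ i, ∑ j, starRingEnd ℂ (c i) * c j * A i j‖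
      ≤ (∑ i, ∑ j, ‖A i j‖) * ∑ i, ‖c i‖ ^ 2 := by
  have hsq : ∀ i, ‖c i‖ ^ 2 ≤ ∑ i, ‖c i‖ ^ 2 := fun i =>
    Finset.single_le_sum (f := fun i => ‖c i‖ ^ 2) (fun i _ => by positivity) (Finset.mem_univ i)
  simp only [Finset.sum_mul]
  refine norm_sum_le_of_le _ fun i _ => norm_sum_le_of_le _ fun j _ => ?_
  rw [norm_mul, norm_mul, RCLike.norm_conj, mul_comm]
  gcongr
  nlinarith [sq_nonneg (‖c i‖ - ‖c j‖), hsq i, hsq j]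

theorem re_sum_sum_diagonal {ι : Type*} [Fintype ι] [DecidableEq ι] (d : ι → ℝ) (c : ι → ℂ) :
    (∑ i, ∑ j, starRingEnd ℂ (c i) * c j * (if i = j then (d i : ℂ) else 0)).re
      = ∑ i, d i * ‖c i‖ ^ 2 := by
  rw [Complex.re_sum]
  refine Finset.sum_congr rfl fun i _ => ?_
  simp only [mul_ite, mul_zero, Finset.sum_ite_eq, Finset.mem_univ, if_true]
  rw [Complex.conj_mul', mul_comm, ← Complex.ofReal_pow, ← Complex.ofReal_mul, Complex.ofReal_re]

theorem eventually_re_sum_sum_pos {α ι : Type*} [Fintype ι] [DecidableEq ι] {F : Filter α}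
    {A : α → ι → ι → ℂ} {d : ι → ℝ} (hd : ∀ i, 0 < d i)
    (hA : ∀ i j, Tendsto (fun R => A R i j) F (𝓝 (if i = j then (d i : ℂ) else 0))) :
    ∀ᶠ R in F, ∀ c : ι → ℂ, c ≠ 0 →
      0 < (∑ i, ∑ j, starRingEnd ℂ (c i) * c j * A R i j).re := by
  set a : ι → ι → ℂ := fun i j => if i = j then (d i : ℂ) else 0
  obtain ⟨δ, hδ, hδd⟩ := Pi.exists_forall_pos_add_lt (x := 0) hd
  have herr : Tendsto (fun R => ∑ i, ∑ j, ‖A R i j - a i j‖) F (𝓝 0) := by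
    have := tendsto_finsetSum Finset.univ fun i _ => tendsto_finsetSum Finset.univ fun j _ =>
      ((hA i j).sub (tendsto_const_nhds (x := a i j))).norm
    simpa only [a, sub_self, norm_zero, Finset.sum_const_zero] using this
  filter_upwards [herr.eventually_lt_const hδ] with R hR c hc
  have hpos : 0 < ∑ i, ‖c i‖ ^ 2 := by
    obtain ⟨i, hi⟩ := Function.ne_iff.1 hc
    have : 0 < ‖c i‖ := norm_pos_iff.2 hi
    exact Finset.sum_pos' (fun i _ => by positivity) ⟨i, Finset.mem_univ _, by positivity⟩
  have hdiag : δ * ∑ i, ‖c i‖ ^ 2 ≤ (∑ i, ∑ j, starRingEnd ℂ (c i) * c j * a i j).re := by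
    rw [re_sum_sum_diagonal, Finset.mul_sum]
    gcongr with i
    simpa using (hδd i).le
  have hdiff := (Complex.abs_re_le_norm _).trans
    (norm_sum_sum_conj_mul_le (fun i j => A R i j - a i j) c)
  simp only [mul_sub, Finset.sum_sub_distrib, Complex.sub_re] at hdiff
  nlinarith [(abs_le.1 hdiff).1]

variable {E E' : Type*} [NormedAddCommGroup E] [InnerProductSpace ℂ E]
  [NormedAddCommGroup E'] [InnerProductSpace ℂ E'] {D : Set E} {h : E → E → ℂ} {γ : ℝ}

theorem norm_sq_sum_smul {ι : Type*} [Fintype ι] (w : ι → E) (c : ι → ℂ) :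
    ‖∑ i, c i • w i‖ ^ 2 = (∑ i, ∑ j, starRingEnd ℂ (c i) * c j * inner ℂ (w i) (w j)).re := by
  rw [← inner_self_eq_norm_sq (𝕜 := ℂ), RCLike.re_to_complex, sum_inner]
  simp only [inner_sum, inner_smul_left, inner_smul_right, mul_assoc, mul_left_comm]

theorem IsHermitianForm.finrank_span_eq_card_and_re_le (hf : IsHermitianForm D h) {ι : Type*}
    [Fintype ι] {w : ι → E} (hw : ∀ i, w i ∈ D) {l : ℝ}
    (hGram : ∀ c : ι → ℂ, c ≠ 0 →
      0 < (∑ i, ∑ j, starRingEnd ℂ (c i) * c j * inner ℂ (w i) (w j)).re)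
    (hForm : ∀ c : ι → ℂ, c ≠ 0 → 0 < (∑ i, ∑ j, starRingEnd ℂ (c i) * c j
      * ((l : ℂ) * inner ℂ (w i) (w j) - h (w i) (w j))).re) :
    Module.finrank ℂ (Submodule.span ℂ (Set.range w)) = Fintype.card ι ∧
      ∀ x ∈ Submodule.span ℂ (Set.range w), (h x x).re ≤ l * ‖x‖ ^ 2 := by
  constructor
  · refine finrank_span_eq_card (Fintype.linearIndependent_iff.2 fun c hc => ?_)
    by_contra! hc0
    have := hGram c (Function.ne_iff.2 hc0)
    rw [← norm_sq_sum_smul, hc] at this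
    simp at this
  · intro x hx
    obtain ⟨c, rfl⟩ := (Submodule.mem_span_range_iff_exists_fun ℂ).1 hx
    rcases eq_or_ne c 0 with rfl | hc
    · simp [hf.zero_right hf.zero_mem]
    · have hpos := hForm c hc
      simp only [mul_sub, Finset.sum_sub_distrib, Complex.sub_re, mul_left_comm _ (l : ℂ),
        ← Finset.mul_sum, Complex.re_ofReal_mul] at hpos
      rw [hf.apply_sum_smul hw, norm_sq_sum_smul]
      linarith

variable [CompleteSpace E']

theorem sum_ofReal_add_le_of_tendsto (hγ : 0 ≤ γ)
    {α : Type*} {F : Filter α} [F.NeBot] {D' : α → Set E'} {h' : α → E' → E' → ℂ}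
    (hc : ∀ R, IsClosedForm (D' R) (h' R)) {J : α → E → E'} (hJ : ∀ R, ∀ u ∈ D, J R u ∈ D' R)
    (hinner : ∀ u ∈ D, ∀ v ∈ D,
      Tendsto (fun R => inner ℂ (J R u) (J R v)) F (𝓝 (inner ℂ u v)))
    (hform : ∀ u ∈ D, ∀ v ∈ D, Tendsto (fun R => h' R (J R u) (J R v)) F (𝓝 (h u v)))
    {B : ENNReal} (hB : ∀ R, negTrace (D' R) (h' R) γ ≤ B) {ι : Type*} [Fintype ι] {u : ι → E}
    (hu : Orthonormal ℂ u) {t : ι → ℝ} (ht : ∀ i, OperatorRel D h (u i) ((t i : ℂ) • u i))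
    {ε : ℝ} (hε : 0 < ε) (htε : ∀ i, t i + ε < 0) :
    ∑ i, ENNReal.ofReal (|t i + ε| ^ γ) ≤ B := by
  classical
  have huD : ∀ i, u i ∈ D := fun i => (ht i).1
  have hG : ∀ i j, Tendsto (fun R => inner ℂ (J R (u i)) (J R (u j))) F
      (𝓝 (if i = j then ((1 : ℝ) : ℂ) else 0)) := fun i j => by
    simpa [orthonormal_iff_ite.1 hu i j] using hinner _ (huD i) _ (huD j)
  have hH : ∀ i j, Tendsto (fun R => h' R (J R (u i)) (J R (u j))) F
      (𝓝 (if i = j then (t i : ℂ) else 0)) := fun i j => by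
    simpa only [apply_eigenvectors hu ht] using hform _ (huD i) _ (huD j)
  have hGram : ∀ k, ∀ᶠ R in F, ∀ c : {i // t i + ε ≤ t k + ε} → ℂ, c ≠ 0 →
      0 < (∑ i, ∑ j, starRingEnd ℂ (c i) * c j * inner ℂ (J R (u i)) (J R (u j))).re := fun k =>
    eventually_re_sum_sum_pos (d := fun _ => 1) (fun _ => one_pos) fun i j => by
      simpa only [Subtype.ext_iff] using hG i j
  have hForm : ∀ k, ∀ᶠ R in F, ∀ c : {i // t i + ε ≤ t k + ε} → ℂ, c ≠ 0 →
      0 < (∑ i, ∑ j, starRingEnd ℂ (c i) * c j * (((t k + ε : ℝ) : ℂ)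
        * inner ℂ (J R (u i)) (J R (u j)) - h' R (J R (u i)) (J R (u j)))).re := fun k =>
    eventually_re_sum_sum_pos (d := fun i => t k + ε - t i) (fun i => by linarith [i.2])
      fun i j => by
        convert ((hG i j).const_mul ((t k + ε : ℝ) : ℂ)).sub (hH i j) using 2
        simp only [Subtype.ext_iff]
        split_ifs <;> simp
  obtain ⟨R, hR⟩ := (eventually_all.2 fun k => (hGram k).and (hForm k)).exists
  have hspan := fun k => (hc R).finrank_span_eq_card_and_re_le
    (w := fun i : {i // t i + ε ≤ t k + ε} => J R (u i)) (fun i => hJ R _ (huD i))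
    (hR k).1 (hR k).2
  refine ((hc R).sum_le_negTrace_of_trial hγ htε (fun k => ?_) (fun k => (hspan k).1.ge)
    fun k => (hspan k).2).trans (hB R)
  exact (Submodule.span_le (p := (hc R).domain)).2 <|
    Set.range_subset_iff.2 fun i => hJ R _ (huD i)

theorem IsHermitianForm.negTrace_le_of_tendsto (hf : IsHermitianForm D h) (hγ : 0 ≤ γ)
    {α : Type*} {F : Filter α} [F.NeBot] {D' : α → Set E'} {h' : α → E' → E' → ℂ}
    (hc : ∀ R, IsClosedForm (D' R) (h' R)) {J : α → E → E'} (hJ : ∀ R, ∀ u ∈ D, J R u ∈ D' R)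
    (hinner : ∀ u ∈ D, ∀ v ∈ D,
      Tendsto (fun R => inner ℂ (J R u) (J R v)) F (𝓝 (inner ℂ u v)))
    (hform : ∀ u ∈ D, ∀ v ∈ D, Tendsto (fun R => h' R (J R u) (J R v)) F (𝓝 (h u v)))
    {B : ENNReal} (hB : ∀ R, negTrace (D' R) (h' R) γ ≤ B) : negTrace D h γ ≤ B := by
  refine hf.negTrace_le fun ι _ u t hu hneg ht => ?_
  obtain ⟨ε₀, hε₀, htε₀⟩ := Pi.exists_forall_pos_add_lt (y := 0) hneg
  have hlim : Tendsto (fun ε => ∑ i, ENNReal.ofReal (|t i + ε| ^ γ)) (𝓝[>] 0)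
      (𝓝 (∑ i, ENNReal.ofReal (|t i + 0| ^ γ))) := by
    refine Tendsto.mono_left (Continuous.tendsto ?_ 0) nhdsWithin_le_nhds
    exact continuous_finsetSum _ fun i _ => ENNReal.continuous_ofReal.comp
      (((continuous_const.add continuous_id).abs).rpow_const fun _ => Or.inr hγ)
  simp only [add_zero] at hlim
  refine le_of_tendsto hlim ?_
  filter_upwards [Ioo_mem_nhdsGT hε₀] with ε hε
  exact sum_ofReal_add_le_of_tendsto hγ hc hJ hinner hform hB hu ht hε.1
    fun i => (add_lt_add_right hε.2 (t i)).trans (htε₀ i)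

theorem IsHermitianForm.negTrace_le_of_isometric (hf : IsHermitianForm D h) (hγ : 0 ≤ γ)
    {D' : Set E'} {h' : E' → E' → ℂ} (hc : IsClosedForm D' h') {J : E → E'}
    (hJ : ∀ u ∈ D, J u ∈ D') (hinner : ∀ u ∈ D, ∀ v ∈ D, inner ℂ (J u) (J v) = inner ℂ u v)
    (hform : ∀ u ∈ D, ∀ v ∈ D, h' (J u) (J v) = h u v) :
    negTrace D h γ ≤ negTrace D' h' γ :=
  hf.negTrace_le_of_tendsto hγ (F := (pure () : Filter Unit)) (fun _ => hc)
    (J := fun _ => J) (fun _ => hJ)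
    (fun u hu v hv => by simp only [hinner u hu v hv, tendsto_const_nhds])
    (fun u hu v hv => by simp only [hform u hu v hv, tendsto_const_nhds]) fun _ => le_rfl

end Comparison

/-! ### Direct sums of forms -/

theorem toENat_rank_pi_le (K : Type*) [DivisionRing K] {ι : Type*} [Fintype ι] (M : ι → Type*)
    [∀ j, AddCommGroup (M j)] [∀ j, Module K (M j)] :
    Cardinal.toENat (Module.rank K (∀ j, M j)) ≤ ∑ j, Cardinal.toENat (Module.rank K (M j)) := by
  by_cases htop : ∃ j, Cardinal.toENat (Module.rank K (M j)) = ⊤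
  · obtain ⟨j, hj⟩ := htop
    exact le_top.trans <| hj.ge.trans <|
      Finset.single_le_sum (f := fun j => Cardinal.toENat (Module.rank K (M j)))
        (fun _ _ => zero_le) (Finset.mem_univ j)
  · push Not at htop
    have hfinite : ∀ j, FiniteDimensional K (M j) := fun j =>
      Module.rank_lt_aleph0_iff.1 (Cardinal.toENat_ne_top.1 (htop j))
    simp only [← Module.finrank_eq_rank, Module.finrank_pi_fintype, map_natCast]
    exact (Nat.cast_sum _ _).le

section DirectSum

variable {ι : Type*} [Fintype ι] {E : ι → Type*} [∀ j, NormedAddCommGroup (E j)]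
  [∀ j, InnerProductSpace ℂ (E j)] {D : ∀ j, Set (E j)} {h : ∀ j, E j → E j → ℂ}

/-- The domain of the orthogonal sum of the forms `h j` with domains `D j`. -/
def sumDomain (D : ∀ j, Set (E j)) : Set (PiLp 2 E) :=
  {u | ∀ j, u j ∈ D j}

/-- The orthogonal sum of the forms `h j`. -/
def sumForm (h : ∀ j, E j → E j → ℂ) (v u : PiLp 2 E) : ℂ :=
  ∑ j, h j (v j) (u j)

theorem isHermitianForm_sumForm (hf : ∀ j, IsHermitianForm (D j) (h j)) :
    IsHermitianForm (sumDomain D) (sumForm h) where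
  zero_mem j := (hf j).zero_mem
  add_mem hu hv j := (hf j).add_mem (hu j) (hv j)
  smul_mem c _ hu j := (hf j).smul_mem c (hu j)
  add_right hv hu hu' := by
    rw [sumForm, sumForm, sumForm, ← Finset.sum_add_distrib]
    exact Finset.sum_congr rfl fun j _ => (hf j).add_right (hv j) (hu j) (hu' j)
  smul_right c _ _ hv hu := by
    rw [sumForm, sumForm, Finset.mul_sum]
    exact Finset.sum_congr rfl fun j _ => (hf j).smul_right c (hv j) (hu j)
  conj_symm hu hv := by
    rw [sumForm, sumForm, map_sum]
    exact Finset.sum_congr rfl fun j _ => (hf j).conj_symm (hu j) (hv j)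

theorem exists_subseq_tendsto_re_sumForm (hc : ∀ j, IsClosedForm (D j) (h j))
    {v : ℕ → PiLp 2 E} {r m : ℝ} (hvD : ∀ n, v n ∈ sumDomain D) (hvr : ∀ n, ‖v n‖ ≤ r)
    (hvm : ∀ n, (sumForm h (v n) (v n)).re ≤ m) :
    ∃ (b : ι → ℝ) (ns : ℕ → ℕ), StrictMono ns ∧
      (∀ j, Tendsto (fun n => (h j (v (ns n) j) (v (ns n) j)).re) atTop (𝓝 (b j))) ∧
      ∑ j, b j ≤ m := by
  classical
  choose C hC using fun j => (hc j).bddBelow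
  have hlower : ∀ n j, -(|C j| * r ^ 2) ≤ (h j (v n j) (v n j)).re := fun n j => by
    have hnorm : ‖v n j‖ ^ 2 ≤ r ^ 2 := by
      gcongr
      exact (PiLp.norm_apply_le (v n) j).trans (hvr n)
    calc -(|C j| * r ^ 2) ≤ -(|C j| * ‖v n j‖ ^ 2) := by gcongr
      _ ≤ -C j * ‖v n j‖ ^ 2 := by nlinarith [le_abs_self (C j), sq_nonneg ‖v n j‖]
      _ ≤ _ := hC j _ (hvD n j)
  simp only [sumForm, Complex.re_sum] at hvm
  have hupper : ∀ n j, (h j (v n j) (v n j)).re ≤ m + ∑ i, |C i| * r ^ 2 := fun n j => by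
    have hrest := Finset.sum_le_sum fun i (_ : i ∈ Finset.univ.erase j) => hlower n i
    have hsub : ∑ i ∈ Finset.univ.erase j, |C i| * r ^ 2 ≤ ∑ i, |C i| * r ^ 2 :=
      Finset.sum_le_sum_of_subset_of_nonneg (Finset.erase_subset _ _) fun _ _ _ => by positivity
    rw [Finset.sum_neg_distrib] at hrest
    linarith [hvm n,
      Finset.add_sum_erase _ (fun i => (h i (v n i) (v n i)).re) (Finset.mem_univ j)]
  obtain ⟨b, -, ns, hns, hb⟩ := isCompact_Icc.tendsto_subseq
    (x := fun n j => (h j (v n j) (v n j)).re) fun n => ⟨hlower n, hupper n⟩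
  rw [tendsto_pi_nhds] at hb
  exact ⟨b, ns, hns, hb, le_of_tendsto' (tendsto_finsetSum _ fun j _ => hb j) fun n => hvm (ns n)⟩

theorem isClosedForm_sumForm (hc : ∀ j, IsClosedForm (D j) (h j)) :
    IsClosedForm (sumDomain D) (sumForm h) where
  toIsHermitianForm := isHermitianForm_sumForm fun j => (hc j).toIsHermitianForm
  bddBelow := by
    choose C hC using fun j => (hc j).bddBelow
    refine ⟨∑ j, |C j|, fun u hu => ?_⟩
    rw [sumForm, Complex.re_sum, ← Finset.sum_neg_distrib, Finset.sum_mul]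
    refine Finset.sum_le_sum fun j _ => le_trans ?_ (hC j _ (hu j))
    calc -|C j| * ‖u‖ ^ 2 ≤ -|C j| * ‖u j‖ ^ 2 := by
          have := PiLp.norm_apply_le u j
          exact mul_le_mul_of_nonpos_left (by gcongr) (neg_nonpos.2 (abs_nonneg _))
      _ ≤ -C j * ‖u j‖ ^ 2 := by gcongr; exact le_abs_self _
  isSeqClosed {v u r m} hvD hvr hvm hvu := by
    obtain ⟨b, ns, hns, hb, hbm⟩ := exists_subseq_tendsto_re_sumForm hc hvD hvr hvm
    have hu := fun j => (hc j).re_le_of_tendsto (fun n => hvD (ns n) j)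
      (fun n => (PiLp.norm_apply_le _ j).trans (hvr (ns n))) (hb j)
      ((hvu.piLp_apply j).comp hns.tendsto_atTop)
    refine ⟨fun j => (hu j).1, le_trans ?_ hbm⟩
    rw [sumForm, Complex.re_sum]
    exact Finset.sum_le_sum fun j _ => (hu j).2

theorem OperatorRel.sumForm_apply (hf : ∀ j, IsHermitianForm (D j) (h j)) {u f : PiLp 2 E}
    (hu : OperatorRel (sumDomain D) (sumForm h) u f) (j : ι) :
    OperatorRel (D j) (h j) (u j) (f j) := by
  classical
  refine ⟨hu.1 j, fun v hv => ?_⟩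
  have hsingle : PiLp.single 2 j v ∈ sumDomain D := fun i => by
    rcases eq_or_ne i j with rfl | hij
    · simpa using hv
    · simpa [hij] using (hf i).zero_mem
  rw [← inner_piLp_single_left, ← hu.2 _ hsingle, sumForm, Finset.sum_eq_single j]
  · simp
  · intro i _ hij
    simpa [hij] using (hf i).zero_left (hu.1 i)
  · simp

theorem multiplicity_sumForm_le (hf : ∀ j, IsHermitianForm (D j) (h j)) (t : ℝ) :
    multiplicity (sumDomain D) (sumForm h) t ≤ ∑ j, multiplicity (D j) (h j) t := by
  have hsum := isHermitianForm_sumForm hf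
  let toPi : hsum.eigenspace t →ₗ[ℂ] ∀ j, (hf j).eigenspace t :=
    { toFun u j := ⟨u.1 j, OperatorRel.sumForm_apply hf u.2 j⟩
      map_add' _ _ := rfl
      map_smul' _ _ := rfl }
  have hinj : Function.Injective toPi := fun u v huv =>
    Subtype.ext (PiLp.ext fun j => congrArg Subtype.val (congrFun huv j))
  simp only [IsHermitianForm.multiplicity_eq, hsum, hf]
  exact (OrderHomClass.mono Cardinal.toENat (LinearMap.rank_le_of_injective toPi hinj)).trans
    (toENat_rank_pi_le ℂ _)

theorem negTrace_sumForm_le (hf : ∀ j, IsHermitianForm (D j) (h j)) (γ : ℝ) :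
    negTrace (sumDomain D) (sumForm h) γ ≤ ∑ j, negTrace (D j) (h j) γ := by
  unfold negTrace
  rw [← Summable.tsum_finsetSum fun j _ => ENNReal.summable]
  refine ENNReal.tsum_le_tsum fun t => ?_
  rw [← Finset.sum_mul]
  gcongr
  exact (ENat.toENNReal_le.2 (multiplicity_sumForm_le hf t)).trans_eq
    (map_sum ENat.toENNRealRingHom _ _)

end DirectSum

/-! ### Primitives of locally integrable functions -/

section Primitive

theorem intervalIntegrable_of_locallyIntegrable {F : Type*} [NormedAddCommGroup F] {G : ℝ → F}
    (hG : LocallyIntegrable G) (a b : ℝ) : IntervalIntegrable G volume a b :=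
  intervalIntegrable_iff.2
    ((hG.integrableOn_isCompact isCompact_uIcc).mono_set Set.uIoc_subset_uIcc)

/-- `w` is a primitive of the locally integrable function `G`. -/
structure IsPrimitive {F : Type*} [NormedAddCommGroup F] [NormedSpace ℝ F] (G w : ℝ → F) :
    Prop where
  locallyIntegrable : LocallyIntegrable G
  sub_eq : ∀ a b, w b - w a = ∫ s in a..b, G s

theorem isPrimitive_integral {F : Type*} [NormedAddCommGroup F] [NormedSpace ℝ F] {G : ℝ → F}
    (hG : LocallyIntegrable G) (a : ℝ) : IsPrimitive G fun x => ∫ s in a..x, G s where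
  locallyIntegrable := hG
  sub_eq x y := intervalIntegral.integral_interval_sub_left
    (intervalIntegrable_of_locallyIntegrable hG a y)
    (intervalIntegrable_of_locallyIntegrable hG a x)

namespace IsPrimitive

variable {F : Type*} [NormedAddCommGroup F] [NormedSpace ℝ F] {G w : ℝ → F}

theorem intervalIntegrable (h : IsPrimitive G w) (a b : ℝ) : IntervalIntegrable G volume a b :=
  intervalIntegrable_of_locallyIntegrable h.locallyIntegrable a b

theorem eq_add_integral (h : IsPrimitive G w) (a : ℝ) :
    w = fun x => w a + ∫ s in a..x, G s :=
  funext fun x => by rw [← h.sub_eq a x, add_sub_cancel]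

theorem continuous (h : IsPrimitive G w) : Continuous w := by
  rw [h.eq_add_integral 0]
  exact continuous_const.add (intervalIntegral.continuous_primitive h.intervalIntegrable 0)

theorem integral_deriv_mul {G w : ℝ → ℝ} (h : IsPrimitive G w) {φ : ℝ → ℝ} (hφ : ContDiff ℝ 1 φ)
    (a b : ℝ) :
    ∫ x in a..b, deriv φ x * w x = φ b * w b - φ a * w a - ∫ x in a..b, φ x * G x := by
  have hac : AbsolutelyContinuousOnInterval w a b := by
    rw [h.eq_add_integral a]
    exact .add (f := fun _ => w a)
      (contDiff_const (n := 1)).contDiffOn.absolutelyContinuousOnInterval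
      ((h.intervalIntegrable a b).absolutelyContinuousOnInterval_intervalIntegral (by simp))
  have hderiv : ∫ x in a..b, φ x * deriv w x = ∫ x in a..b, φ x * G x := by
    refine intervalIntegral.integral_congr_ae ?_
    filter_upwards [_root_.LocallyIntegrable.ae_hasDerivAt_integral h.locallyIntegrable] with x hx _
    rw [h.eq_add_integral a, ((hx a).const_add (w a)).deriv]
  linarith [hφ.contDiffOn.absolutelyContinuousOnInterval.integral_mul_deriv_eq_deriv_mul hac]

variable [CompleteSpace F]

theorem clm_comp (h : IsPrimitive G w) (L : F →L[ℝ] ℝ) :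
    IsPrimitive (fun x => L (G x)) fun x => L (w x) where
  locallyIntegrable x := (h.locallyIntegrable x).imp fun _ hs => ⟨hs.1, L.integrable_comp hs.2⟩
  sub_eq a b := by
    rw [← map_sub, h.sub_eq, L.intervalIntegral_comp_comm (h.intervalIntegrable a b)]

theorem integral_deriv_smul (h : IsPrimitive G w) {φ : ℝ → ℝ} (hφ : ContDiff ℝ 1 φ) (a b : ℝ) :
    ∫ x in a..b, deriv φ x • w x = φ b • w b - φ a • w a - ∫ x in a..b, φ x • G x := by
  have hφw : IntervalIntegrable (fun x => deriv φ x • w x) volume a b :=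
    ((hφ.continuous_deriv le_rfl).smul h.continuous).intervalIntegrable a b
  have hφG : IntervalIntegrable (fun x => φ x • G x) volume a b :=
    (h.intervalIntegrable a b).continuousOn_smul hφ.continuous.continuousOn
  refine (SeparatingDual.eq_iff_forall_dual_eq (R := ℝ)).2 fun L => ?_
  have hL := (h.clm_comp L).integral_deriv_mul hφ a b
  simp only [map_sub, ← L.intervalIntegral_comp_comm hφw, ← L.intervalIntegral_comp_comm hφG,
    map_smul, smul_eq_mul, hL]

theorem integral_Ioi_deriv_smul (h : IsPrimitive G w) {φ : ℝ → ℝ} (hφ : ContDiff ℝ 1 φ)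
    (hc : HasCompactSupport φ) (a : ℝ) :
    ∫ x in Set.Ioi a, deriv φ x • w x = -(φ a • w a) - ∫ x in Set.Ioi a, φ x • G x := by
  obtain ⟨b₀, hb₀⟩ := IsCompact.bddAbove hc
  obtain ⟨b, hab, hb⟩ : ∃ b, a ≤ b ∧ b₀ < b :=
    ⟨max a b₀ + 1, by linarith [le_max_left a b₀], by linarith [le_max_right a b₀]⟩
  have hout : ∀ x, b ≤ x → x ∉ tsupport φ := fun x hx h => by linarith [hb₀ h]
  have htrunc : ∀ (ψ : ℝ → ℝ) (f : ℝ → F), tsupport ψ ⊆ tsupport φ →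
      ∫ x in Set.Ioi a, ψ x • f x = ∫ x in a..b, ψ x • f x := by
    intro ψ f hψ
    rw [intervalIntegral.integral_of_le hab]
    refine setIntegral_eq_of_subset_of_forall_sdiff_eq_zero measurableSet_Ioi
      Set.Ioc_subset_Ioi_self fun x hx => ?_
    have hbx : b ≤ x := not_lt.1 fun hxb => hx.2 ⟨hx.1, hxb.le⟩
    rw [image_eq_zero_of_notMem_tsupport fun h => hout x hbx (hψ h), zero_smul]
  rw [htrunc _ _ tsupport_deriv_subset, htrunc _ _ subset_rfl, h.integral_deriv_smul hφ,
    image_eq_zero_of_notMem_tsupport (hout b le_rfl), zero_smul, zero_sub]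

theorem integral_univ_deriv_smul (h : IsPrimitive G w) {φ : ℝ → ℝ} (hφ : ContDiff ℝ 1 φ)
    (hc : HasCompactSupport φ) : ∫ x, deriv φ x • w x = -∫ x, φ x • G x := by
  obtain ⟨a₀, ha₀⟩ := IsCompact.bddBelow hc
  have hout : ∀ x, x ≤ a₀ - 1 → x ∉ tsupport φ := fun x hx h => by linarith [ha₀ h]
  have hextend : ∀ (ψ : ℝ → ℝ) (f : ℝ → F), tsupport ψ ⊆ tsupport φ →
      ∫ x in Set.Ioi (a₀ - 1), ψ x • f x = ∫ x, ψ x • f x := fun ψ f hψ =>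
    setIntegral_eq_integral_of_forall_compl_eq_zero fun x hx => by
      rw [image_eq_zero_of_notMem_tsupport fun h => hout x (not_lt.1 hx) (hψ h), zero_smul]
  rw [← hextend _ _ tsupport_deriv_subset, ← hextend _ _ subset_rfl,
    h.integral_Ioi_deriv_smul hφ hc, image_eq_zero_of_notMem_tsupport (hout _ le_rfl), zero_smul,
    neg_zero, zero_sub]

end IsPrimitive

end Primitive

/-! ### Test functions and weak derivatives -/

section TestFunction

/-- `φ` is a test function on the open set `Ω`. -/
structure IsTestFunction (Ω : Set ℝ) (φ : ℝ → ℝ) : Prop where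
  contDiff : ContDiff ℝ (⊤ : ℕ∞) φ
  hasCompactSupport : HasCompactSupport φ
  tsupport_subset : tsupport φ ⊆ Ω

variable {Ω : Set ℝ}

namespace IsTestFunction

variable {φ ψ : ℝ → ℝ}

theorem deriv (hφ : IsTestFunction Ω φ) : IsTestFunction Ω (deriv φ) where
  contDiff := (contDiff_infty_iff_deriv.1 hφ.contDiff).2
  hasCompactSupport := hφ.hasCompactSupport.deriv
  tsupport_subset := tsupport_deriv_subset.trans hφ.tsupport_subset

theorem sub_const_mul (hφ : IsTestFunction Ω φ) (hψ : IsTestFunction Ω ψ) (c : ℝ) :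
    IsTestFunction Ω fun x => φ x - c * ψ x := by
  have hK : IsCompact (tsupport φ ∪ tsupport ψ) :=
    hφ.hasCompactSupport.isCompact.union hψ.hasCompactSupport.isCompact
  have hsupport : (Function.support fun x => φ x - c * ψ x) ⊆ tsupport φ ∪ tsupport ψ := by
    intro x hx
    by_contra hnot
    rw [Set.mem_union, not_or] at hnot
    exact hx (by simp [image_eq_zero_of_notMem_tsupport hnot.1,
      image_eq_zero_of_notMem_tsupport hnot.2])
  exact ⟨hφ.contDiff.sub (contDiff_const.mul hψ.contDiff),
    HasCompactSupport.of_support_subset_isCompact hK hsupport,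
    (closure_minimal hsupport hK.isClosed).trans
      (Set.union_subset hφ.tsupport_subset hψ.tsupport_subset)⟩

theorem integrableOn_mul (hφ : IsTestFunction Ω φ) {f : ℝ → ℂ} (hf : LocallyIntegrableOn f Ω) :
    IntegrableOn (fun x => (φ x : ℂ) * f x) Ω := by
  have hint : IntegrableOn (fun x => (φ x : ℂ) * f x) (tsupport φ) := by
    simpa only [Complex.real_smul] using
      (hf.integrableOn_compact_subset hφ.tsupport_subset hφ.hasCompactSupport).continuousOn_smul
        hφ.contDiff.continuous.continuousOn hφ.hasCompactSupport
  refine ((integrableOn_iff_integrable_of_support_subset fun x hx => ?_).1 hint).integrableOn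
  exact subset_tsupport φ fun h0 => hx (by simp [h0])

theorem setIntegral_mul (hφ : IsTestFunction Ω φ) (f : ℝ → ℂ) :
    ∫ x in Ω, (φ x : ℂ) * f x = ∫ x, (φ x : ℂ) * f x :=
  setIntegral_eq_integral_of_forall_compl_eq_zero fun x hx => by
    rw [image_eq_zero_of_notMem_tsupport fun h => hx (hφ.tsupport_subset h), Complex.ofReal_zero,
      zero_mul]

theorem memLp (hφ : IsTestFunction Ω φ) (μ : Measure ℝ) [IsFiniteMeasureOnCompacts μ] :
    MemLp (fun x => (φ x : ℂ)) 2 μ :=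
  (hφ.contDiff.continuous.memLp_of_hasCompactSupport hφ.hasCompactSupport).ofReal

end IsTestFunction

theorem exists_isTestFunction_integral_eq_one (hΩ : IsOpen Ω) (hne : Ω.Nonempty) :
    ∃ η, IsTestFunction Ω η ∧ ∫ x, η x = 1 := by
  obtain ⟨x₀, hx₀⟩ := hne
  obtain ⟨r, hr, hball⟩ := Metric.isOpen_iff.1 hΩ x₀ hx₀
  let b : ContDiffBump x₀ := ⟨r / 4, r / 2, by positivity, by linarith⟩
  refine ⟨b.normed volume, ⟨b.contDiff_normed, b.hasCompactSupport_normed, ?_⟩, b.integral_normed⟩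
  rw [b.tsupport_normed_eq]
  exact (Metric.closedBall_subset_ball (half_lt_self hr)).trans hball

theorem exists_isTestFunction_deriv_eq (hΩ : Ω.OrdConnected) {θ : ℝ → ℝ}
    (hθ : IsTestFunction Ω θ) (hint : ∫ x, θ x = 0) :
    ∃ ψ, IsTestFunction Ω ψ ∧ deriv ψ = θ := by
  rcases (tsupport θ).eq_empty_or_nonempty with hempty | hne
  · obtain rfl := tsupport_eq_empty_iff.1 hempty
    exact ⟨0, hθ, deriv_const' 0⟩
  have hK : IsCompact (tsupport θ) := hθ.hasCompactSupport
  set m := sInf (tsupport θ)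
  set M := sSup (tsupport θ)
  have hzero : ∀ x, x ∉ Set.Icc m M → θ x = 0 := fun x hx =>
    image_eq_zero_of_notMem_tsupport fun h => hx ⟨csInf_le hK.bddBelow h, le_csSup hK.bddAbove h⟩
  have hcont := hθ.contDiff.continuous
  have hintegrable : Integrable θ := hcont.integrable_of_hasCompactSupport hθ.hasCompactSupport
  set ψ : ℝ → ℝ := fun x => ∫ s in Set.Iic x, θ s
  have hderiv : ∀ x, HasDerivAt ψ (θ x) x := fun x => by
    have hψ : ψ = fun x => ψ m + ∫ s in m..x, θ s := funext fun x => by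
      rw [← intervalIntegral.integral_Iic_sub_Iic hintegrable.integrableOn
        hintegrable.integrableOn, add_sub_cancel]
    rw [hψ]
    exact (hcont.integral_hasStrictDerivAt m x).hasDerivAt.const_add _
  have hsupport : Function.support ψ ⊆ Set.Icc m M := fun x hx => by
    by_contra hxI
    rcases lt_or_ge x m with hxm | hxm
    · exact hx (setIntegral_eq_zero_of_forall_eq_zero fun s hs =>
        hzero s fun hsI => (hs.trans_lt hxm).not_ge hsI.1)
    · refine hx ((setIntegral_eq_integral_of_forall_compl_eq_zero fun s hs =>
        hzero s fun hsI => hs (hsI.2.trans ?_)).trans hint)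
      exact (not_le.1 fun hxM => hxI ⟨hxm, hxM⟩).le
  have hd : deriv ψ = θ := funext fun x => (hderiv x).deriv
  refine ⟨ψ, ⟨contDiff_infty_iff_deriv.2 ⟨fun x => (hderiv x).differentiableAt, hd ▸ hθ.contDiff⟩,
    HasCompactSupport.of_support_subset_isCompact isCompact_Icc hsupport, ?_⟩, hd⟩
  exact (closure_minimal hsupport isClosed_Icc).trans <|
    hΩ.out (hθ.tsupport_subset (hK.sInf_mem hne)) (hθ.tsupport_subset (hK.sSup_mem hne))

theorem ae_eq_zero_of_integral_isTestFunction (hΩ : IsOpen Ω) {f : ℝ → ℂ}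
    (hf : LocallyIntegrableOn f Ω)
    (h : ∀ φ, IsTestFunction Ω φ → ∫ x in Ω, (φ x : ℂ) * f x = 0) :
    f =ᵐ[volume.restrict Ω] 0 := by
  refine (ae_restrict_iff' hΩ.measurableSet).2
    (hΩ.ae_eq_zero_of_integral_contDiff_smul_eq_zero hf fun φ hφ hc hs => ?_)
  have hφ' : IsTestFunction Ω φ := ⟨hφ, hc, hs⟩
  simpa only [Complex.real_smul, ← hφ'.setIntegral_mul] using h φ hφ'

-- The du Bois-Reymond lemma: test `f - c` with `φ = ψ' + (∫ φ) η`.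
theorem exists_ae_eq_const (hΩ : IsOpen Ω) (hΩc : Ω.OrdConnected) {f : ℝ → ℂ}
    (hf : LocallyIntegrableOn f Ω)
    (h : ∀ φ, IsTestFunction Ω φ → ∫ x in Ω, ((deriv φ x : ℝ) : ℂ) * f x = 0) :
    ∃ c : ℂ, f =ᵐ[volume.restrict Ω] fun _ => c := by
  rcases Ω.eq_empty_or_nonempty with rfl | hne
  · exact ⟨0, by simp [EventuallyEq]⟩
  obtain ⟨η, hη, hη1⟩ := exists_isTestFunction_integral_eq_one hΩ hne
  set c := ∫ x in Ω, (η x : ℂ) * f x with hc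
  have hconst : LocallyIntegrableOn (fun _ : ℝ => c) Ω :=
    (locallyIntegrable_const c).locallyIntegrableOn Ω
  have hzero : (fun x => f x - c) =ᵐ[volume.restrict Ω] 0 := by
    refine ae_eq_zero_of_integral_isTestFunction hΩ (hf.sub hconst) fun φ hφ => ?_
    have hintegrable : ∀ {φ}, IsTestFunction Ω φ → Integrable φ := fun hφ =>
      hφ.contDiff.continuous.integrable_of_hasCompactSupport hφ.hasCompactSupport
    obtain ⟨ψ, hψ, hψd⟩ := exists_isTestFunction_deriv_eq hΩc
        (hφ.sub_const_mul hη (∫ x, φ x)) <| by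
      rw [integral_sub (hintegrable hφ) ((hintegrable hη).const_mul _), integral_const_mul, hη1,
        mul_one, sub_self]
    have hψf := h ψ hψ
    simp only [hψd, Complex.ofReal_sub, Complex.ofReal_mul, sub_mul, mul_assoc] at hψf
    rw [integral_sub (hφ.integrableOn_mul hf) ((hη.integrableOn_mul hf).const_mul _),
      integral_const_mul, ← hc] at hψf
    have hφ1 : ∫ x in Ω, (φ x : ℂ) = (∫ x, φ x : ℝ) := by
      simpa only [mul_one, integral_complex_ofReal] using hφ.setIntegral_mul fun _ => (1 : ℂ)
    simp only [mul_sub]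
    rw [integral_sub (hφ.integrableOn_mul hf) (hφ.integrableOn_mul hconst), integral_mul_const, hφ1,
      hψf]
  exact ⟨c, hzero.mono fun x hx => sub_eq_zero.1 hx⟩

end TestFunction

/-! ### Sobolev functions -/

section Sobolev

variable {Ω : Set ℝ} {u g : ℝ → ℂ}

theorem hasWeakDeriv_iff : HasWeakDeriv Ω u g ↔ ∀ φ, IsTestFunction Ω φ →
    ∫ x in Ω, ((deriv φ x : ℝ) : ℂ) * u x = -∫ x in Ω, (φ x : ℂ) * g x :=
  ⟨fun h φ hφ => h φ hφ.contDiff hφ.hasCompactSupport hφ.tsupport_subset,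
    fun h φ hφ hc hs => h φ ⟨hφ, hc, hs⟩⟩

theorem HasWeakDeriv.congr {u' g' : ℝ → ℂ} (h : HasWeakDeriv Ω u g)
    (hu : u =ᵐ[volume.restrict Ω] u') (hg : g =ᵐ[volume.restrict Ω] g') :
    HasWeakDeriv Ω u' g' := fun φ hφ hc hs =>
  calc ∫ x in Ω, ((deriv φ x : ℝ) : ℂ) * u' x
      = ∫ x in Ω, ((deriv φ x : ℝ) : ℂ) * u x :=
        integral_congr_ae (hu.mono fun x hx => by simp only [hx])
    _ = -∫ x in Ω, (φ x : ℂ) * g x := h φ hφ hc hs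
    _ = -∫ x in Ω, (φ x : ℂ) * g' x :=
        congrArg Neg.neg (integral_congr_ae (hg.mono fun x hx => by simp only [hx]))

theorem memLp_weakDeriv (u : ℝ → ℂ) : MemLp (weakDeriv Ω u) 2 (volume.restrict Ω) := by
  unfold weakDeriv
  split_ifs with h
  exacts [h.choose_spec.1, MemLp.zero]

theorem HasL2WeakDeriv.hasWeakDeriv (h : HasL2WeakDeriv Ω u) :
    HasWeakDeriv Ω u (weakDeriv Ω u) := by
  rw [weakDeriv, dif_pos h]
  exact h.choose_spec.2

theorem locallyIntegrableOn_of_memLp (hu : MemLp u 2 (volume.restrict Ω)) :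
    LocallyIntegrableOn u Ω :=
  locallyIntegrableOn_of_locallyIntegrable_restrict (hu.locallyIntegrable one_le_two)

/-- `w` is the continuous representative on `Ω` of the Sobolev function `u`, extended to the line
by constants. -/
structure IsRep (Ω : Set ℝ) (u w : ℝ → ℂ) : Prop where
  ae_eq : w =ᵐ[volume.restrict Ω] u
  isPrimitive : IsPrimitive (Ω.indicator (weakDeriv Ω u)) w

theorem locallyIntegrable_indicator_weakDeriv (hΩ : IsOpen Ω) (u : ℝ → ℂ) :
    LocallyIntegrable (Ω.indicator (weakDeriv Ω u)) :=
  ((memLp_indicator_iff_restrict hΩ.measurableSet).2 (memLp_weakDeriv u)).locallyIntegrable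
    one_le_two

theorem MemH1.exists_isRep (hΩ : IsOpen Ω) (hΩc : Ω.OrdConnected) (h : MemH1 Ω u) :
    ∃ w, IsRep Ω u w := by
  have hP := isPrimitive_integral (locallyIntegrable_indicator_weakDeriv hΩ u) 0
  set P : ℝ → ℂ := fun x => ∫ s in (0 : ℝ)..x, Ω.indicator (weakDeriv Ω u) s
  have hu := locallyIntegrableOn_of_memLp h.1
  have hPl : LocallyIntegrableOn P Ω := hP.continuous.locallyIntegrable.locallyIntegrableOn Ω
  obtain ⟨c, hc⟩ := exists_ae_eq_const hΩ hΩc (hu.sub hPl) fun φ hφ => by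
    have hφP : ∫ x in Ω, ((deriv φ x : ℝ) : ℂ) * P x
        = -∫ x in Ω, (φ x : ℂ) * weakDeriv Ω u x := by
      have hparts := hP.integral_univ_deriv_smul (hφ.contDiff.of_le (mod_cast le_top))
        hφ.hasCompactSupport
      simp only [Complex.real_smul] at hparts
      rw [hφ.deriv.setIntegral_mul, hparts, ← hφ.setIntegral_mul]
      refine congrArg Neg.neg (setIntegral_congr_fun hΩ.measurableSet fun x hx => ?_)
      simp only [Set.indicator_of_mem hx]
    simp only [Pi.sub_apply, mul_sub]
    rw [integral_sub (hφ.deriv.integrableOn_mul hu) (hφ.deriv.integrableOn_mul hPl), hφP,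
      hasWeakDeriv_iff.1 h.2.hasWeakDeriv φ hφ, sub_self]
  refine ⟨fun x => P x + c, hc.mono fun x hx => ?_, hP.locallyIntegrable, fun a b => ?_⟩
  · exact (sub_eq_iff_eq_add'.1 hx).symm
  · rw [add_sub_add_right_eq_sub, hP.sub_eq]

namespace IsRep

variable {w : ℝ → ℂ}

theorem hasBoundaryValue (h : IsRep (Set.Ioi 0) u w) : HasBoundaryValue u (w 0) :=
  ⟨w, h.isPrimitive.continuous.continuousOn, h.ae_eq, rfl⟩

theorem eq_of_hasBoundaryValue (h : IsRep (Set.Ioi 0) u w) {c : ℂ} (hc : HasBoundaryValue u c) :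
    w 0 = c := by
  obtain ⟨w', hw', hae, rfl⟩ := hc
  have hww' : w =ᵐ[volume.restrict (Set.Ici 0)] w' := by
    rw [← Measure.restrict_congr_set Ioi_ae_eq_Ici]
    exact h.ae_eq.trans hae.symm
  exact Measure.eqOn_of_ae_eq hww' h.isPrimitive.continuous.continuousOn hw'
    (by rw [interior_Ici, closure_Ioi]) Set.self_mem_Ici

theorem setIntegral_Ioi_deriv_mul {a : ℝ} (h : IsRep (Set.Ioi a) u w) {φ : ℝ → ℝ}
    (hφ : ContDiff ℝ 1 φ) (hc : HasCompactSupport φ) :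
    ∫ x in Set.Ioi a, ((deriv φ x : ℝ) : ℂ) * u x
      = -(φ a * w a) - ∫ x in Set.Ioi a, (φ x : ℂ) * weakDeriv (Set.Ioi a) u x := by
  have hparts := h.isPrimitive.integral_Ioi_deriv_smul hφ hc a
  simp only [Complex.real_smul] at hparts
  calc ∫ x in Set.Ioi a, ((deriv φ x : ℝ) : ℂ) * u x
      = ∫ x in Set.Ioi a, ((deriv φ x : ℝ) : ℂ) * w x :=
        integral_congr_ae (h.ae_eq.mono fun x hx => by simp only [hx])
    _ = -(φ a * w a) - ∫ x in Set.Ioi a, (φ x : ℂ) * weakDeriv (Set.Ioi a) u x := by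
        rw [hparts]
        refine congrArg _ (setIntegral_congr_fun measurableSet_Ioi fun x hx => ?_)
        simp only [Set.indicator_of_mem hx]

end IsRep

end Sobolev

/-! ### Weak derivatives in `L²` -/

/-- `Ω` is an open half-line unbounded to the right, the whole line, or empty, and `μ` is the
Lebesgue measure on it. The measure is a separate parameter because `volume` and
`volume.restrict Set.univ` are not definitionally equal. -/
class IsEdge (Ω : Set ℝ) (μ : Measure ℝ) : Prop where
  isOpen : IsOpen Ω
  isUpperSet : IsUpperSet Ω
  eq_restrict : μ = volume.restrict Ω

instance isEdge_Ioi (a : ℝ) : IsEdge (Set.Ioi a) (volume.restrict (Set.Ioi a)) :=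
  ⟨isOpen_Ioi, isUpperSet_Ioi a, rfl⟩

instance isEdge_univ : IsEdge Set.univ volume :=
  ⟨isOpen_univ, isUpperSet_univ, Measure.restrict_univ.symm⟩

section Edge

variable {Ω : Set ℝ} {μ : Measure ℝ} [IsEdge Ω μ]

theorem IsEdge.ae_eq_restrict_iff {f g : ℝ → ℂ} : f =ᵐ[volume.restrict Ω] g ↔ f =ᵐ[μ] g := by
  rw [← IsEdge.eq_restrict (Ω := Ω) (μ := μ)]

theorem IsTestFunction.memLp_edge {φ : ℝ → ℝ} (hφ : IsTestFunction Ω φ) :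
    MemLp (fun x => (φ x : ℂ)) 2 μ := by
  rw [IsEdge.eq_restrict (Ω := Ω) (μ := μ)]
  exact hφ.memLp _

/-- The test function `φ` as an element of `L²`. -/
def IsTestFunction.toLp {φ : ℝ → ℝ} (hφ : IsTestFunction Ω φ) (μ : Measure ℝ) [IsEdge Ω μ] :
    Lp ℂ 2 μ :=
  hφ.memLp_edge.toLp

theorem IsTestFunction.inner_toLp {φ : ℝ → ℝ} (hφ : IsTestFunction Ω φ) (f : Lp ℂ 2 μ) :
    inner ℂ (hφ.toLp μ) f = ∫ x in Ω, (φ x : ℂ) * f x := by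
  rw [L2.inner_def, ← IsEdge.eq_restrict (Ω := Ω) (μ := μ)]
  refine integral_congr_ae (hφ.memLp_edge.coeFn_toLp.mono fun x hx => ?_)
  simp only [IsTestFunction.toLp, hx, RCLike.inner_apply, Complex.conj_ofReal, mul_comm]

theorem hasWeakDeriv_iff_inner {u g : Lp ℂ 2 μ} : HasWeakDeriv Ω u g ↔
    ∀ φ (hφ : IsTestFunction Ω φ), inner ℂ (hφ.deriv.toLp μ) u = -inner ℂ (hφ.toLp μ) g := by
  simp only [hasWeakDeriv_iff, IsTestFunction.inner_toLp]

theorem memLp_restrict_coe (u : Lp ℂ 2 μ) : MemLp u 2 (volume.restrict Ω) := by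
  rw [← IsEdge.eq_restrict (Ω := Ω) (μ := μ)]
  exact Lp.memLp u

theorem HasWeakDeriv.memH1 {u g : Lp ℂ 2 μ} (h : HasWeakDeriv Ω u g) : MemH1 Ω u :=
  ⟨memLp_restrict_coe u, g, memLp_restrict_coe g, h⟩

theorem memLp_weakDeriv_edge (u : ℝ → ℂ) : MemLp (weakDeriv Ω u) 2 μ := by
  rw [IsEdge.eq_restrict (Ω := Ω) (μ := μ)]
  exact memLp_weakDeriv u

/-- The weak derivative as an element of `L²`. -/
def derivLp (Ω : Set ℝ) [IsEdge Ω μ] (u : Lp ℂ 2 μ) : Lp ℂ 2 μ :=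
  (memLp_weakDeriv_edge (Ω := Ω) u).toLp

theorem coeFn_derivLp (u : Lp ℂ 2 μ) : derivLp Ω u =ᵐ[μ] weakDeriv Ω u :=
  (memLp_weakDeriv_edge u).coeFn_toLp

theorem MemH1.hasWeakDeriv_derivLp {u : Lp ℂ 2 μ} (h : MemH1 Ω u) :
    HasWeakDeriv Ω u (derivLp Ω u) :=
  h.2.hasWeakDeriv.congr .rfl ((IsEdge.ae_eq_restrict_iff (μ := μ)).2 (coeFn_derivLp u).symm)

theorem ext_inner_isTestFunction {f g : Lp ℂ 2 μ}
    (h : ∀ φ (hφ : IsTestFunction Ω φ), inner ℂ (hφ.toLp μ) f = inner ℂ (hφ.toLp μ) g) :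
    f = g := by
  rw [← sub_eq_zero, Lp.eq_zero_iff_ae_eq_zero, ← IsEdge.ae_eq_restrict_iff (Ω := Ω)]
  refine ae_eq_zero_of_integral_isTestFunction (IsEdge.isOpen μ)
    (locallyIntegrableOn_of_memLp (memLp_restrict_coe _)) fun φ hφ => ?_
  rw [← hφ.inner_toLp, inner_sub_right, h φ hφ, sub_self]

theorem HasWeakDeriv.derivLp_eq {u g : Lp ℂ 2 μ} (h : HasWeakDeriv Ω u g) : derivLp Ω u = g :=
  ext_inner_isTestFunction (Ω := Ω) fun φ hφ => neg_injective <| by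
    rw [← hasWeakDeriv_iff_inner.1 h φ hφ,
      ← hasWeakDeriv_iff_inner.1 h.memH1.hasWeakDeriv_derivLp φ hφ]

theorem hasWeakDeriv_zero : HasWeakDeriv Ω (0 : Lp ℂ 2 μ) (0 : Lp ℂ 2 μ) :=
  hasWeakDeriv_iff_inner.2 fun φ hφ => by simp only [inner_zero_right, neg_zero]

theorem HasWeakDeriv.add {u v g k : Lp ℂ 2 μ} (hu : HasWeakDeriv Ω u g)
    (hv : HasWeakDeriv Ω v k) : HasWeakDeriv Ω (u + v : Lp ℂ 2 μ) (g + k : Lp ℂ 2 μ) :=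
  hasWeakDeriv_iff_inner.2 fun φ hφ => by
    rw [inner_add_right, inner_add_right, hasWeakDeriv_iff_inner.1 hu,
      hasWeakDeriv_iff_inner.1 hv, neg_add]

theorem HasWeakDeriv.smul {u g : Lp ℂ 2 μ} (c : ℂ) (hu : HasWeakDeriv Ω u g) :
    HasWeakDeriv Ω (c • u : Lp ℂ 2 μ) (c • g : Lp ℂ 2 μ) :=
  hasWeakDeriv_iff_inner.2 fun φ hφ => by
    rw [inner_smul_right, inner_smul_right, hasWeakDeriv_iff_inner.1 hu, mul_neg]

theorem HasWeakDeriv.of_tendstoWeakly {v g : ℕ → Lp ℂ 2 μ} {u k : Lp ℂ 2 μ}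
    (h : ∀ n, HasWeakDeriv Ω (v n) (g n)) (hv : TendstoWeakly v u) (hg : TendstoWeakly g k) :
    HasWeakDeriv Ω u k :=
  hasWeakDeriv_iff_inner.2 fun φ hφ => tendsto_nhds_unique (hv _) <|
    (hg (hφ.toLp μ)).neg.congr fun n => (hasWeakDeriv_iff_inner.1 (h n) φ hφ).symm

theorem exists_subseq_hasWeakDeriv {v : ℕ → Lp ℂ 2 μ} {u : Lp ℂ 2 μ} {K : ℝ}
    (h : ∀ n, MemH1 Ω (v n)) (hK : ∀ n, ‖derivLp Ω (v n)‖ ≤ K) (hv : TendstoWeakly v u) :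
    ∃ (g : Lp ℂ 2 μ) (ns : ℕ → ℕ), StrictMono ns ∧ HasWeakDeriv Ω u g ∧
      TendstoWeakly ((fun n => derivLp Ω (v n)) ∘ ns) g := by
  obtain ⟨g, ns, hns, hg⟩ := exists_subseq_tendstoWeakly hK
  exact ⟨g, ns, hns, .of_tendstoWeakly (fun n => (h (ns n)).hasWeakDeriv_derivLp)
    (hv.comp hns.tendsto_atTop) hg, hg⟩

theorem memH1_of_tendstoWeakly {v : ℕ → Lp ℂ 2 μ} {u : Lp ℂ 2 μ} {K : ℝ}
    (h : ∀ n, MemH1 Ω (v n)) (hK : ∀ n, ‖derivLp Ω (v n)‖ ≤ K) (hv : TendstoWeakly v u) :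
    MemH1 Ω u :=
  let ⟨_, _, _, hg, _⟩ := exists_subseq_hasWeakDeriv h hK hv
  hg.memH1

theorem tendstoWeakly_derivLp {v : ℕ → Lp ℂ 2 μ} {u : Lp ℂ 2 μ} {K : ℝ}
    (h : ∀ n, MemH1 Ω (v n)) (hK : ∀ n, ‖derivLp Ω (v n)‖ ≤ K) (hv : TendstoWeakly v u) :
    TendstoWeakly (fun n => derivLp Ω (v n)) (derivLp Ω u) := fun e =>
  tendsto_of_subseq_tendsto fun ns hns => by
    obtain ⟨g, ms, -, hg, hgw⟩ :=
      exists_subseq_hasWeakDeriv (fun n => h (ns n)) (fun n => hK (ns n)) (hv.comp hns)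
    exact ⟨ms, hg.derivLp_eq ▸ hgw e⟩

end Edge

/-! ### Point evaluation in `H¹` -/

section PointEvaluation

variable {Ω : Set ℝ} {μ : Measure ℝ} [IsEdge Ω μ]

theorem exists_lp_inner_eq_setIntegral (hμ : μ ≤ volume) {k : ℝ → ℝ} (hk : Continuous k)
    {a b c : ℝ} (hab : a ≤ b) (hc : ∀ s ∈ Set.Ioc a b, |k s| ≤ c) (hc0 : 0 ≤ c) :
    ∃ e : Lp ℂ 2 μ, ‖e‖ ≤ c * √(b - a) ∧
      ∀ f : Lp ℂ 2 μ, inner ℂ e f = ∫ s in Set.Ioc a b, (k s : ℂ) * f s ∂μ := by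
  have hfin : μ (Set.Ioc a b) ≤ ENNReal.ofReal (b - a) := (hμ _).trans_eq Real.volume_Ioc
  have hcfin := hfin.trans_lt ENNReal.ofReal_lt_top
  set f₀ : ℝ → ℂ := (Set.Ioc a b).indicator fun s => (k s : ℂ)
  have hbound : ∀ s, ‖f₀ s‖ ≤ (Set.Ioc a b).indicator (fun _ => c) s := fun s => by
    by_cases hs : s ∈ Set.Ioc a b
    · simpa [f₀, hs] using hc s hs
    · simp [f₀, hs]
  have hmem : MemLp f₀ 2 μ := .of_le (memLp_indicator_const 2 measurableSet_Ioc c (.inr hcfin.ne))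
    ((Complex.continuous_ofReal.comp hk).aestronglyMeasurable.indicator measurableSet_Ioc)
    (.of_forall fun s => (hbound s).trans (le_abs_self _))
  refine ⟨hmem.toLp, ?_, fun f => ?_⟩
  · calc ‖hmem.toLp‖ ≤ ‖indicatorConstLp 2 measurableSet_Ioc hcfin.ne c‖ := by
          refine Lp.norm_le_norm_of_ae_le ?_
          filter_upwards [hmem.coeFn_toLp, indicatorConstLp_coeFn (p := 2)
            (hs := measurableSet_Ioc) (hμs := hcfin.ne) (c := c)] with s hs hs'
          rw [hs, hs']
          exact (hbound s).trans (le_abs_self _)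
      _ = c * √(μ.real (Set.Ioc a b)) := by
          rw [norm_indicatorConstLp two_ne_zero ENNReal.ofNat_ne_top, Real.norm_of_nonneg hc0,
            Real.sqrt_eq_rpow, ENNReal.toReal_ofNat]
      _ ≤ c * √(b - a) := by
          gcongr
          exact ENNReal.toReal_le_of_le_ofReal (sub_nonneg.2 hab) hfin
  · rw [L2.inner_def, ← integral_indicator measurableSet_Ioc]
    refine integral_congr_ae (hmem.coeFn_toLp.mono fun s hs => ?_)
    by_cases hs' : s ∈ Set.Ioc a b
    · simp only [hs, f₀, Set.indicator_of_mem hs', RCLike.inner_apply, Complex.conj_ofReal,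
        mul_comm]
    · simp only [hs, f₀, Set.indicator_of_notMem hs', inner_zero_left]

theorem IsRep.eq_setIntegral {u w : ℝ → ℂ} (h : IsRep Ω u w) {x ℓ : ℝ} (hx : Set.Ioi x ⊆ Ω)
    (hℓ : 0 < ℓ) :
    w x = ∫ s in Set.Ioc x (x + ℓ), ((ℓ⁻¹ : ℝ) : ℂ) * u s ∂(volume.restrict Ω)
      + ∫ s in Set.Ioc x (x + ℓ), ((ℓ⁻¹ * (s - (x + ℓ)) : ℝ) : ℂ) * weakDeriv Ω u s
        ∂(volume.restrict Ω) := by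
  have hsub : Set.Ioc x (x + ℓ) ⊆ Ω := Set.Ioc_subset_Ioi_self.trans hx
  rw [Measure.restrict_restrict_of_subset hsub]
  have hφ : deriv (fun s => ℓ⁻¹ * (s - (x + ℓ))) = fun _ => ℓ⁻¹ := by ext s; simp
  have hparts := h.isPrimitive.integral_deriv_smul (φ := fun s => ℓ⁻¹ * (s - (x + ℓ)))
    (by fun_prop) x (x + ℓ)
  have hℓx : ℓ⁻¹ * (x - (x + ℓ)) = -1 := by field_simp; ring
  simp only [hφ, hℓx, sub_self, mul_zero, zero_smul, neg_smul, one_smul, sub_neg_eq_add,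
    zero_add] at hparts
  rw [intervalIntegral.integral_of_le (by linarith), intervalIntegral.integral_of_le (by linarith),
    eq_sub_iff_add_eq] at hparts
  rw [← hparts]
  congr 1
  · refine integral_congr_ae ?_
    filter_upwards [ae_restrict_of_ae_restrict_of_subset hsub h.ae_eq] with s hs
    rw [← hs, Complex.real_smul]
  · refine setIntegral_congr_fun measurableSet_Ioc fun s hs => ?_
    simp only [Set.indicator_of_mem (hsub hs), Complex.real_smul]

theorem IsRep.exists_eq_inner {x ℓ : ℝ} (hx : Set.Ioi x ⊆ Ω) (hℓ : 0 < ℓ) :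
    ∃ e e' : Lp ℂ 2 μ, ‖e‖ ≤ ℓ⁻¹ * √ℓ ∧ ‖e'‖ ≤ √ℓ ∧ ∀ (u : Lp ℂ 2 μ) (w : ℝ → ℂ),
      IsRep Ω u w → w x = inner ℂ e u + inner ℂ e' (derivLp Ω u) := by
  have hμ : μ = volume.restrict Ω := IsEdge.eq_restrict
  have hμv : μ ≤ volume := hμ ▸ Measure.restrict_le_self
  obtain ⟨e, he, heu⟩ := exists_lp_inner_eq_setIntegral (a := x) (b := x + ℓ) (c := ℓ⁻¹) hμv
    (continuous_const (y := ℓ⁻¹)) (by linarith) (fun s _ => (abs_of_pos (inv_pos.2 hℓ)).le)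
    (by positivity)
  obtain ⟨e', he', heu'⟩ := exists_lp_inner_eq_setIntegral (a := x) (b := x + ℓ) (c := 1) hμv
    (k := fun s => ℓ⁻¹ * (s - (x + ℓ))) (by fun_prop) (by linarith) (fun s hs => by
      rw [abs_mul, abs_of_pos (inv_pos.2 hℓ), inv_mul_le_one₀ hℓ, abs_le]
      constructor <;> linarith [hs.1, hs.2]) zero_le_one
  rw [add_sub_cancel_left] at he he'
  rw [one_mul] at he'
  refine ⟨e, e', he, he', fun u w h => ?_⟩
  rw [heu, heu', h.eq_setIntegral hx hℓ, ← hμ]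
  refine congrArg _ (integral_congr_ae (ae_restrict_of_ae ?_))
  filter_upwards [coeFn_derivLp (Ω := Ω) u] with s hs
  rw [hs]

theorem IsRep.norm_sq_le {u : Lp ℂ 2 μ} {w : ℝ → ℂ} (h : IsRep Ω u w) {x ℓ : ℝ}
    (hx : Set.Ioi x ⊆ Ω) (hℓ : 0 < ℓ) :
    ‖w x‖ ^ 2 ≤ 2 / ℓ * ‖u‖ ^ 2 + 2 * ℓ * ‖derivLp Ω u‖ ^ 2 := by
  obtain ⟨e, e', he, he', hw⟩ := IsRep.exists_eq_inner (μ := μ) hx hℓ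
  have hbound : ‖w x‖ ≤ ℓ⁻¹ * √ℓ * ‖u‖ + √ℓ * ‖derivLp Ω u‖ := by
    rw [hw u w h]
    exact (norm_add_le _ _).trans (add_le_add
      ((norm_inner_le_norm _ _).trans (by gcongr)) ((norm_inner_le_norm _ _).trans (by gcongr)))
  calc ‖w x‖ ^ 2 ≤ (ℓ⁻¹ * √ℓ * ‖u‖ + √ℓ * ‖derivLp Ω u‖) ^ 2 := by gcongr
    _ ≤ 2 * ((ℓ⁻¹ * √ℓ * ‖u‖) ^ 2 + (√ℓ * ‖derivLp Ω u‖) ^ 2) := add_sq_le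
    _ = 2 / ℓ * ‖u‖ ^ 2 + 2 * ℓ * ‖derivLp Ω u‖ ^ 2 := by
        simp only [mul_pow, Real.sq_sqrt hℓ.le]
        field_simp

theorem IsRep.tendsto {v : ℕ → Lp ℂ 2 μ} {u : Lp ℂ 2 μ} {ω : ℕ → ℝ → ℂ} {w : ℝ → ℂ} {K : ℝ}
    (h : ∀ n, MemH1 Ω (v n)) (hK : ∀ n, ‖derivLp Ω (v n)‖ ≤ K) (hv : TendstoWeakly v u)
    (hω : ∀ n, IsRep Ω (v n) (ω n)) (hw : IsRep Ω u w) {x : ℝ} (hx : Set.Ioi x ⊆ Ω) :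
    Tendsto (fun n => ω n x) atTop (𝓝 (w x)) := by
  obtain ⟨e, e', -, -, heq⟩ := IsRep.exists_eq_inner (μ := μ) hx one_pos
  rw [heq u w hw]
  exact ((hv e).add (tendstoWeakly_derivLp h hK hv e')).congr fun n => (heq _ _ (hω n)).symm

end PointEvaluation

/-! ### Schrödinger forms on an edge -/

section EdgePotential

theorem norm_sq_eq_integral {μ : Measure ℝ} (f : Lp ℂ 2 μ) : ‖f‖ ^ 2 = ∫ x, ‖f x‖ ^ 2 ∂μ := by
  have h : ((‖f‖ ^ 2 : ℝ) : ℂ) = ∫ x, ((‖f x‖ ^ 2 : ℝ) : ℂ) ∂μ :=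
    calc ((‖f‖ ^ 2 : ℝ) : ℂ) = inner ℂ f f := by
          rw [Complex.ofReal_pow]
          exact (inner_self_eq_norm_sq_to_K (𝕜 := ℂ) f).symm
      _ = ∫ x, ((‖f x‖ ^ 2 : ℝ) : ℂ) ∂μ := by
          rw [L2.inner_def]
          simp only [inner_self_eq_norm_sq_to_K, Complex.ofReal_pow, Complex.coe_algebraMap]
  exact_mod_cast h.trans integral_complex_ofReal

theorem integrable_norm_sq {μ : Measure ℝ} (f : Lp ℂ 2 μ) : Integrable (fun x => ‖f x‖ ^ 2) μ :=
  (Lp.memLp f).integrable_norm_pow two_ne_zero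

/-- The class of potentials for which the Schrödinger form on an edge is closed and bounded from
below: the negative part is, up to arbitrarily small bounded errors, integrable. -/
structure IsEdgePotential (μ : Measure ℝ) (V : ℝ → ℝ) : Prop where
  aestronglyMeasurable : AEStronglyMeasurable V μ
  integrable_excess : ∀ δ > 0, Integrable (fun x => max (-V x - δ) 0) μ

variable {μ : Measure ℝ} {V : ℝ → ℝ}

theorem isEdgePotential_of_memLp {p : ℝ} (hp : 1 ≤ p)
    (hV : AEStronglyMeasurable (fun x => max (V x) 0) μ)
    (hV' : MemLp (fun x => max (-V x) 0) (ENNReal.ofReal p) μ) : IsEdgePotential μ V := by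
  have hVm : AEStronglyMeasurable V μ := (hV.sub hV'.1).congr <| .of_forall fun x =>
    max_zero_sub_max_neg_zero_eq_self (V x)
  have hp0 : 0 < p := by linarith
  have hint := hV'.integrable_norm_rpow (by simpa using hp0) ENNReal.ofReal_ne_top
  rw [ENNReal.toReal_ofReal hp0.le] at hint
  refine ⟨hVm, fun δ hδ => (hint.const_mul (δ ^ (1 - p))).mono'
    ((hVm.neg.sub aestronglyMeasurable_const).sup aestronglyMeasurable_const)
    (.of_forall fun x => ?_)⟩
  rw [Real.norm_of_nonneg (le_max_right _ _), Real.norm_of_nonneg (le_max_right _ _)]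
  rcases le_or_gt (-V x) δ with hx | hx
  · rw [max_eq_right (sub_nonpos.2 hx)]
    positivity
  · have hVx : 0 < -V x := hδ.trans hx
    rw [max_eq_left (sub_pos.2 hx).le, max_eq_left hVx.le]
    calc -V x - δ ≤ (-V x) ^ (1 - p) * (-V x) ^ p := by
          rw [← Real.rpow_add hVx, sub_add_cancel, Real.rpow_one]; linarith
      _ ≤ δ ^ (1 - p) * (-V x) ^ p := mul_le_mul_of_nonneg_right
          (Real.rpow_le_rpow_of_nonpos hδ hx.le (by linarith)) (Real.rpow_nonneg hVx.le _)

namespace IsEdgePotential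

theorem posPart (hV : IsEdgePotential μ V) : AEStronglyMeasurable (fun x => max (V x) 0) μ :=
  hV.aestronglyMeasurable.sup aestronglyMeasurable_const

theorem negPart (hV : IsEdgePotential μ V) : AEStronglyMeasurable (fun x => max (-V x) 0) μ :=
  hV.aestronglyMeasurable.neg.sup aestronglyMeasurable_const

end IsEdgePotential

theorem negPart_le_add_excess (δ : ℝ) (hδ : 0 ≤ δ) (y : ℝ) : max (-y) 0 ≤ δ + max (-y - δ) 0 := by
  rw [← max_add_add_left, add_zero, add_sub_cancel]
  exact max_le_max le_rfl hδ

theorem excess_le_negPart {δ : ℝ} (hδ : 0 ≤ δ) (y : ℝ) : max (-y - δ) 0 ≤ max (-y) 0 :=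
  max_le_max (sub_le_self _ hδ) le_rfl

end EdgePotential

section EdgeForm

/-- The form domain on one edge `Ω`, without a boundary condition. -/
def edgeDomain (Ω : Set ℝ) (μ : Measure ℝ) (V : ℝ → ℝ) : Set (Lp ℂ 2 μ) :=
  {u | MemH1 Ω u ∧ Integrable (fun x => max (V x) 0 * ‖u x‖ ^ 2) μ}

/-- The Schrödinger form on one edge. -/
def edgeForm (Ω : Set ℝ) (μ : Measure ℝ) (V : ℝ → ℝ) (v u : Lp ℂ 2 μ) : ℂ :=
  ∫ x, (starRingEnd ℂ (weakDeriv Ω v x) * weakDeriv Ω u x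
    + (V x : ℂ) * (starRingEnd ℂ (v x) * u x)) ∂μ

variable {Ω : Set ℝ} {μ : Measure ℝ} [IsEdge Ω μ] {V W : ℝ → ℝ} {u v : Lp ℂ 2 μ}

namespace MemH1

theorem ae_norm_sq_le (hu : MemH1 Ω u) {ℓ : ℝ} (hℓ : 0 < ℓ) :
    ∀ᵐ x ∂μ, ‖u x‖ ^ 2 ≤ 2 / ℓ * ‖u‖ ^ 2 + 2 * ℓ * ‖derivLp Ω u‖ ^ 2 := by
  obtain ⟨w, hw⟩ := hu.exists_isRep (IsEdge.isOpen μ) (IsEdge.isUpperSet μ).ordConnected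
  have hΩ : ∀ᵐ x ∂μ, x ∈ Ω := by
    rw [IsEdge.eq_restrict (Ω := Ω) (μ := μ)]
    exact ae_restrict_mem (IsEdge.isOpen μ).measurableSet
  filter_upwards [IsEdge.ae_eq_restrict_iff.1 hw.ae_eq, hΩ] with x hx hxΩ
  rw [← hx]
  exact hw.norm_sq_le (fun y hy => IsEdge.isUpperSet μ (Set.mem_Ioi.1 hy).le hxΩ) hℓ

theorem integrable_mul_norm_sq (hu : MemH1 Ω u) (hW : Integrable W μ) :
    Integrable (fun x => W x * ‖u x‖ ^ 2) μ := by
  refine hW.mul_bdd (c := 2 / 1 * ‖u‖ ^ 2 + 2 * 1 * ‖derivLp Ω u‖ ^ 2)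
    ((Lp.aestronglyMeasurable u).norm.pow 2) ((hu.ae_norm_sq_le one_pos).mono fun x hx => ?_)
  rwa [Real.norm_of_nonneg (by positivity)]

theorem integral_mul_norm_sq_le (hu : MemH1 Ω u) (hW : Integrable W μ) (hW0 : ∀ x, 0 ≤ W x)
    {ℓ : ℝ} (hℓ : 0 < ℓ) : ∫ x, W x * ‖u x‖ ^ 2 ∂μ
      ≤ (∫ x, W x ∂μ) * (2 / ℓ * ‖u‖ ^ 2 + 2 * ℓ * ‖derivLp Ω u‖ ^ 2) := by
  rw [← integral_mul_const]
  exact integral_mono_ae (hu.integrable_mul_norm_sq hW) (hW.mul_const _)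
    ((hu.ae_norm_sq_le hℓ).mono fun x hx => mul_le_mul_of_nonneg_left hx (hW0 x))

theorem integrable_negPart_mul (hu : MemH1 Ω u) (hV : IsEdgePotential μ V) :
    Integrable (fun x => max (-V x) 0 * ‖u x‖ ^ 2) μ := by
  refine ((integrable_norm_sq u).add
    (hu.integrable_mul_norm_sq (hV.integrable_excess 1 one_pos))).mono'
    (hV.negPart.mul ((Lp.aestronglyMeasurable u).norm.pow 2)) (.of_forall fun x => ?_)
  rw [Real.norm_of_nonneg (by positivity)]
  calc max (-V x) 0 * ‖u x‖ ^ 2 ≤ (1 + max (-V x - 1) 0) * ‖u x‖ ^ 2 :=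
        mul_le_mul_of_nonneg_right (negPart_le_add_excess 1 zero_le_one _) (sq_nonneg _)
    _ = ‖u x‖ ^ 2 + max (-V x - 1) 0 * ‖u x‖ ^ 2 := by rw [add_mul, one_mul]

theorem integral_negPart_mul_le (hu : MemH1 Ω u) (hV : IsEdgePotential μ V) {δ : ℝ} (hδ : 0 < δ) :
    ∫ x, max (-V x) 0 * ‖u x‖ ^ 2 ∂μ
      ≤ δ * ‖u‖ ^ 2 + ∫ x, max (-V x - δ) 0 * ‖u x‖ ^ 2 ∂μ := by
  have hδu := (integrable_norm_sq u).const_mul δ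
  have hW := hu.integrable_mul_norm_sq (hV.integrable_excess δ hδ)
  rw [norm_sq_eq_integral, ← integral_const_mul, ← integral_add hδu hW]
  refine integral_mono (hu.integrable_negPart_mul hV) (hδu.add hW) fun x => ?_
  exact (mul_le_mul_of_nonneg_right (negPart_le_add_excess δ hδ.le _) (sq_nonneg _)).trans_eq
    (add_mul _ _ _)

end MemH1

theorem exists_integral_negPart_le (hV : IsEdgePotential μ V) :
    ∃ C : ℝ, 0 ≤ C ∧ ∀ u : Lp ℂ 2 μ, MemH1 Ω u →
      ∫ x, max (-V x) 0 * ‖u x‖ ^ 2 ∂μ ≤ 1 / 2 * ‖derivLp Ω u‖ ^ 2 + C * ‖u‖ ^ 2 := by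
  have hW := hV.integrable_excess 1 one_pos
  set A := ∫ x, max (-V x - 1) 0 ∂μ
  have hA : 0 ≤ A := integral_nonneg fun x => le_max_right _ _
  set ℓ := 1 / (4 * (A + 1)) with hℓ
  have hℓ0 : 0 < ℓ := by positivity
  have hAℓ : A * (2 * ℓ) ≤ 1 / 2 := by
    rw [hℓ]
    field_simp
    linarith
  refine ⟨1 + A * (2 / ℓ), by positivity, fun u hu => ?_⟩
  calc ∫ x, max (-V x) 0 * ‖u x‖ ^ 2 ∂μ
      ≤ 1 * ‖u‖ ^ 2 + A * (2 / ℓ * ‖u‖ ^ 2 + 2 * ℓ * ‖derivLp Ω u‖ ^ 2) :=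
        (hu.integral_negPart_mul_le hV one_pos).trans <| add_le_add le_rfl <|
          hu.integral_mul_norm_sq_le hW (fun x => le_max_right _ _) hℓ0
    _ = A * (2 * ℓ) * ‖derivLp Ω u‖ ^ 2 + (1 + A * (2 / ℓ)) * ‖u‖ ^ 2 := by ring
    _ ≤ 1 / 2 * ‖derivLp Ω u‖ ^ 2 + (1 + A * (2 / ℓ)) * ‖u‖ ^ 2 := by gcongr

theorem integrable_potential_mul (hV : IsEdgePotential μ V) (hv : v ∈ edgeDomain Ω μ V)
    (hu : u ∈ edgeDomain Ω μ V) :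
    Integrable (fun x => (V x : ℂ) * (starRingEnd ℂ (v x) * u x)) μ := by
  refine ((hv.2.add (hv.1.integrable_negPart_mul hV)).add
    (hu.2.add (hu.1.integrable_negPart_mul hV))).mono'
    ((Complex.continuous_ofReal.comp_aestronglyMeasurable hV.aestronglyMeasurable).mul
      ((Complex.continuous_conj.comp_aestronglyMeasurable (Lp.aestronglyMeasurable v)).mul
        (Lp.aestronglyMeasurable u))) (.of_forall fun x => ?_)
  rw [norm_mul, norm_mul, RCLike.norm_conj, Complex.norm_real, Real.norm_eq_abs]
  calc |V x| * (‖v x‖ * ‖u x‖) ≤ |V x| * (‖v x‖ ^ 2 + ‖u x‖ ^ 2) := by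
        gcongr
        nlinarith [sq_nonneg (‖v x‖ - ‖u x‖), sq_nonneg ‖v x‖, sq_nonneg ‖u x‖]
    _ = (max (V x) 0 + max (-V x) 0) * (‖v x‖ ^ 2 + ‖u x‖ ^ 2) := by
        rw [max_zero_add_max_neg_zero_eq_abs_self]
    _ = _ := by simp only [Pi.add_apply]; ring

theorem edgeForm_eq (hV : IsEdgePotential μ V) (hv : v ∈ edgeDomain Ω μ V)
    (hu : u ∈ edgeDomain Ω μ V) : edgeForm Ω μ V v u
      = inner ℂ (derivLp Ω v) (derivLp Ω u) + ∫ x, (V x : ℂ) * (starRingEnd ℂ (v x) * u x) ∂μ := by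
  have hderiv : (fun x => inner ℂ (derivLp Ω v x) (derivLp Ω u x)) =ᵐ[μ]
      fun x => starRingEnd ℂ (weakDeriv Ω v x) * weakDeriv Ω u x := by
    filter_upwards [coeFn_derivLp (Ω := Ω) v, coeFn_derivLp (Ω := Ω) u] with x hvx hux
    rw [hvx, hux, RCLike.inner_apply, mul_comm]
  rw [edgeForm, L2.inner_def, integral_congr_ae hderiv]
  exact integral_add ((L2.integrable_inner (derivLp Ω v) (derivLp Ω u)).congr hderiv)
    (integrable_potential_mul hV hv hu)

theorem zero_mem_edgeDomain : (0 : Lp ℂ 2 μ) ∈ edgeDomain Ω μ V := by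
  refine ⟨hasWeakDeriv_zero.memH1, (integrable_zero ℝ ℝ μ).congr ?_⟩
  filter_upwards [Lp.coeFn_zero ℂ 2 μ] with x hx
  simp only [hx, Pi.zero_apply, norm_zero, ne_eq, OfNat.ofNat_ne_zero, not_false_eq_true, zero_pow,
    mul_zero]

theorem add_mem_edgeDomain (hV : IsEdgePotential μ V) (hu : u ∈ edgeDomain Ω μ V)
    (hv : v ∈ edgeDomain Ω μ V) : u + v ∈ edgeDomain Ω μ V := by
  refine ⟨(hu.1.hasWeakDeriv_derivLp.add hv.1.hasWeakDeriv_derivLp).memH1,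
    ((hu.2.add hv.2).const_mul 2).mono' (hV.posPart.mul
      ((Lp.aestronglyMeasurable _).norm.pow 2)) ?_⟩
  filter_upwards [Lp.coeFn_add u v] with x hx
  rw [hx, Real.norm_of_nonneg (by positivity)]
  calc max (V x) 0 * ‖u x + v x‖ ^ 2 ≤ max (V x) 0 * (2 * (‖u x‖ ^ 2 + ‖v x‖ ^ 2)) := by
        gcongr
        exact (pow_le_pow_left₀ (norm_nonneg _) (norm_add_le _ _) 2).trans add_sq_le
    _ = _ := by simp only [Pi.add_apply]; ring

theorem smul_mem_edgeDomain (c : ℂ) (hu : u ∈ edgeDomain Ω μ V) : c • u ∈ edgeDomain Ω μ V := by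
  refine ⟨(hu.1.hasWeakDeriv_derivLp.smul c).memH1, (hu.2.const_mul (‖c‖ ^ 2)).congr ?_⟩
  filter_upwards [Lp.coeFn_smul c u] with x hx
  rw [hx, Pi.smul_apply, norm_smul]
  ring

theorem isHermitianForm_edgeForm (hV : IsEdgePotential μ V) :
    IsHermitianForm (edgeDomain Ω μ V) (edgeForm Ω μ V) where
  zero_mem := zero_mem_edgeDomain
  add_mem := add_mem_edgeDomain hV
  smul_mem c _ := smul_mem_edgeDomain c
  add_right {v u u'} hv hu hu' := by
    have hpot : ∫ x, (V x : ℂ) * (starRingEnd ℂ (v x) * (u + u' : Lp ℂ 2 μ) x) ∂μ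
        = ∫ x, (V x : ℂ) * (starRingEnd ℂ (v x) * u x)
          + (V x : ℂ) * (starRingEnd ℂ (v x) * u' x) ∂μ := by
      refine integral_congr_ae ((Lp.coeFn_add u u').mono fun x hx => ?_)
      simp only [hx, Pi.add_apply, mul_add]
    rw [edgeForm_eq hV hv hu, edgeForm_eq hV hv hu',
      edgeForm_eq hV hv (add_mem_edgeDomain hV hu hu'),
      (hu.1.hasWeakDeriv_derivLp.add hu'.1.hasWeakDeriv_derivLp).derivLp_eq, inner_add_right, hpot,
      integral_add (integrable_potential_mul hV hv hu) (integrable_potential_mul hV hv hu'),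
      add_add_add_comm]
  smul_right c v u hv hu := by
    have hpot : ∫ x, (V x : ℂ) * (starRingEnd ℂ (v x) * (c • u : Lp ℂ 2 μ) x) ∂μ
        = ∫ x, c * ((V x : ℂ) * (starRingEnd ℂ (v x) * u x)) ∂μ := by
      refine integral_congr_ae ((Lp.coeFn_smul c u).mono fun x hx => ?_)
      simp only [hx, Pi.smul_apply, smul_eq_mul, mul_left_comm]
    rw [edgeForm_eq hV hv hu, edgeForm_eq hV hv (smul_mem_edgeDomain c hu),
      (hu.1.hasWeakDeriv_derivLp.smul c).derivLp_eq, inner_smul_right, hpot, integral_const_mul,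
      mul_add]
  conj_symm _ _ := by
    rw [edgeForm, edgeForm, ← integral_conj]
    refine integral_congr_ae (.of_forall fun x => ?_)
    simp only [map_add, map_mul, Complex.conj_conj, Complex.conj_ofReal]
    ring

theorem re_edgeForm (hV : IsEdgePotential μ V) (hu : u ∈ edgeDomain Ω μ V) :
    (edgeForm Ω μ V u u).re = ‖derivLp Ω u‖ ^ 2 + (∫ x, max (V x) 0 * ‖u x‖ ^ 2 ∂μ)
      - ∫ x, max (-V x) 0 * ‖u x‖ ^ 2 ∂μ := by
  have hpot : ∫ x, (V x : ℂ) * (starRingEnd ℂ (u x) * u x) ∂μ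
      = ∫ x, ((max (V x) 0 * ‖u x‖ ^ 2 - max (-V x) 0 * ‖u x‖ ^ 2 : ℝ) : ℂ) ∂μ := by
    refine integral_congr_ae (.of_forall fun x => ?_)
    simp only [← sub_mul, max_zero_sub_max_neg_zero_eq_self, Complex.conj_mul']
    push_cast
    ring
  rw [edgeForm_eq hV hu hu, hpot, integral_complex_ofReal, Complex.add_re, Complex.ofReal_re,
    integral_sub hu.2 (hu.1.integrable_negPart_mul hV), ← add_sub_assoc]
  exact congrArg (· + _ - _) (inner_self_eq_norm_sq (𝕜 := ℂ) (derivLp Ω u))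

theorem exists_le_re_edgeForm (Ω : Set ℝ) [IsEdge Ω μ] (hV : IsEdgePotential μ V) :
    ∃ C : ℝ, 0 ≤ C ∧ ∀ u ∈ edgeDomain Ω μ V,
      1 / 2 * ‖derivLp Ω u‖ ^ 2 + ∫ x, max (V x) 0 * ‖u x‖ ^ 2 ∂μ
        ≤ (edgeForm Ω μ V u u).re + C * ‖u‖ ^ 2 := by
  obtain ⟨C, hC, h⟩ := exists_integral_negPart_le (Ω := Ω) hV
  refine ⟨C, hC, fun u hu => ?_⟩
  linarith [re_edgeForm hV hu, h u hu.1]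

end EdgeForm

section EdgeLimit

theorem integrable_and_integral_le_of_tendsto {α : Type*} [MeasurableSpace α] {μ : Measure α}
    {G : ℕ → α → ℝ} {f : α → ℝ} {b : ℝ} (hG : ∀ n, Integrable (G n) μ) (hG0 : ∀ n x, 0 ≤ G n x)
    (hlim : ∀ᵐ x ∂μ, Tendsto (fun n => G n x) atTop (𝓝 (f x)))
    (hb : Tendsto (fun n => ∫ x, G n x ∂μ) atTop (𝓝 b)) :
    Integrable f μ ∧ ∫ x, f x ∂μ ≤ b := by
  have hf0 : 0 ≤ᵐ[μ] f := hlim.mono fun x hx => ge_of_tendsto' hx fun n => hG0 n x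
  have hfm := aestronglyMeasurable_of_tendsto_ae atTop (fun n => (hG n).aestronglyMeasurable) hlim
  have hb0 : 0 ≤ b := ge_of_tendsto' hb fun n => integral_nonneg (hG0 n)
  have hfatou : ∫⁻ x, ENNReal.ofReal (f x) ∂μ ≤ ENNReal.ofReal b :=
    calc ∫⁻ x, ENNReal.ofReal (f x) ∂μ
        = ∫⁻ x, liminf (fun n => ENNReal.ofReal (G n x)) atTop ∂μ :=
          lintegral_congr_ae <| hlim.mono fun x hx =>
            ((ENNReal.continuous_ofReal.tendsto _).comp hx).liminf_eq.symm
      _ ≤ liminf (fun n => ∫⁻ x, ENNReal.ofReal (G n x) ∂μ) atTop :=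
          lintegral_liminf_le' fun n => (hG n).aestronglyMeasurable.aemeasurable.ennreal_ofReal
      _ = ENNReal.ofReal b := by
          simp only [← ofReal_integral_eq_lintegral_ofReal (hG _) (.of_forall (hG0 _))]
          exact ((ENNReal.continuous_ofReal.tendsto _).comp hb).liminf_eq
  have hf : Integrable f μ := ⟨hfm, (hasFiniteIntegral_iff_ofReal hf0).2
    (hfatou.trans_lt ENNReal.ofReal_lt_top)⟩
  rw [← ofReal_integral_eq_lintegral_ofReal hf hf0] at hfatou
  exact ⟨hf, (ENNReal.ofReal_le_ofReal_iff hb0).1 hfatou⟩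

variable {Ω : Set ℝ} {μ : Measure ℝ} [IsEdge Ω μ] {V W : ℝ → ℝ} {v : ℕ → Lp ℂ 2 μ} {u : Lp ℂ 2 μ}
  {K : ℝ}

theorem ae_tendsto_of_tendstoWeakly (h : ∀ n, MemH1 Ω (v n)) (hK : ∀ n, ‖derivLp Ω (v n)‖ ≤ K)
    (hv : TendstoWeakly v u) : ∀ᵐ x ∂μ, Tendsto (fun n => v n x) atTop (𝓝 (u x)) := by
  have hrep : ∀ {f : Lp ℂ 2 μ}, MemH1 Ω f → ∃ w, IsRep Ω f w := fun hf =>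
    hf.exists_isRep (IsEdge.isOpen μ) (IsEdge.isUpperSet μ).ordConnected
  choose ω hω using fun n => hrep (h n)
  obtain ⟨w, hw⟩ := hrep (memH1_of_tendstoWeakly h hK hv)
  have hΩ : ∀ᵐ x ∂μ, x ∈ Ω := by
    rw [IsEdge.eq_restrict (Ω := Ω) (μ := μ)]
    exact ae_restrict_mem (IsEdge.isOpen μ).measurableSet
  filter_upwards [ae_all_iff.2 fun n => IsEdge.ae_eq_restrict_iff.1 (hω n).ae_eq,
    IsEdge.ae_eq_restrict_iff.1 hw.ae_eq, hΩ] with x hωx hwx hxΩ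
  have hx := IsRep.tendsto h hK hv hω hw fun y hy => IsEdge.isUpperSet μ (Set.mem_Ioi.1 hy).le hxΩ
  simpa only [hωx, hwx] using hx

theorem tendsto_integral_mul_norm_sq (h : ∀ n, MemH1 Ω (v n)) (hK : ∀ n, ‖derivLp Ω (v n)‖ ≤ K)
    {r : ℝ} (hr : ∀ n, ‖v n‖ ≤ r) (hv : TendstoWeakly v u) (hW : Integrable W μ) :
    Tendsto (fun n => ∫ x, W x * ‖v n x‖ ^ 2 ∂μ) atTop (𝓝 (∫ x, W x * ‖u x‖ ^ 2 ∂μ)) := by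
  refine tendsto_integral_of_dominated_convergence
    (fun x => ‖W x‖ * (2 / 1 * r ^ 2 + 2 * 1 * K ^ 2))
    (fun n => hW.aestronglyMeasurable.mul ((Lp.aestronglyMeasurable _).norm.pow 2))
    (hW.norm.mul_const _) (fun n => ?_) ?_
  · filter_upwards [(h n).ae_norm_sq_le one_pos] with x hx
    rw [norm_mul, norm_pow, norm_norm]
    refine mul_le_mul_of_nonneg_left (hx.trans ?_) (norm_nonneg _)
    gcongr
    exacts [hr n, hK n]
  · filter_upwards [ae_tendsto_of_tendstoWeakly h hK hv] with x hx
    exact (hx.norm.pow 2).const_mul _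

/-- In the limit the derivative and `V₊` are handled by lower semicontinuity, and `V₋` by dominated
convergence, up to an error `δ r²` which disappears in the end. -/
theorem mem_edgeDomain_and_re_edgeForm_le (hV : IsEdgePotential μ V)
    (hvD : ∀ n, v n ∈ edgeDomain Ω μ V) (hK : ∀ n, ‖derivLp Ω (v n)‖ ≤ K) {r a b m : ℝ}
    (hr : ∀ n, ‖v n‖ ≤ r) (hm : ∀ n, (edgeForm Ω μ V (v n) (v n)).re ≤ m) (hv : TendstoWeakly v u)
    (ha : Tendsto (fun n => ‖derivLp Ω (v n)‖ ^ 2) atTop (𝓝 a))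
    (hb : Tendsto (fun n => ∫ x, max (V x) 0 * ‖v n x‖ ^ 2 ∂μ) atTop (𝓝 b)) :
    u ∈ edgeDomain Ω μ V ∧ (edgeForm Ω μ V u u).re ≤ m := by
  have hH1 := fun n => (hvD n).1
  have huH1 := memH1_of_tendstoWeakly hH1 hK hv
  obtain ⟨hint, hle⟩ := integrable_and_integral_le_of_tendsto (fun n => (hvD n).2)
    (fun n x => by positivity) ((ae_tendsto_of_tendstoWeakly hH1 hK hv).mono fun x hx =>
      (hx.norm.pow 2).const_mul (max (V x) 0)) hb
  refine ⟨⟨huH1, hint⟩, ?_⟩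
  have hderiv := (tendstoWeakly_derivLp hH1 hK hv).norm_sq_le ha
  have hδ : ∀ δ > 0, a + b - (δ * r ^ 2 + ∫ x, max (-V x) 0 * ‖u x‖ ^ 2 ∂μ) ≤ m := fun δ hδ => by
    have hW := hV.integrable_excess δ hδ
    have hWu : ∫ x, max (-V x - δ) 0 * ‖u x‖ ^ 2 ∂μ ≤ ∫ x, max (-V x) 0 * ‖u x‖ ^ 2 ∂μ :=
      integral_mono (huH1.integrable_mul_norm_sq hW) (huH1.integrable_negPart_mul hV) fun x =>
        mul_le_mul_of_nonneg_right (excess_le_negPart hδ.le _) (sq_nonneg _)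
    refine le_trans (by linarith) (le_of_tendsto' ((ha.add hb).sub
      ((tendsto_integral_mul_norm_sq hH1 hK hr hv hW).const_add (δ * r ^ 2))) fun n => ?_)
    have hrn : δ * ‖v n‖ ^ 2 ≤ δ * r ^ 2 := by gcongr; exact hr n
    linarith [hm n, re_edgeForm hV (hvD n), (hH1 n).integral_negPart_mul_le hV hδ]
  have hlim : a + b - ∫ x, max (-V x) 0 * ‖u x‖ ^ 2 ∂μ ≤ m := by
    refine le_of_forall_pos_le_add fun ε hε => ?_
    have := hδ (ε / (r ^ 2 + 1)) (by positivity)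
    have hεr : ε / (r ^ 2 + 1) * r ^ 2 ≤ ε := by
      rw [div_mul_eq_mul_div, div_le_iff₀ (by positivity)]
      nlinarith
    linarith
  linarith [re_edgeForm hV ⟨huH1, hint⟩]

theorem isClosedForm_edgeForm (hV : IsEdgePotential μ V) :
    IsClosedForm (edgeDomain Ω μ V) (edgeForm Ω μ V) where
  toIsHermitianForm := isHermitianForm_edgeForm hV
  bddBelow := by
    obtain ⟨C, -, hC⟩ := exists_le_re_edgeForm Ω hV
    refine ⟨C, fun u hu => ?_⟩
    have hV0 : 0 ≤ ∫ x, max (V x) 0 * ‖u x‖ ^ 2 ∂μ := integral_nonneg fun x => by positivity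
    linarith [hC u hu, sq_nonneg ‖derivLp Ω u‖]
  isSeqClosed {v u r m} hvD hr hm hv := by
    obtain ⟨C, hC0, hC⟩ := exists_le_re_edgeForm Ω hV
    set M := m + C * r ^ 2
    have hVn : ∀ n, 0 ≤ ∫ x, max (V x) 0 * ‖v n x‖ ^ 2 ∂μ := fun n =>
      integral_nonneg fun x => by positivity
    have hM : ∀ n, 1 / 2 * ‖derivLp Ω (v n)‖ ^ 2 + ∫ x, max (V x) 0 * ‖v n x‖ ^ 2 ∂μ ≤ M :=
      fun n => (hC _ (hvD n)).trans <| add_le_add (hm n) <|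
        mul_le_mul_of_nonneg_left (pow_le_pow_left₀ (norm_nonneg _) (hr n) 2) hC0
    have hderiv : ∀ n, ‖derivLp Ω (v n)‖ ^ 2 ≤ 2 * M := fun n => by linarith [hM n, hVn n]
    have hpot : ∀ n, ∫ x, max (V x) 0 * ‖v n x‖ ^ 2 ∂μ ≤ M := fun n => by
      linarith [hM n, sq_nonneg ‖derivLp Ω (v n)‖]
    obtain ⟨a, -, ns, hns, ha⟩ := (isCompact_Icc (a := (0 : ℝ)) (b := 2 * M)).tendsto_subseq
      (x := fun n => ‖derivLp Ω (v n)‖ ^ 2) fun n => ⟨sq_nonneg _, hderiv n⟩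
    obtain ⟨b, -, ks, hks, hb⟩ := (isCompact_Icc (a := (0 : ℝ)) (b := M)).tendsto_subseq
      (x := fun n => ∫ x, max (V x) 0 * ‖v (ns n) x‖ ^ 2 ∂μ) fun n => ⟨hVn _, hpot _⟩
    exact mem_edgeDomain_and_re_edgeForm_le hV (fun n => hvD (ns (ks n)))
      (fun n => Real.le_sqrt_of_sq_le (hderiv (ns (ks n)))) (fun n => hr _) (fun n => hm _)
      (hv.comp (hns.comp hks).tendsto_atTop) (ha.comp hks.tendsto_atTop) hb

end EdgeLimit

/-! ### The form of the star graph -/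

section Star

theorem HasBoundaryValue.add {u v : Lp ℂ 2 (volume.restrict (Set.Ioi (0 : ℝ)))} {c d : ℂ}
    (hu : HasBoundaryValue u c) (hv : HasBoundaryValue v d) :
    HasBoundaryValue (u + v : Lp ℂ 2 (volume.restrict (Set.Ioi (0 : ℝ)))) (c + d) := by
  obtain ⟨w, hw, hwu, rfl⟩ := hu
  obtain ⟨w', hw', hwv, rfl⟩ := hv
  exact ⟨w + w', hw.add hw', (hwu.add hwv).trans (Lp.coeFn_add u v).symm, rfl⟩

theorem HasBoundaryValue.smul {u : Lp ℂ 2 (volume.restrict (Set.Ioi (0 : ℝ)))} {c : ℂ} (a : ℂ)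
    (hu : HasBoundaryValue u c) :
    HasBoundaryValue (a • u : Lp ℂ 2 (volume.restrict (Set.Ioi (0 : ℝ)))) (a * c) := by
  obtain ⟨w, hw, hwu, rfl⟩ := hu
  exact ⟨a • w, hw.const_smul a, (hwu.const_smul a).trans (Lp.coeFn_smul a u).symm, rfl⟩

theorem hasBoundaryValue_zero :
    HasBoundaryValue (0 : Lp ℂ 2 (volume.restrict (Set.Ioi (0 : ℝ)))) 0 :=
  ⟨0, continuousOn_const, (Lp.coeFn_zero ℂ 2 _).symm, rfl⟩

variable {N : ℕ} {V : Fin N → ℝ → ℝ} {u : StarL2 N}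

theorem mem_starDomain : u ∈ starDomain V ↔
    (∀ j, u j ∈ edgeDomain (Set.Ioi 0) (volume.restrict (Set.Ioi 0)) (V j)) ∧
      ∃ c, ∀ j, HasBoundaryValue (u j) c :=
  ⟨fun h => ⟨fun j => ⟨h.1.1 j, h.2 j⟩, h.1.2⟩, fun h => ⟨⟨fun j => (h.1 j).1, h.2⟩,
    fun j => (h.1 j).2⟩⟩

theorem starForm_eq_sumForm (V : Fin N → ℝ → ℝ) : starForm V
    = sumForm fun j => edgeForm (Set.Ioi 0) (volume.restrict (Set.Ioi 0)) (V j) :=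
  rfl

theorem StarPotential.isEdgePotential {p : ℝ} (hp : 1 ≤ p) (hV : StarPotential p V) (j : Fin N) :
    IsEdgePotential (volume.restrict (Set.Ioi 0)) (V j) :=
  isEdgePotential_of_memLp hp ((hV j).1.aestronglyMeasurable.mono_measure
    (Measure.restrict_mono Set.Ioi_subset_Ici_self le_rfl)) (hV j).2

theorem exists_norm_derivLp_sq_le_starForm
    (hV : ∀ j, IsEdgePotential (volume.restrict (Set.Ioi 0)) (V j)) :
    ∃ C : ℝ, 0 ≤ C ∧ ∀ u ∈ starDomain V, ∀ j,
      ‖derivLp (Set.Ioi 0) (u j)‖ ^ 2 ≤ 2 * ((starForm V u u).re + C * ‖u‖ ^ 2) := by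
  choose C hC0 hC using fun j => exists_le_re_edgeForm (Set.Ioi 0) (hV j)
  refine ⟨∑ j, C j, Finset.sum_nonneg fun j _ => hC0 j, fun u hu j => ?_⟩
  have hedge : ∀ i, 1 / 2 * ‖derivLp (Set.Ioi 0) (u i)‖ ^ 2
      ≤ (edgeForm (Set.Ioi 0) (volume.restrict (Set.Ioi 0)) (V i) (u i) (u i)).re
        + C i * ‖u‖ ^ 2 := fun i => by
    have hpos : 0 ≤ ∫ x in Set.Ioi 0, max (V i x) 0 * ‖u i x‖ ^ 2 :=
      integral_nonneg fun x => by positivity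
    have hnorm : C i * ‖u i‖ ^ 2 ≤ C i * ‖u‖ ^ 2 := mul_le_mul_of_nonneg_left
      (pow_le_pow_left₀ (norm_nonneg _) (PiLp.norm_apply_le u i) 2) (hC0 i)
    linarith [hC i _ ((mem_starDomain.1 hu).1 i)]
  have hsum := (Finset.single_le_sum (f := fun i => 1 / 2 * ‖derivLp (Set.Ioi 0) (u i)‖ ^ 2)
    (fun i _ => by positivity) (Finset.mem_univ j)).trans (Finset.sum_le_sum fun i _ => hedge i)
  rw [Finset.sum_add_distrib, ← Finset.sum_mul, ← Complex.re_sum] at hsum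
  rw [starForm_eq_sumForm, sumForm]
  linarith

theorem exists_hasBoundaryValue_of_tendstoWeakly {v : ℕ → StarL2 N} {K : ℝ}
    (hv : ∀ n, v n ∈ starH1 N) (hK : ∀ n j, ‖derivLp (Set.Ioi 0) (v n j)‖ ≤ K)
    (hvu : TendstoWeakly v u) : ∃ c, ∀ j, HasBoundaryValue (u j) c := by
  have hrep : ∀ {f : Lp ℂ 2 (volume.restrict (Set.Ioi (0 : ℝ)))}, MemH1 (Set.Ioi 0) f →
      ∃ w, IsRep (Set.Ioi 0) f w := fun hf => hf.exists_isRep isOpen_Ioi Set.ordConnected_Ioi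
  choose ω hω using fun n j => hrep ((hv n).1 j)
  choose w hw using fun j =>
    hrep (memH1_of_tendstoWeakly (fun n => (hv n).1 j) (fun n => hK n j) (hvu.piLp_apply j))
  have hlim : ∀ j, Tendsto (fun n => ω n j 0) atTop (𝓝 (w j 0)) := fun j =>
    IsRep.tendsto (fun n => (hv n).1 j) (fun n => hK n j) (hvu.piLp_apply j) (fun n => hω n j)
      (hw j) subset_rfl
  have heq : ∀ i j, w i 0 = w j 0 := fun i j =>
    tendsto_nhds_unique (hlim i) <| (hlim j).congr fun n => by
      obtain ⟨c, hc⟩ := (hv n).2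
      rw [(hω n j).eq_of_hasBoundaryValue (hc j), (hω n i).eq_of_hasBoundaryValue (hc i)]
  rcases isEmpty_or_nonempty (Fin N) with hN | ⟨⟨i⟩⟩
  · exact ⟨0, fun j => isEmptyElim j⟩
  · exact ⟨w i 0, fun j => heq i j ▸ (hw j).hasBoundaryValue⟩

/-- The form domain of the star graph as a subspace. -/
def starSubmodule (hV : ∀ j, IsEdgePotential (volume.restrict (Set.Ioi 0)) (V j)) :
    Submodule ℂ (StarL2 N) where
  carrier := starDomain V
  zero_mem' := mem_starDomain.2
    ⟨fun _ => zero_mem_edgeDomain, 0, fun _ => hasBoundaryValue_zero⟩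
  add_mem' hu hv := by
    obtain ⟨hu, c, hc⟩ := mem_starDomain.1 hu
    obtain ⟨hv, d, hd⟩ := mem_starDomain.1 hv
    exact mem_starDomain.2
      ⟨fun j => add_mem_edgeDomain (hV j) (hu j) (hv j), c + d, fun j => (hc j).add (hd j)⟩
  smul_mem' a u hu := by
    obtain ⟨hu, c, hc⟩ := mem_starDomain.1 hu
    exact mem_starDomain.2
      ⟨fun j => smul_mem_edgeDomain a (hu j), a * c, fun j => (hc j).smul a⟩

theorem isClosedForm_starForm
    (hV : ∀ j, IsEdgePotential (volume.restrict (Set.Ioi 0)) (V j)) :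
    IsClosedForm (starDomain V) (starForm V) := by
  have hsum := isClosedForm_sumForm fun j => isClosedForm_edgeForm (Ω := Set.Ioi 0) (hV j)
  refine hsum.mono (S := starSubmodule hV) (fun u hu => (mem_starDomain.1 hu).1)
    fun {v u r m} hvS hvr hvm hvu => ?_
  obtain ⟨C, hC0, hC⟩ := exists_norm_derivLp_sq_le_starForm hV
  have hderiv : ∀ n j, ‖derivLp (Set.Ioi 0) (v n j)‖ ≤ √(2 * (m + C * r ^ 2)) := fun n j => by
    refine Real.le_sqrt_of_sq_le ((hC _ (hvS n) j).trans ?_)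
    gcongr
    exacts [hvm n, hvr n]
  exact mem_starDomain.2 ⟨(hsum.isSeqClosed (fun n => (mem_starDomain.1 (hvS n)).1) hvr hvm hvu).1,
    exists_hasBoundaryValue_of_tendstoWeakly (fun n => (hvS n).1) hderiv hvu⟩

end Star

/-! ### Gluing two edges to a line -/

section Glue

open Classical in
/-- The function on the line that consists of `f` on the positive half-line and of the reflection
of `g` on the negative one. -/
def glue {α : Type*} (f g : ℝ → α) : ℝ → α :=
  (Set.Ioi (0 : ℝ)).piecewise f fun x => g (-x)

theorem glue_apply {α : Type*} (f g : ℝ → α) (x : ℝ) :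
    glue f g x = if 0 < x then f x else g (-x) :=
  if_congr Set.mem_Ioi rfl rfl

theorem apply_glue {α β : Type*} (F : α → β) (f g : ℝ → α) (x : ℝ) :
    F (glue f g x) = glue (fun x => F (f x)) (fun x => F (g x)) x := by
  rw [glue_apply, glue_apply, apply_ite F]

theorem apply_glue₂ {α β δ : Type*} (F : α → β → δ) (f g : ℝ → α) (f' g' : ℝ → β) (x : ℝ) :
    F (glue f g x) (glue f' g' x) = glue (fun x => F (f x) (f' x)) (fun x => F (g x) (g' x)) x := by
  simp only [glue_apply]
  split_ifs <;> rfl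

theorem measurePreserving_neg_compl : MeasurePreserving (fun x : ℝ => -x)
    (volume.restrict (Set.Ioi (0 : ℝ))ᶜ) (volume.restrict (Set.Ioi (0 : ℝ))) := by
  have h := (Measure.measurePreserving_neg (volume : Measure ℝ)).restrict_preimage
    (measurableSet_Ici (a := (0 : ℝ)))
  have hs : (Neg.neg ⁻¹' Set.Ici (0 : ℝ)) = (Set.Ioi (0 : ℝ))ᶜ := by
    rw [Set.neg_preimage, Set.neg_Ici, neg_zero, Set.compl_Ioi]
  rwa [hs, ← Measure.restrict_congr_set Ioi_ae_eq_Ici] at h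

theorem glue_ae_eq {α : Type*} {f g f' g' : ℝ → α}
    (hf : f =ᵐ[volume.restrict (Set.Ioi (0 : ℝ))] f')
    (hg : g =ᵐ[volume.restrict (Set.Ioi (0 : ℝ))] g') : glue f g =ᵐ[volume] glue f' g' := by
  have hpos := (ae_restrict_iff' measurableSet_Ioi).1 hf
  have hneg := (ae_restrict_iff' measurableSet_Ioi.compl).1
    (measurePreserving_neg_compl.quasiMeasurePreserving.ae_eq_comp hg)
  filter_upwards [hpos, hneg] with x hxpos hxneg
  rw [glue_apply, glue_apply]
  split_ifs with h
  exacts [hxpos h, hxneg h]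

section Integral

variable {F : Type*} [NormedAddCommGroup F] {f g : ℝ → F}

theorem memLp_glue {p : ENNReal} (hf : MemLp f p (volume.restrict (Set.Ioi (0 : ℝ))))
    (hg : MemLp g p (volume.restrict (Set.Ioi (0 : ℝ)))) : MemLp (glue f g) p volume :=
  MemLp.piecewise (g := fun x => g (-x)) measurableSet_Ioi hf
    (hg.comp_measurePreserving measurePreserving_neg_compl)

theorem integrable_glue (hf : IntegrableOn f (Set.Ioi (0 : ℝ)))
    (hg : IntegrableOn g (Set.Ioi (0 : ℝ))) : Integrable (glue f g) :=
  memLp_one_iff_integrable.1 <|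
    memLp_glue (memLp_one_iff_integrable.2 hf) (memLp_one_iff_integrable.2 hg)

theorem integral_glue [NormedSpace ℝ F] (hf : IntegrableOn f (Set.Ioi (0 : ℝ)))
    (hg : IntegrableOn g (Set.Ioi (0 : ℝ))) :
    ∫ x, glue f g x = (∫ x in Set.Ioi (0 : ℝ), f x) + ∫ x in Set.Ioi (0 : ℝ), g x := by
  have hneg := (Homeomorph.neg ℝ).measurableEmbedding
  rw [glue, integral_piecewise (g := fun x => g (-x)) measurableSet_Ioi hf
    ((measurePreserving_neg_compl.integrable_comp_emb hneg).2 hg),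
    measurePreserving_neg_compl.integral_comp hneg]

theorem locallyIntegrable_glue (hf : LocallyIntegrableOn f (Set.Ici 0))
    (hg : LocallyIntegrableOn g (Set.Ici 0)) : LocallyIntegrable (glue f g) := by
  refine locallyIntegrable_iff.2 fun K hK => ?_
  have hpos : IntegrableOn (glue f g) (K ∩ Set.Ioi 0) :=
    ((hf.integrableOn_compact_subset Set.inter_subset_right (hK.inter_right isClosed_Ici)).mono_set
      (Set.inter_subset_inter_right K Set.Ioi_subset_Ici_self)).congr_fun
      (fun x hx => ((glue_apply f g x).trans (if_pos hx.2)).symm)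
      (hK.measurableSet.inter measurableSet_Ioi)
  have hneg : IntegrableOn (glue f g) (K ∩ Set.Iic 0) := by
    have hg' := (hg.integrableOn_compact_subset Set.inter_subset_right
      ((hK.neg).inter_right isClosed_Ici)).comp_neg
    rw [Set.inter_neg, neg_neg, Set.neg_Ici, neg_zero] at hg'
    exact hg'.congr_fun (fun x hx => ((glue_apply f g x).trans (if_neg (not_lt.2 hx.2))).symm)
      (hK.measurableSet.inter measurableSet_Iic)
  rw [← Set.inter_univ K, ← Set.Ioi_union_Iic, Set.inter_union_distrib_left]
  exact hpos.union hneg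

end Integral

theorem lintegral_glue (f g : ℝ → ENNReal) :
    ∫⁻ x, glue f g x = (∫⁻ x in Set.Ioi (0 : ℝ), f x) + ∫⁻ x in Set.Ioi (0 : ℝ), g x := by
  rw [glue, lintegral_piecewise measurableSet_Ioi,
    measurePreserving_neg_compl.lintegral_comp_emb (Homeomorph.neg ℝ).measurableEmbedding]

theorem IsTestFunction.comp_neg {φ : ℝ → ℝ} (hφ : IsTestFunction Set.univ φ) :
    IsTestFunction Set.univ fun x => φ (-x) where
  contDiff := hφ.contDiff.comp contDiff_neg
  hasCompactSupport := hφ.hasCompactSupport.comp_homeomorph (Homeomorph.neg ℝ)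
  tsupport_subset := Set.subset_univ _

theorem IsTestFunction.integral_mul_glue {φ : ℝ → ℝ} (hφ : IsTestFunction Set.univ φ)
    {f g : ℝ → ℂ} (hf : MemLp f 2 (volume.restrict (Set.Ioi (0 : ℝ))))
    (hg : MemLp g 2 (volume.restrict (Set.Ioi (0 : ℝ)))) :
    ∫ x, (φ x : ℂ) * glue f g x = (∫ x in Set.Ioi (0 : ℝ), (φ x : ℂ) * f x)
      + ∫ x in Set.Ioi (0 : ℝ), (φ (-x) : ℂ) * g x := by
  rw [← integral_glue (f := fun x => (φ x : ℂ) * f x)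
    (g := fun x => (φ (-x) : ℂ) * g x) ((hφ.memLp _).integrable_mul hf)
    ((hφ.comp_neg.memLp _).integrable_mul hg)]
  refine integral_congr_ae (.of_forall fun x => ?_)
  simp only [glue_apply, mul_ite, neg_neg]

theorem hasWeakDeriv_glue {u v : ℝ → ℂ} (hu : MemH1 (Set.Ioi 0) u) (hv : MemH1 (Set.Ioi 0) v)
    {c : ℂ} (huc : HasBoundaryValue u c) (hvc : HasBoundaryValue v c) :
    HasWeakDeriv Set.univ (glue u v)
      (glue (weakDeriv (Set.Ioi 0) u) (-weakDeriv (Set.Ioi 0) v)) := by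
  obtain ⟨w, hw⟩ := hu.exists_isRep isOpen_Ioi (isUpperSet_Ioi 0).ordConnected
  obtain ⟨w', hw'⟩ := hv.exists_isRep isOpen_Ioi (isUpperSet_Ioi 0).ordConnected
  refine hasWeakDeriv_iff.2 fun φ hφ => ?_
  have hparts := hw.setIntegral_Ioi_deriv_mul (hφ.contDiff.of_le (mod_cast le_top))
    hφ.hasCompactSupport
  have hparts' := hw'.setIntegral_Ioi_deriv_mul (hφ.comp_neg.contDiff.of_le (mod_cast le_top))
    hφ.comp_neg.hasCompactSupport
  simp only [deriv_comp_neg, Complex.ofReal_neg, neg_mul, neg_zero] at hparts'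
  rw [integral_neg] at hparts'
  rw [Measure.restrict_univ, hφ.deriv.integral_mul_glue hu.1 hv.1,
    hφ.integral_mul_glue (memLp_weakDeriv u) (memLp_weakDeriv v).neg]
  simp only [Pi.neg_apply, mul_neg]
  rw [integral_neg]
  rw [hw.eq_of_hasBoundaryValue huc] at hparts
  rw [hw'.eq_of_hasBoundaryValue hvc] at hparts'
  linear_combination hparts - hparts'

/-- The function on the line glued from two functions on the half-line, as an element of `L²`. -/
def glueLp (u v : Lp ℂ 2 (volume.restrict (Set.Ioi (0 : ℝ)))) : LineL2 :=
  (memLp_glue (Lp.memLp u) (Lp.memLp v)).toLp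

variable {u v u' v' : Lp ℂ 2 (volume.restrict (Set.Ioi (0 : ℝ)))}

theorem coeFn_glueLp (u v : Lp ℂ 2 (volume.restrict (Set.Ioi (0 : ℝ)))) :
    glueLp u v =ᵐ[volume] glue u v :=
  MemLp.coeFn_toLp _

theorem inner_glueLp (u v u' v' : Lp ℂ 2 (volume.restrict (Set.Ioi (0 : ℝ)))) :
    inner ℂ (glueLp u v) (glueLp u' v') = inner ℂ u u' + inner ℂ v v' := by
  simp only [L2.inner_def]
  rw [← integral_glue (f := fun x => inner ℂ (u x) (u' x)) (g := fun x => inner ℂ (v x) (v' x))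
    (L2.integrable_inner u u') (L2.integrable_inner v v')]
  refine integral_congr_ae ?_
  filter_upwards [coeFn_glueLp u v, coeFn_glueLp u' v'] with x hx hx'
  rw [hx, hx', apply_glue₂ (inner ℂ)]

theorem hasWeakDeriv_glueLp (hu : MemH1 (Set.Ioi 0) u) (hv : MemH1 (Set.Ioi 0) v)
    {c : ℂ} (huc : HasBoundaryValue u c) (hvc : HasBoundaryValue v c) :
    HasWeakDeriv Set.univ (glueLp u v)
      (glueLp (derivLp (Set.Ioi 0) u) (-derivLp (Set.Ioi 0) v)) := by
  refine (hasWeakDeriv_glue hu hv huc hvc).congr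
    ((IsEdge.ae_eq_restrict_iff (μ := volume)).2 (coeFn_glueLp u v).symm)
    ((IsEdge.ae_eq_restrict_iff (μ := volume)).2 ?_)
  exact ((coeFn_glueLp _ _).trans (glue_ae_eq (coeFn_derivLp u)
    ((Lp.coeFn_neg _).trans (coeFn_derivLp v).neg))).symm

variable {V V' : ℝ → ℝ}

theorem glueLp_mem_edgeDomain
    (hu : u ∈ edgeDomain (Set.Ioi 0) (volume.restrict (Set.Ioi 0)) V)
    (hv : v ∈ edgeDomain (Set.Ioi 0) (volume.restrict (Set.Ioi 0)) V')
    {c : ℂ} (huc : HasBoundaryValue u c) (hvc : HasBoundaryValue v c) :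
    glueLp u v ∈ edgeDomain Set.univ volume (glue V V') := by
  refine ⟨(hasWeakDeriv_glueLp hu.1 hv.1 huc hvc).memH1, (integrable_glue hu.2 hv.2).congr ?_⟩
  filter_upwards [coeFn_glueLp u v] with x hx
  rw [hx, apply_glue₂ fun (a : ℝ) (z : ℂ) => max a 0 * ‖z‖ ^ 2]

theorem edgeForm_glueLp (hV : IsEdgePotential (volume.restrict (Set.Ioi 0)) V)
    (hV' : IsEdgePotential (volume.restrict (Set.Ioi 0)) V')
    (hVV' : IsEdgePotential volume (glue V V'))
    (hu : u ∈ edgeDomain (Set.Ioi 0) (volume.restrict (Set.Ioi 0)) V)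
    (hv : v ∈ edgeDomain (Set.Ioi 0) (volume.restrict (Set.Ioi 0)) V')
    (hu' : u' ∈ edgeDomain (Set.Ioi 0) (volume.restrict (Set.Ioi 0)) V)
    (hv' : v' ∈ edgeDomain (Set.Ioi 0) (volume.restrict (Set.Ioi 0)) V')
    {c d : ℂ} (huc : HasBoundaryValue u c) (hvc : HasBoundaryValue v c)
    (hud : HasBoundaryValue u' d) (hvd : HasBoundaryValue v' d) :
    edgeForm Set.univ volume (glue V V') (glueLp u v) (glueLp u' v')
      = edgeForm (Set.Ioi 0) (volume.restrict (Set.Ioi 0)) V u u'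
        + edgeForm (Set.Ioi 0) (volume.restrict (Set.Ioi 0)) V' v v' := by
  have hpot : ∫ x, ((glue V V' x : ℝ) : ℂ) * (starRingEnd ℂ (glueLp u v x) * glueLp u' v' x)
      = (∫ x in Set.Ioi 0, (V x : ℂ) * (starRingEnd ℂ (u x) * u' x))
        + ∫ x in Set.Ioi 0, (V' x : ℂ) * (starRingEnd ℂ (v x) * v' x) := by
    rw [← integral_glue (integrable_potential_mul hV hu hu') (integrable_potential_mul hV' hv hv')]
    refine integral_congr_ae ?_
    filter_upwards [coeFn_glueLp u v, coeFn_glueLp u' v'] with x hx hx'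
    rw [hx, hx', apply_glue₂ fun a b : ℂ => starRingEnd ℂ a * b,
      apply_glue₂ fun (r : ℝ) (z : ℂ) => (r : ℂ) * z]
  rw [edgeForm_eq hVV' (glueLp_mem_edgeDomain hu hv huc hvc)
    (glueLp_mem_edgeDomain hu' hv' hud hvd), edgeForm_eq hV hu hu', edgeForm_eq hV' hv hv',
    (hasWeakDeriv_glueLp hu.1 hv.1 huc hvc).derivLp_eq,
    (hasWeakDeriv_glueLp hu'.1 hv'.1 hud hvd).derivLp_eq, inner_glueLp, inner_neg_neg, hpot]
  ring

end Glue

/-! ### From the line to the star graph -/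

section UpperBound

theorem LinePotential.isEdgePotential {p : ℝ} (hp : 1 ≤ p) {V : ℝ → ℝ} (hV : LinePotential p V) :
    IsEdgePotential volume V :=
  isEdgePotential_of_memLp hp hV.1.aestronglyMeasurable hV.2

theorem lintegral_glue_potential (V V' : ℝ → ℝ) (p : ℝ) :
    ∫⁻ x, ENNReal.ofReal (max (-glue V V' x) 0 ^ p)
      = (∫⁻ x in Set.Ioi (0 : ℝ), ENNReal.ofReal (max (-V x) 0 ^ p))
        + ∫⁻ x in Set.Ioi (0 : ℝ), ENNReal.ofReal (max (-V' x) 0 ^ p) := by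
  rw [← lintegral_glue]
  exact lintegral_congr fun x => apply_glue (fun a : ℝ => ENNReal.ofReal (max (-a) 0 ^ p)) V V' x

/-- A family of lines, the `i`-th of which consists of the edges `right i` and `left i` of the star
graph, that covers each edge with total weight one. A line may join an edge to its own mirror
image. -/
structure LineCover (N : ℕ) (ι : Type*) [Fintype ι] where
  right : ι → Fin N
  left : ι → Fin N
  weight : ι → ℝ
  sum_weight : ∀ f : Fin N → ℂ,
    ∑ i, (weight i : ℂ) ^ 2 * (f (right i) + f (left i)) = ∑ j, f j

variable {N : ℕ} {V : Fin N → ℝ → ℝ} {p γ : ℝ}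

theorem StarPotential.linePotential_glue (hV : StarPotential p V) (i j : Fin N) :
    LinePotential p (glue (V i) (V j)) := by
  refine ⟨(locallyIntegrable_glue (hV i).1 (hV j).1).congr (.of_forall fun x => ?_),
    (memLp_glue (hV i).2 (hV j).2).ae_eq (.of_forall fun x => ?_)⟩
  exacts [(apply_glue (fun a : ℝ => max a 0) _ _ x).symm,
    (apply_glue (fun a : ℝ => max (-a) 0) _ _ x).symm]

namespace LineCover

variable {ι : Type*} [Fintype ι] (C : LineCover N ι)

/-- The potential on the `i`-th line of the cover. -/
def potential (V : Fin N → ℝ → ℝ) (i : ι) : ℝ → ℝ :=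
  glue (V (C.right i)) (V (C.left i))

/-- The function on the lines of the cover induced by a function on the star graph, multiplied by
the weights of the lines. -/
def lift (u : StarL2 N) : PiLp 2 fun _ : ι => LineL2 :=
  WithLp.toLp 2 fun i => (C.weight i : ℂ) • glueLp (u (C.right i)) (u (C.left i))

theorem lift_apply (u : StarL2 N) (i : ι) :
    C.lift u i = (C.weight i : ℂ) • glueLp (u (C.right i)) (u (C.left i)) := rfl

theorem inner_lift (u v : StarL2 N) : inner ℂ (C.lift u) (C.lift v) = inner ℂ u v := by
  rw [PiLp.inner_apply, PiLp.inner_apply, ← C.sum_weight]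
  refine Finset.sum_congr rfl fun i _ => ?_
  rw [lift_apply, lift_apply, inner_smul_left, inner_smul_right, inner_glueLp, Complex.conj_ofReal,
    ← mul_assoc, ← sq]

theorem lift_mem (hVC : ∀ i, IsEdgePotential volume (C.potential V i)) {u : StarL2 N}
    (hu : u ∈ starDomain V) :
    C.lift u ∈ sumDomain fun i => edgeDomain Set.univ volume (C.potential V i) := fun i => by
  obtain ⟨hedge, c, hc⟩ := mem_starDomain.1 hu
  exact (isHermitianForm_edgeForm (hVC i)).smul_mem _
    (glueLp_mem_edgeDomain (hedge _) (hedge _) (hc _) (hc _))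

theorem sumForm_lift (hV : ∀ j, IsEdgePotential (volume.restrict (Set.Ioi 0)) (V j))
    (hVC : ∀ i, IsEdgePotential volume (C.potential V i)) {u v : StarL2 N}
    (hu : u ∈ starDomain V) (hv : v ∈ starDomain V) :
    sumForm (fun i => edgeForm Set.univ volume (C.potential V i)) (C.lift u) (C.lift v)
      = starForm V u v := by
  obtain ⟨hu, c, hc⟩ := mem_starDomain.1 hu
  obtain ⟨hv, d, hd⟩ := mem_starDomain.1 hv
  rw [starForm_eq_sumForm, sumForm, sumForm, ← C.sum_weight]
  refine Finset.sum_congr rfl fun i _ => ?_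
  have hf := isHermitianForm_edgeForm (Ω := Set.univ) (hVC i)
  have hui := glueLp_mem_edgeDomain (hu (C.right i)) (hu (C.left i)) (hc _) (hc _)
  have hvi := glueLp_mem_edgeDomain (hv (C.right i)) (hv (C.left i)) (hd _) (hd _)
  rw [lift_apply, lift_apply, hf.smul_right _ (hf.smul_mem _ hui) hvi, hf.smul_left _ hui hvi,
    potential, edgeForm_glueLp (hV _) (hV _) (hVC i) (hu _) (hu _) (hv _) (hv _) (hc _) (hc _)
      (hd _) (hd _), Complex.conj_ofReal, ← mul_assoc, ← sq]

theorem negTrace_starForm_le (hV : ∀ j, IsEdgePotential (volume.restrict (Set.Ioi 0)) (V j))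
    (hVC : ∀ i, IsEdgePotential volume (C.potential V i)) (hγ : 0 ≤ γ) :
    negTrace (starDomain V) (starForm V) γ
      ≤ ∑ i, negTrace (lineDomain (C.potential V i)) (lineForm (C.potential V i)) γ := by
  have hclosed := fun i => isClosedForm_edgeForm (Ω := Set.univ) (hVC i)
  refine ((isClosedForm_starForm hV).toIsHermitianForm.negTrace_le_of_isometric hγ
    (isClosedForm_sumForm hclosed) (fun u hu => C.lift_mem hVC hu)
    (fun u _ v _ => C.inner_lift u v) fun u hu v hv => C.sumForm_lift hV hVC hu hv).trans ?_
  exact negTrace_sumForm_le (fun i => (hclosed i).toIsHermitianForm) γ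

theorem negTrace_starForm_le_mul (hγ : 1 / 2 ≤ γ) {L : ENNReal} (hL : LineLiebThirring γ L)
    (hV : StarPotential (γ + 1 / 2) V) : negTrace (starDomain V) (starForm V) γ
      ≤ L * ∑ i, ((∫⁻ x in Set.Ioi 0, ENNReal.ofReal (max (-V (C.right i) x) 0 ^ (γ + 1 / 2)))
        + ∫⁻ x in Set.Ioi 0, ENNReal.ofReal (max (-V (C.left i) x) 0 ^ (γ + 1 / 2))) := by
  have hp : 1 ≤ γ + 1 / 2 := by linarith
  have hVC := fun i => hV.linePotential_glue (C.right i) (C.left i)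
  refine (C.negTrace_starForm_le (hV.isEdgePotential hp) (fun i => (hVC i).isEdgePotential hp)
    (by linarith)).trans ?_
  rw [Finset.mul_sum]
  exact Finset.sum_le_sum fun i _ => (hL _ (hVC i)).trans_eq (by rw [lintegral_glue_potential])

end LineCover

theorem sum_add_of_equiv {A M : Type*} [AddCommMonoid A] [Fintype M] (e : M × Bool ≃ Fin N)
    (f : Fin N → A) : ∑ m, (f (e (m, true)) + f (e (m, false))) = ∑ j, f j := by
  simp only [← e.sum_comp f, Fintype.sum_prod_type, Fintype.sum_bool]

theorem add_sum_add_of_equiv {A M : Type*} [AddCommMonoid A] [Fintype M]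
    (e : Option (M × Bool) ≃ Fin N) (f : Fin N → A) :
    f (e none) + ∑ m, (f (e (some (m, true))) + f (e (some (m, false)))) = ∑ j, f j := by
  simp only [← e.sum_comp f, Fintype.sum_option, Fintype.sum_prod_type, Fintype.sum_bool]

/-- The cover of a star graph with an even number of edges by disjoint lines. -/
def LineCover.ofEven {M : Type*} [Fintype M] (e : M × Bool ≃ Fin N) : LineCover N M where
  right m := e (m, true)
  left m := e (m, false)
  weight _ := 1
  sum_weight f := by simp only [Complex.ofReal_one, one_pow, one_mul, sum_add_of_equiv]

/-- The cover of a star graph with an odd number of edges, in which the edge `e none` is joined to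
its own mirror image. -/
def LineCover.ofOdd {M : Type*} [Fintype M] (e : Option (M × Bool) ≃ Fin N) :
    LineCover N (Option M) where
  right o := o.elim (e none) fun m => e (some (m, true))
  left o := o.elim (e none) fun m => e (some (m, false))
  weight o := o.elim (√2)⁻¹ fun _ => 1
  sum_weight f := by
    have hsqrt : (((√2)⁻¹ : ℝ) : ℂ) ^ 2 = 2⁻¹ := by
      rw [← Complex.ofReal_pow, inv_pow, Real.sq_sqrt zero_le_two, Complex.ofReal_inv,
        Complex.ofReal_ofNat]
    simp only [Fintype.sum_option, Option.elim_none, Option.elim_some, Complex.ofReal_one, one_pow,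
      one_mul, hsqrt, ← add_sum_add_of_equiv e f]
    ring

theorem starLiebThirring_of_even (hγ : 1 / 2 ≤ γ) (hN : Even N) {L : ENNReal}
    (hL : LineLiebThirring γ L) : StarLiebThirring γ N L := by
  intro V hV
  obtain ⟨M, hM⟩ := hN
  let e : Fin M × Bool ≃ Fin N := Fintype.equivOfCardEq (by simp; omega)
  refine ((LineCover.ofEven e).negTrace_starForm_le_mul hγ hL hV).trans_eq ?_
  exact congrArg (L * ·) (sum_add_of_equiv e fun j =>
    ∫⁻ x in Set.Ioi 0, ENNReal.ofReal (max (-V j x) 0 ^ (γ + 1 / 2)))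

theorem exists_equiv_option_apply_none {A : Type*} (e : Option A ≃ Fin N) (j : Fin N) :
    ∃ e' : Option A ≃ Fin N, e' none = j :=
  ⟨e.trans (Equiv.swap (e none) j), by simp⟩

theorem add_sum_le_of_forall_le {j₀ : Fin N} {I : Fin N → ENNReal} (hj₀ : ∀ j, I j₀ ≤ I j) :
    I j₀ + ∑ j, I j ≤ (N + 1 : ENNReal) / N * ∑ j, I j := by
  have hN : (N : ENNReal) ≠ 0 := Nat.cast_ne_zero.2 j₀.pos.ne'
  have hI : I j₀ ≤ (∑ j, I j) / N := by
    rw [ENNReal.le_div_iff_mul_le (.inl hN) (.inl (ENNReal.natCast_ne_top N)), mul_comm,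
      ← nsmul_eq_mul]
    simpa using Finset.card_nsmul_le_sum Finset.univ I (I j₀) fun j _ => hj₀ j
  calc I j₀ + ∑ j, I j ≤ (∑ j, I j) / N + ∑ j, I j := by gcongr
    _ = (N + 1 : ENNReal) / N * ∑ j, I j := by
      rw [ENNReal.add_div, ENNReal.div_self hN (ENNReal.natCast_ne_top N), add_mul, one_mul,
        add_comm, one_div, mul_comm, div_eq_mul_inv, mul_comm]

theorem starLiebThirring_of_odd (hγ : 1 / 2 ≤ γ) (hN : Odd N) {L : ENNReal}
    (hL : LineLiebThirring γ L) : StarLiebThirring γ N ((N + 1 : ENNReal) / N * L) := by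
  intro V hV
  obtain ⟨M, hM⟩ := hN
  have : Nonempty (Fin N) := ⟨⟨0, by omega⟩⟩
  set I : Fin N → ENNReal := fun j =>
    ∫⁻ x in Set.Ioi (0 : ℝ), ENNReal.ofReal (max (-V j x) 0 ^ (γ + 1 / 2))
  -- Doubling the edge that carries the least potential costs a fraction `1 / N` of the total.
  obtain ⟨j₀, hj₀⟩ := Finite.exists_min I
  obtain ⟨e, rfl⟩ := exists_equiv_option_apply_none
    (Fintype.equivOfCardEq (by simp; omega) : Option (Fin M × Bool) ≃ Fin N) j₀
  calc negTrace (starDomain V) (starForm V) γ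
      ≤ L * ∑ o, (I ((LineCover.ofOdd e).right o) + I ((LineCover.ofOdd e).left o)) :=
        (LineCover.ofOdd e).negTrace_starForm_le_mul hγ hL hV
    _ = L * (I (e none) + ∑ j, I j) := by
        rw [Fintype.sum_option, ← add_sum_add_of_equiv e I, ← add_assoc]
        rfl
    _ ≤ L * ((N + 1 : ENNReal) / N * ∑ j, I j) := by
        gcongr
        exact add_sum_le_of_forall_le hj₀
    _ = (N + 1 : ENNReal) / N * L * ∑ j, I j := by ring

end UpperBound

/-! ### Cutting off functions on the line -/

section Cutoff

open Real

theorem deriv_smoothTransition_of_nonpos {x : ℝ} (hx : x ≤ 0) : deriv smoothTransition x = 0 := by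
  refine IsLocalMin.deriv_eq_zero (.of_forall fun y => ?_)
  rw [smoothTransition.zero_of_nonpos hx]
  exact smoothTransition.nonneg y

theorem deriv_smoothTransition_of_one_le {x : ℝ} (hx : 1 ≤ x) : deriv smoothTransition x = 0 := by
  refine IsLocalMax.deriv_eq_zero (.of_forall fun y => ?_)
  rw [smoothTransition.one_of_one_le hx]
  exact smoothTransition.le_one y

theorem continuous_deriv_smoothTransition : Continuous (deriv smoothTransition) :=
  (smoothTransition.contDiff (n := 1)).continuous_deriv le_rfl

theorem exists_forall_abs_deriv_smoothTransition_le :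
    ∃ C : ℝ, ∀ x, |deriv smoothTransition x| ≤ C :=
  continuous_deriv_smoothTransition.bounded_above_of_compact_support <|
    HasCompactSupport.intro (isCompact_Icc (a := (0 : ℝ)) (b := 1)) fun x hx => by
      rcases lt_or_ge x 0 with h | h
      · exact deriv_smoothTransition_of_nonpos h.le
      · exact deriv_smoothTransition_of_one_le (not_le.1 fun h1 => hx ⟨h, h1⟩).le

theorem abs_smoothTransition_le_one (x : ℝ) : |smoothTransition x| ≤ 1 := by
  rw [abs_of_nonneg (smoothTransition.nonneg x)]
  exact smoothTransition.le_one x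

theorem tendsto_smoothTransition_atTop : Tendsto smoothTransition atTop (𝓝 1) :=
  tendsto_const_nhds.congr' <| (eventually_ge_atTop 1).mono fun _ hx =>
    (smoothTransition.one_of_one_le hx).symm

theorem continuous_smoothTransition_sq : Continuous fun x => smoothTransition x ^ 2 :=
  smoothTransition.continuous.pow 2

theorem abs_smoothTransition_sq_le_one (x : ℝ) : |smoothTransition x ^ 2| ≤ 1 := by
  rw [abs_pow]
  exact pow_le_one₀ (abs_nonneg _) (abs_smoothTransition_le_one x)

theorem tendsto_smoothTransition_sq_atTop :
    Tendsto (fun x => smoothTransition x ^ 2) atTop (𝓝 1) := by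
  simpa only [one_pow] using tendsto_smoothTransition_atTop.pow 2

theorem tendsto_deriv_smoothTransition_atTop : Tendsto (deriv smoothTransition) atTop (𝓝 0) :=
  tendsto_const_nhds.congr' <| (eventually_ge_atTop 1).mono fun _ hx =>
    (deriv_smoothTransition_of_one_le hx).symm

section WeakDeriv

variable {Ω : Set ℝ} {u g : ℝ → ℂ}

theorem HasWeakDeriv.mono {Ω' : Set ℝ} (h : HasWeakDeriv Ω' u g) (hΩ : Ω ⊆ Ω') :
    HasWeakDeriv Ω u g :=
  hasWeakDeriv_iff.2 fun φ hφ => by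
    have hφ' : IsTestFunction Ω' φ :=
      ⟨hφ.contDiff, hφ.hasCompactSupport, hφ.tsupport_subset.trans hΩ⟩
    rw [hφ.deriv.setIntegral_mul, hφ.setIntegral_mul, ← hφ'.deriv.setIntegral_mul,
      ← hφ'.setIntegral_mul, hasWeakDeriv_iff.1 h φ hφ']

theorem HasWeakDeriv.translate (h : HasWeakDeriv Set.univ u g) (R : ℝ) :
    HasWeakDeriv Set.univ (fun x => u (x - R)) fun x => g (x - R) := by
  intro φ hφ hc _
  have hint := h (fun x => φ (x + R)) (hφ.comp (contDiff_id.add contDiff_const))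
    (hc.comp_homeomorph (Homeomorph.addRight R)) (Set.subset_univ _)
  simp only [Measure.restrict_univ, deriv_comp_add_const] at hint ⊢
  rw [← integral_sub_right_eq_self (fun x => ((deriv φ (x + R) : ℝ) : ℂ) * u x) R,
    ← integral_sub_right_eq_self (fun x => (φ (x + R) : ℂ) * g x) R] at hint
  simpa only [sub_add_cancel] using hint

theorem HasWeakDeriv.contDiff_mul (h : HasWeakDeriv Ω u g) (hu : LocallyIntegrableOn u Ω)
    (hg : LocallyIntegrableOn g Ω) {k : ℝ → ℝ} (hk : ContDiff ℝ (⊤ : ℕ∞) k) :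
    HasWeakDeriv Ω (fun x => (k x : ℂ) * u x)
      fun x => ((deriv k x : ℝ) : ℂ) * u x + (k x : ℂ) * g x :=
  hasWeakDeriv_iff.2 fun φ hφ => by
    have hmul : ∀ {m : ℝ → ℝ}, ContDiff ℝ (⊤ : ℕ∞) m → IsTestFunction Ω fun x => φ x * m x :=
      fun hm => ⟨hφ.contDiff.mul hm, hφ.hasCompactSupport.mul_right,
        (closure_mono (Function.support_mul_subset_left _ _)).trans hφ.tsupport_subset⟩
    have hk' : ContDiff ℝ (⊤ : ℕ∞) (deriv k) := (contDiff_infty_iff_deriv.1 hk).2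
    have hφku := (hmul hk).deriv.integrableOn_mul hu
    have hφk'u := (hmul hk').integrableOn_mul hu
    have hφkg := (hmul hk).integrableOn_mul hg
    have hderiv : ∀ x, deriv (fun x => φ x * k x) x = deriv φ x * k x + φ x * deriv k x :=
      fun x => deriv_fun_mul (hφ.contDiff.differentiable (by simp) x)
        (hk.differentiable (by simp) x)
    calc ∫ x in Ω, ((deriv φ x : ℝ) : ℂ) * (k x * u x)
        = ∫ x in Ω, (((deriv (fun x => φ x * k x) x : ℝ) : ℂ) * u x
            - ((φ x * deriv k x : ℝ) : ℂ) * u x) :=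
          integral_congr_ae (.of_forall fun x => by
            simp only [hderiv]
            push_cast
            ring)
      _ = -(∫ x in Ω, (((φ x * deriv k x : ℝ) : ℂ) * u x + ((φ x * k x : ℝ) : ℂ) * g x)) := by
          rw [integral_sub hφku hφk'u, integral_add hφk'u hφkg, hasWeakDeriv_iff.1 h _ (hmul hk)]
          ring
      _ = -∫ x in Ω, (φ x : ℂ) * (((deriv k x : ℝ) : ℂ) * u x + k x * g x) :=
          congrArg Neg.neg (integral_congr_ae (.of_forall fun x => by
            simp only
            push_cast
            ring))

end WeakDeriv

theorem memLp_comp_sub_right {F : Type*} [NormedAddCommGroup F] {p : ENNReal} {f : ℝ → F}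
    (hf : MemLp f p) (R : ℝ) : MemLp (fun x => f (x - R)) p :=
  hf.comp_measurePreserving (measurePreserving_sub_right volume R)

theorem memLp_ofReal_mul {μ : Measure ℝ} {p : ENNReal} {f : ℝ → ℂ} (hf : MemLp f p μ) {k : ℝ → ℝ}
    (hk : Continuous k) {C : ℝ} (hC : ∀ x, |k x| ≤ C) : MemLp (fun x => (k x : ℂ) * f x) p μ :=
  hf.of_le_mul (c := C)
    ((Complex.continuous_ofReal.comp hk).aestronglyMeasurable.mul hf.1) <| .of_forall fun x => by
      rw [norm_mul, Complex.norm_real]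
      exact mul_le_mul_of_nonneg_right (hC x) (norm_nonneg _)

theorem integrable_comp_add_mul {k : ℝ → ℝ} (hk : Continuous k) {C : ℝ} (hC : ∀ x, |k x| ≤ C)
    {f : ℝ → ℂ} (hf : Integrable f) (R : ℝ) : Integrable fun x => (k (x + R) : ℂ) * f x :=
  memLp_one_iff_integrable.1 <| memLp_ofReal_mul (memLp_one_iff_integrable.2 hf)
    (hk.comp (continuous_add_const R)) fun x => hC (x + R)

theorem tendsto_integral_comp_add_mul {k : ℝ → ℝ} (hk : Continuous k) {C : ℝ}
    (hC : ∀ x, |k x| ≤ C) {c : ℝ} (hc : Tendsto k atTop (𝓝 c)) {f : ℝ → ℂ} (hf : Integrable f) :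
    Tendsto (fun R => ∫ x, (k (x + R) : ℂ) * f x) atTop (𝓝 (c * ∫ x, f x)) := by
  rw [← integral_const_mul]
  refine tendsto_integral_filter_of_dominated_convergence (fun x => C * ‖f x‖)
    (.of_forall fun R => ?_) (.of_forall fun R => .of_forall fun x => ?_) (hf.norm.const_mul C)
    (.of_forall fun x => ?_)
  · exact (Complex.continuous_ofReal.comp
      (hk.comp (continuous_add_const R))).aestronglyMeasurable.mul hf.1
  · rw [norm_mul, Complex.norm_real]
    exact mul_le_mul_of_nonneg_right (hC _) (norm_nonneg _)
  · exact ((Complex.continuous_ofReal.tendsto c).comp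
      (hc.comp (tendsto_atTop_add_const_left atTop x tendsto_id))).mul_const _

theorem memLp_cutoff {f : ℝ → ℂ} (hf : MemLp f 2) (R : ℝ) {k : ℝ → ℝ} (hk : Continuous k) {C : ℝ}
    (hC : ∀ x, |k x| ≤ C) :
    MemLp (fun x => (k x : ℂ) * f (x - R)) 2 (volume.restrict (Set.Ioi 0)) :=
  memLp_ofReal_mul ((memLp_comp_sub_right hf R).restrict _) hk hC

/-- The function `u` on the line, shifted to the right by `R` and cut off smoothly on `(0, 1)`, as
a function on a half-line. -/
def cutoffLp (R : ℝ) (u : LineL2) : Lp ℂ 2 (volume.restrict (Set.Ioi (0 : ℝ))) :=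
  (memLp_cutoff (Lp.memLp u) R smoothTransition.continuous abs_smoothTransition_le_one).toLp

theorem coeFn_cutoffLp (R : ℝ) (u : LineL2) :
    cutoffLp R u =ᵐ[volume.restrict (Set.Ioi 0)] fun x => (smoothTransition x : ℂ) * u (x - R) :=
  MemLp.coeFn_toLp _

theorem hasWeakDeriv_cutoff (R : ℝ) {u : LineL2} (hu : MemH1 Set.univ u) :
    HasWeakDeriv (Set.Ioi 0) (fun x => (smoothTransition x : ℂ) * u (x - R)) fun x =>
      ((deriv smoothTransition x : ℝ) : ℂ) * u (x - R)
        + (smoothTransition x : ℂ) * weakDeriv Set.univ u (x - R) :=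
  have hloc {f : ℝ → ℂ} (hf : MemLp f 2) :
      LocallyIntegrableOn (fun x => f (x - R)) (Set.Ioi 0) :=
    ((memLp_comp_sub_right hf R).locallyIntegrable one_le_two).locallyIntegrableOn _
  ((hu.2.hasWeakDeriv.translate R).mono (Set.subset_univ _)).contDiff_mul (hloc (Lp.memLp u))
    (hloc (memLp_weakDeriv_edge u)) smoothTransition.contDiff

theorem exists_hasWeakDeriv_cutoffLp (R : ℝ) {u : LineL2} (hu : MemH1 Set.univ u) :
    ∃ g : Lp ℂ 2 (volume.restrict (Set.Ioi (0 : ℝ))),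
      HasWeakDeriv (Set.Ioi 0) (cutoffLp R u) g ∧ g =ᵐ[volume.restrict (Set.Ioi 0)] fun x =>
        ((deriv smoothTransition x : ℝ) : ℂ) * u (x - R)
          + (smoothTransition x : ℂ) * weakDeriv Set.univ u (x - R) := by
  obtain ⟨C, hC⟩ := exists_forall_abs_deriv_smoothTransition_le
  have hg := (memLp_cutoff (Lp.memLp u) R continuous_deriv_smoothTransition hC).add
    (memLp_cutoff (memLp_weakDeriv_edge (Ω := Set.univ) u) R smoothTransition.continuous
      abs_smoothTransition_le_one)
  exact ⟨hg.toLp, (hasWeakDeriv_cutoff R hu).congr (coeFn_cutoffLp R u).symm hg.coeFn_toLp.symm,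
    hg.coeFn_toLp⟩

theorem memH1_cutoffLp (R : ℝ) {u : LineL2} (hu : MemH1 Set.univ u) :
    MemH1 (Set.Ioi 0) (cutoffLp R u) :=
  have ⟨_, hg, _⟩ := exists_hasWeakDeriv_cutoffLp R hu
  hg.memH1

theorem weakDeriv_cutoffLp (R : ℝ) {u : LineL2} (hu : MemH1 Set.univ u) :
    weakDeriv (Set.Ioi 0) (cutoffLp R u) =ᵐ[volume.restrict (Set.Ioi 0)] fun x =>
      ((deriv smoothTransition x : ℝ) : ℂ) * u (x - R)
        + (smoothTransition x : ℂ) * weakDeriv Set.univ u (x - R) := by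
  obtain ⟨g, hg, hgu⟩ := exists_hasWeakDeriv_cutoffLp R hu
  refine (coeFn_derivLp _).symm.trans ?_
  rwa [hg.derivLp_eq]

theorem hasBoundaryValue_cutoffLp (R : ℝ) {u : LineL2} (hu : MemH1 Set.univ u) :
    HasBoundaryValue (cutoffLp R u) 0 := by
  obtain ⟨w, hw⟩ := hu.exists_isRep isOpen_univ Set.ordConnected_univ
  have hae : w =ᵐ[volume] u := IsEdge.ae_eq_restrict_iff.1 hw.ae_eq
  refine ⟨fun x => (smoothTransition x : ℂ) * w (x - R), ?_, ?_, ?_⟩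
  · exact ((Complex.continuous_ofReal.comp smoothTransition.continuous).mul
      (hw.isPrimitive.continuous.comp (continuous_sub_right R))).continuousOn
  · filter_upwards [coeFn_cutoffLp R u, ae_restrict_of_ae
      ((measurePreserving_sub_right volume R).quasiMeasurePreserving.ae_eq_comp hae)] with x hx hwx
    rw [hx]
    exact congrArg _ hwx
  · simp only [smoothTransition.zero, Complex.ofReal_zero, zero_mul]

theorem cutoffLp_mem_edgeDomain (R : ℝ) {V : ℝ → ℝ} {u : LineL2}
    (hu : u ∈ edgeDomain Set.univ volume V) :
    cutoffLp R u ∈ edgeDomain (Set.Ioi 0) (volume.restrict (Set.Ioi 0)) fun x => V (x - R) := by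
  have hint : Integrable (fun x => smoothTransition x ^ 2 *
      (max (V (x - R)) 0 * ‖u (x - R)‖ ^ 2)) (volume.restrict (Set.Ioi 0)) :=
    (hu.2.comp_sub_right R).restrict.bdd_mul (c := 1)
      continuous_smoothTransition_sq.aestronglyMeasurable
      (.of_forall abs_smoothTransition_sq_le_one)
  refine ⟨memH1_cutoffLp R hu.1, hint.congr ?_⟩
  filter_upwards [coeFn_cutoffLp R u] with x hx
  rw [hx, norm_mul, mul_pow, Complex.norm_real, Real.norm_eq_abs, sq_abs]
  ring

theorem setIntegral_Ioi_comp_sub_right {F : ℝ → ℂ} {R : ℝ} (hF : ∀ x, x + R ≤ 0 → F x = 0) :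
    ∫ x in Set.Ioi 0, F (x - R) = ∫ x, F x := by
  rw [← integral_sub_right_eq_self F R]
  refine setIntegral_eq_integral_of_forall_compl_eq_zero fun x hx => hF _ ?_
  rw [sub_add_cancel]
  exact not_lt.1 hx

theorem inner_cutoffLp (R : ℝ) (u v : LineL2) :
    inner ℂ (cutoffLp R u) (cutoffLp R v)
      = ∫ x, ((smoothTransition (x + R) ^ 2 : ℝ) : ℂ) * inner ℂ (u x) (v x) := by
  rw [L2.inner_def]
  refine Eq.trans (integral_congr_ae ?_) (setIntegral_Ioi_comp_sub_right (R := R) fun x hx => ?_)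
  · filter_upwards [coeFn_cutoffLp R u, coeFn_cutoffLp R v] with x hu hv
    rw [hu, hv, sub_add_cancel, RCLike.inner_apply, RCLike.inner_apply, map_mul,
      Complex.conj_ofReal, Complex.ofReal_pow]
    ring
  · rw [smoothTransition.zero_of_nonpos hx, zero_pow two_ne_zero, Complex.ofReal_zero, zero_mul]

theorem tendsto_inner_cutoffLp (u v : LineL2) :
    Tendsto (fun R => inner ℂ (cutoffLp R u) (cutoffLp R v)) atTop (𝓝 (inner ℂ u v)) := by
  simp only [inner_cutoffLp]
  simpa only [L2.inner_def, Complex.ofReal_one, one_mul] using tendsto_integral_comp_add_mul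
    continuous_smoothTransition_sq abs_smoothTransition_sq_le_one
    tendsto_smoothTransition_sq_atTop (L2.integrable_inner u v)

theorem edgeForm_cutoffLp (R : ℝ) (V : ℝ → ℝ) {u v : LineL2} (hu : MemH1 Set.univ u)
    (hv : MemH1 Set.univ v) :
    edgeForm (Set.Ioi 0) (volume.restrict (Set.Ioi 0)) (fun x => V (x - R))
        (cutoffLp R u) (cutoffLp R v)
      = ∫ x, (((smoothTransition (x + R) ^ 2 : ℝ) : ℂ)
            * (starRingEnd ℂ (weakDeriv Set.univ u x) * weakDeriv Set.univ v x
              + (V x : ℂ) * (starRingEnd ℂ (u x) * v x))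
          + ((deriv smoothTransition (x + R) ^ 2 : ℝ) : ℂ) * (starRingEnd ℂ (u x) * v x)
          + ((smoothTransition (x + R) * deriv smoothTransition (x + R) : ℝ) : ℂ)
            * (starRingEnd ℂ (u x) * weakDeriv Set.univ v x
              + starRingEnd ℂ (weakDeriv Set.univ u x) * v x)) := by
  unfold edgeForm
  refine Eq.trans (integral_congr_ae ?_) (setIntegral_Ioi_comp_sub_right (R := R) fun x hx => ?_)
  · filter_upwards [coeFn_cutoffLp R u, coeFn_cutoffLp R v, weakDeriv_cutoffLp R hu,
      weakDeriv_cutoffLp R hv] with x hux hvx hux' hvx'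
    rw [hux, hvx, hux', hvx']
    simp only [sub_add_cancel, map_add, map_mul, Complex.conj_ofReal, Complex.ofReal_mul,
      Complex.ofReal_pow]
    ring
  · simp only [smoothTransition.zero_of_nonpos hx, deriv_smoothTransition_of_nonpos hx, mul_zero,
      zero_pow two_ne_zero, Complex.ofReal_zero, zero_mul, add_zero]

theorem integrable_conj_mul {μ : Measure ℝ} {f g : ℝ → ℂ} (hf : MemLp f 2 μ) (hg : MemLp g 2 μ) :
    Integrable (fun x => starRingEnd ℂ (f x) * g x) μ :=
  hf.star.integrable_mul hg

theorem tendsto_edgeForm_cutoffLp {V : ℝ → ℝ} (hV : IsEdgePotential volume V) {u v : LineL2}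
    (hu : u ∈ edgeDomain Set.univ volume V) (hv : v ∈ edgeDomain Set.univ volume V) :
    Tendsto (fun R => edgeForm (Set.Ioi 0) (volume.restrict (Set.Ioi 0))
      (fun x => V (x - R)) (cutoffLp R u) (cutoffLp R v)) atTop
      (𝓝 (edgeForm Set.univ volume V u v)) := by
  obtain ⟨C, hC⟩ := exists_forall_abs_deriv_smoothTransition_le
  have hsq (x : ℝ) : |deriv smoothTransition x ^ 2| ≤ C ^ 2 := by
    rw [abs_pow]
    exact pow_le_pow_left₀ (abs_nonneg _) (hC x) 2
  have hmul (x : ℝ) : |smoothTransition x * deriv smoothTransition x| ≤ 1 * C := by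
    rw [abs_mul]
    exact mul_le_mul (abs_smoothTransition_le_one x) (hC x) (abs_nonneg _) zero_le_one
  have hu' := memLp_weakDeriv_edge (Ω := Set.univ) (μ := volume) u
  have hv' := memLp_weakDeriv_edge (Ω := Set.univ) (μ := volume) v
  have hform := (integrable_conj_mul hu' hv').add (integrable_potential_mul hV hu hv)
  have hinner := integrable_conj_mul (Lp.memLp u) (Lp.memLp v)
  have hcross := (integrable_conj_mul (Lp.memLp u) hv').add (integrable_conj_mul hu' (Lp.memLp v))
  have hχ' := continuous_deriv_smoothTransition.pow 2
  have hχχ' := smoothTransition.continuous.mul continuous_deriv_smoothTransition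
  have hlim := ((tendsto_integral_comp_add_mul continuous_smoothTransition_sq
      abs_smoothTransition_sq_le_one tendsto_smoothTransition_sq_atTop hform).add
    (tendsto_integral_comp_add_mul hχ' hsq (tendsto_deriv_smoothTransition_atTop.pow 2)
      hinner)).add
    (tendsto_integral_comp_add_mul hχχ' hmul
      (tendsto_smoothTransition_atTop.mul tendsto_deriv_smoothTransition_atTop) hcross)
  simp only [Complex.ofReal_one, one_mul, mul_zero, zero_pow two_ne_zero, Complex.ofReal_zero,
    zero_mul, add_zero] at hlim
  refine hlim.congr fun R => Eq.symm ?_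
  have hi := integrable_comp_add_mul continuous_smoothTransition_sq abs_smoothTransition_sq_le_one
    hform R
  have hi' := integrable_comp_add_mul hχ' hsq hinner R
  exact (edgeForm_cutoffLp R V hu.1 hv.1).trans <|
    (integral_add (hi.add hi') (integrable_comp_add_mul hχχ' hmul hcross R)).trans <|
      congrArg (· + _) (integral_add hi hi')

end Cutoff

/-! ### From the star graph to the line -/

section LowerBound

theorem LinePotential.comp_sub_right {p : ℝ} {V : ℝ → ℝ} (hV : LinePotential p V) (R : ℝ) :
    LinePotential p fun x => V (x - R) := by
  refine ⟨?_, memLp_comp_sub_right hV.2 R⟩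
  have hmap := (measurePreserving_sub_right volume R).map_eq
  exact (locallyIntegrable_map_homeomorph (Homeomorph.subRight R)).1 (hmap.symm ▸ hV.1)

variable {N : ℕ} {V : Fin N → ℝ → ℝ} {W : ℝ → ℝ} {j₀ : Fin N}

theorem LinePotential.starPotential_single {p : ℝ} (hW : LinePotential p W) (j₀ : Fin N) :
    StarPotential p (Pi.single j₀ W) := by
  intro j
  obtain rfl | h := eq_or_ne j j₀
  · rw [Pi.single_eq_same]
    exact ⟨hW.1.locallyIntegrableOn _, hW.2.restrict _⟩
  · simp only [Pi.single_eq_of_ne h, Pi.zero_apply, neg_zero, max_self]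
    exact ⟨(locallyIntegrable_const 0).locallyIntegrableOn _, MemLp.zero'⟩

theorem sum_lintegral_single {p : ℝ} (hp : 0 < p) (W : ℝ → ℝ) (j₀ : Fin N) :
    ∑ j, ∫⁻ x in Set.Ioi (0 : ℝ),
        ENNReal.ofReal (max (-(Pi.single j₀ W : Fin N → ℝ → ℝ) j x) 0 ^ p)
      = ∫⁻ x in Set.Ioi (0 : ℝ), ENNReal.ofReal (max (-W x) 0 ^ p) := by
  rw [Finset.sum_eq_single_of_mem j₀ (Finset.mem_univ _) fun j _ h => ?_, Pi.single_eq_same]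
  simp only [Pi.single_eq_of_ne h, Pi.zero_apply, neg_zero, max_self, Real.zero_rpow hp.ne',
    ENNReal.ofReal_zero, lintegral_zero]

theorem single_mem_starDomain {u : Lp ℂ 2 (volume.restrict (Set.Ioi (0 : ℝ)))}
    (hu : u ∈ edgeDomain (Set.Ioi 0) (volume.restrict (Set.Ioi 0)) (V j₀))
    (hb : HasBoundaryValue u 0) : (PiLp.single 2 j₀ u : StarL2 N) ∈ starDomain V := by
  refine mem_starDomain.2 ⟨fun j => ?_, 0, fun j => ?_⟩ <;> obtain rfl | h := eq_or_ne j j₀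
  · rwa [PiLp.single_eq_same]
  · rw [PiLp.single_eq_of_ne _ h]
    exact zero_mem_edgeDomain
  · rwa [PiLp.single_eq_same]
  · rw [PiLp.single_eq_of_ne _ h]
    exact hasBoundaryValue_zero

theorem starForm_single (hV : ∀ j, IsEdgePotential (volume.restrict (Set.Ioi 0)) (V j))
    (j₀ : Fin N) (u v : Lp ℂ 2 (volume.restrict (Set.Ioi (0 : ℝ)))) :
    starForm V (PiLp.single 2 j₀ u) (PiLp.single 2 j₀ v)
      = edgeForm (Set.Ioi 0) (volume.restrict (Set.Ioi 0)) (V j₀) u v := by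
  rw [starForm_eq_sumForm, sumForm,
    Finset.sum_eq_single_of_mem j₀ (Finset.mem_univ _) fun j _ h => ?_]
  · simp only [PiLp.single_eq_same]
  · simp only [PiLp.single_eq_of_ne _ h]
    exact (isHermitianForm_edgeForm (hV j)).zero_left zero_mem_edgeDomain

theorem inner_single (j₀ : Fin N) (u v : Lp ℂ 2 (volume.restrict (Set.Ioi (0 : ℝ)))) :
    inner ℂ (PiLp.single 2 j₀ u : StarL2 N) (PiLp.single 2 j₀ v) = inner ℂ u v := by
  rw [PiLp.inner_apply, Finset.sum_eq_single_of_mem j₀ (Finset.mem_univ _) fun j _ h => ?_]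
  · simp only [PiLp.single_eq_same]
  · simp only [PiLp.single_eq_of_ne _ h, inner_zero_left]

theorem lineLiebThirring_of_star {γ : ℝ} (hγ : 1 / 2 ≤ γ) (hN : 1 ≤ N) {L : ENNReal}
    (hL : StarLiebThirring γ N L) : LineLiebThirring γ L := by
  intro W hW
  have hp : 1 ≤ γ + 1 / 2 := by linarith
  set j₀ : Fin N := ⟨0, hN⟩
  set V : ℝ → Fin N → ℝ → ℝ := fun R => Pi.single j₀ fun x => W (x - R)
  have hVj₀ (R : ℝ) : V R j₀ = fun x => W (x - R) := Pi.single_eq_same _ _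
  have hV (R : ℝ) : StarPotential (γ + 1 / 2) (V R) := (hW.comp_sub_right R).starPotential_single j₀
  have hVe (R : ℝ) := fun j => (hV R).isEdgePotential hp j
  have hWe := hW.isEdgePotential hp
  refine (isHermitianForm_edgeForm hWe).negTrace_le_of_tendsto (by linarith) (F := atTop)
    (fun R => isClosedForm_starForm (hVe R))
    (J := fun R u => PiLp.single 2 j₀ (cutoffLp R u)) (fun R u hu => ?_) (fun u _ v _ => ?_)
    (fun u hu v hv => ?_) fun R => (hL _ (hV R)).trans ?_
  · refine single_mem_starDomain ?_ (hasBoundaryValue_cutoffLp R hu.1)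
    rw [hVj₀]
    exact cutoffLp_mem_edgeDomain R hu
  · simpa only [inner_single] using tendsto_inner_cutoffLp u v
  · simpa only [starForm_single (hVe _), hVj₀] using tendsto_edgeForm_cutoffLp hWe hu hv
  · gcongr
    rw [sum_lintegral_single (by linarith),
      ← lintegral_sub_right_eq_self (fun x => ENNReal.ofReal (max (-W x) 0 ^ (γ + 1 / 2))) R]
    exact setLIntegral_le_lintegral _ _

end LowerBound

theorem starConst_eq_of_even {γ : ℝ} (hγ : 1 / 2 ≤ γ) {N : ℕ} (hN : 1 ≤ N) (he : Even N) :
    starConst γ N = lineConst γ :=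
  le_antisymm (le_sInf fun _ hL => sInf_le (starLiebThirring_of_even hγ he hL))
    (le_sInf fun _ hL => sInf_le (lineLiebThirring_of_star hγ hN hL))

theorem starConst_le_of_odd {γ : ℝ} (hγ : 1 / 2 ≤ γ) {N : ℕ} (ho : Odd N) :
    starConst γ N ≤ ((N : ENNReal) + 1) / (N : ENNReal) * lineConst γ := by
  have hN : (N : ENNReal) ≠ 0 := Nat.cast_ne_zero.2 ho.pos.ne'
  have hN' := ENNReal.natCast_ne_top N
  rw [lineConst, sInf_eq_iInf', ENNReal.mul_iInf_of_ne (ENNReal.div_pos (by simp) hN').ne'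
    (ENNReal.div_ne_top (ENNReal.add_ne_top.2 ⟨hN', ENNReal.one_ne_top⟩) hN)]
  exact le_iInf fun L => sInf_le (starLiebThirring_of_odd hγ ho L.2)

end StarLT

end

theorem theorem1 (γ : ℝ) (hγ : 1 / 2 ≤ γ) (N : ℕ) (hN : 1 ≤ N) :
    (Even N → StarLT.starConst γ N = StarLT.lineConst γ) ∧
    (Odd N → StarLT.starConst γ N ≤ ((N : ENNReal) + 1) / (N : ENNReal) * StarLT.lineConst γ) := by
  exact ⟨StarLT.starConst_eq_of_even hγ hN, StarLT.starConst_le_of_odd hγ⟩
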